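/- Let $d\ge 0$. A staircase is $\gamma\in\mathbb Z^d$ with $\gamma_1\ge\dots\ge\gamma_d$, and $\mathcal Q_\gamma$ denotes the irreducible unitary representation of $U(d)$ with highest weight $\gamma$, with action $r_\gamma$. Fix an arbitrary orthonormal basis in every $\mathcal Q_\gamma$; transposes and complex conjugates are taken in these bases, and in the standard bases of the spaces $\mathbb C^c$. Let $\overline{\mathcal Q_\gamma}$ be the dual representation, i.e. the same space with action $g\mapsto\overline{r_\gamma(g)}$. For $R,S$ each of the form $\mathcal Q_\nu$ or $\overline{\mathcal Q_\nu}$ let $c_{R,S}^{\gamma}$ be the multiplicity of $\mathcal Q_\gamma$ in $R\otimes S$ (as representations of $U(d)$). A Clebsch–Gordan transform of $R\otimes S$ is a unitary $$U:\ R\otimes S\longrightarrow\bigoplus_{\gamma:\,c_{R,S}^\gamma\ge 1}\mathcal Q_\gamma\otimes\mathbb C^{c_{R,S}^\gamma}$$ commuting with the action of $SU(d)$; for $\psi\in\mathbb C^{c_{R,S}^\gamma}$ put $\iota_U^{\gamma,\psi}:\mathcal Q_\gamma\to R\otimes S$, $\iota_U^{\gamma,\psi}(q)=U^*(q\otimes\psi)$.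 We write $\overline\lambda,\overline\gamma$ in indices for $\overline{\mathcal Q_\lambda},\overline{\mathcal Q_\gamma}$, and $\overline\lambda+_d\mu=\{\gamma: c_{\overline\lambda,\mu}^\gamma\ge1\}$. Let $\lambda,\mu$ be staircases, and let $\mathcal C_u(\mathcal Q_\lambda,\mathcal Q_\mu)$ be the convex set of completely positive trace-preserving linear maps $\Phi:\mathcal B(\mathcal Q_\lambda)\to\mathcal B(\mathcal Q_\mu)$ with $\Phi(r_\lambda(g)Ar_\lambda(g)^*)=r_\mu(g)\Phi(A)r_\mu(g)^*$ for all $g\in SU(d)$ and all $A$. Clebsch–Gordan transforms of $\overline{\mathcal Q_\lambda}\otimes\mathcal Q_\mu$ exist. Let $U$ be any of them. For $\gamma\in\overline\lambda+_d\mu$ and a unit vector $\psi\in\mathbb C^{c_{\overline\lambda,\mu}^\gamma}$ let $\Phi_{\lambda,\mu}^{\gamma,\psi}$ be the linear map with Choi matrix $$\sum_{i,j}|i\rangle\langle j|\otimes\Phi_{\lambda,\mu}^{\gamma,\psi}(|i\rangle\langle j|)=\frac{\dim\mathcal Q_\lambda}{\dim\mathcal Q_\gamma}\,U^*\bigl(1_{\mathcal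 Q_\gamma}\otimes|\psi\rangle\langle\psi|\bigr)U .$$ **Theorem.** (a) The set of extreme points of $\mathcal C_u(\mathcal Q_\lambda,\mathcal Q_\mu)$ is exactly the set of all maps $\Phi_{\lambda,\mu}^{\gamma,\psi}$ with $\gamma\in\overline\lambda+_d\mu$ and $\psi\in\mathbb C^{c_{\overline\lambda,\mu}^\gamma}$ a unit vector. (b) For every $\gamma\in\overline\lambda+_d\mu$ one has $c_{\overline\lambda,\mu}^\gamma=c_{\mu,\overline\gamma}^\lambda=c_{\lambda,\gamma}^\mu=:c$, and there are Clebsch–Gordan transforms $V$ of $\mathcal Q_\mu\otimes\overline{\mathcal Q_\gamma}$ and $W$ of $\mathcal Q_\lambda\otimes\mathcal Q_\gamma$ such that for all unit vectors $\psi\in\mathbb C^c$ and all $A\in\mathcal B(\mathcal Q_\lambda)$ $$\Phi_{\lambda,\mu}^{\gamma,\psi}(A)=\frac{\dim\mathcal Q_\lambda}{\dim\mathcal Q_\gamma}\operatorname{tr}_{\overline{\mathcal Q_\lambda}}\Bigl[\iota_U^{\gamma,\psi}(\iota_U^{\gamma,\psi})^*(A^T\otimes 1_{\mathcal Q_\mu})\Bigr],$$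 $$\Phi_{\lambda,\mu}^{\gamma,\psi}(A)=\operatorname{tr}_{\overline{\mathcal Q_\gamma}}\Bigl[\iota_V^{\lambda,\psi}A(\iota_V^{\lambda,\psi})^*\Bigr],$$ $$\Phi_{\lambda,\mu}^{\gamma,\psi}(A)=\frac{\dim\mathcal Q_\lambda}{\dim\mathcal Q_\mu}(\iota_W^{\mu,\overline\psi})^*(A\otimes 1_{\mathcal Q_\gamma})\,\iota_W^{\mu,\overline\psi},$$ where $\overline\psi$ is the entrywise complex conjugate of $\psi$. -/

import Mathlib

open scoped Matrix Kronecker ComplexOrder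

noncomputable section

namespace EquivChannel

/-! ### The unitary groups -/

/-- The unitary group `U(d)`. -/
abbrev U (d : ℕ) : Type := Matrix.unitaryGroup (Fin d) ℂ

/-- The special unitary group `SU(d)`. -/
abbrev SU (d : ℕ) : Type := Matrix.specialUnitaryGroup (Fin d) ℂ

/-- The inclusion `SU(d) → U(d)`. -/
def SU.incl {d : ℕ} : SU d →* U d :=
  Submonoid.inclusion Matrix.specialUnitaryGroup_le_unitaryGroup

/-! ### Staircases and the irreducible representations they label -/

/-- A staircase: integers `γ₁ ≥ γ₂ ≥ ⋯ ≥ γ_d`. -/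
abbrev Staircase (d : ℕ) : Type := {γ : Fin d → ℤ // Antitone γ}

variable {d : ℕ}

/-- The last entry `γ_d` (and `0` if `d = 0`). -/
def Staircase.last (γ : Staircase d) : ℤ :=
  if h : 0 < d then γ.1 ⟨d - 1, by omega⟩ else 0

/-- The `i`-th row length of the partition `γ - (γ_d, …, γ_d)`. -/
def Staircase.rowLen (γ : Staircase d) (i : Fin d) : ℕ := (γ.1 i - γ.last).toNat

/-- The boxes (row, column) of the Young diagram of the partition `γ - (γ_d, …, γ_d)`. -/
abbrev Box (γ : Staircase d) : Type := Σ i : Fin d, Fin (γ.rowLen i)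

/-- The tensor power `(ℂ^d)^{⊗ m}`, with one tensor factor for each of the `m` boxes of
`γ - (γ_d, …, γ_d)`, with its standard inner product and product basis. -/
abbrev Tensor (γ : Staircase d) : Type := EuclideanSpace ℂ (Box γ → Fin d)

/-- The action `g ↦ det(g)^{γ_d} · g^{⊗ m}` of `U(d)` on the tensor power, as matrices. -/
def tensorMat (γ : Staircase d) : U d →* Matrix (Box γ → Fin d) (Box γ → Fin d) ℂ where
  toFun g := Matrix.of fun f f' =>
    (g : Matrix (Fin d) (Fin d) ℂ).det ^ γ.last *
      ∏ x, (g : Matrix (Fin d) (Fin d) ℂ) (f x) (f' x)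
  map_one' := by
    ext f f'
    simp only [OneMemClass.coe_one, Matrix.det_one, one_zpow, one_mul, Matrix.of_apply,
      Matrix.one_apply]
    by_cases h : f = f'
    · simp [h]
    · rw [if_neg h]
      obtain ⟨x, hx⟩ := Function.ne_iff.1 h
      exact Finset.prod_eq_zero (Finset.mem_univ x) (if_neg hx)
  map_mul' g h := by
    ext f f'
    simp only [Matrix.of_apply, Submonoid.coe_mul, Matrix.det_mul, Matrix.mul_apply, mul_zpow,
      Finset.prod_univ_sum, Fintype.piFinset_univ, Finset.mul_sum, Finset.prod_mul_distrib]
    refine Finset.sum_congr rfl fun k _ => ?_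
    ring

/-- The action of `U(d)` on the tensor power, as a representation. -/
def tensorRep (γ : Staircase d) : Representation ℂ (U d) (Tensor γ) where
  toFun g := Matrix.toLpLin 2 2 (tensorMat γ g)
  map_one' := by
    rw [map_one]; exact Matrix.toLpLin_one 2
  map_mul' g h := by
    rw [map_mul]; exact Matrix.toLpLin_mul_same 2 _ _

/-- The highest weight vector: the row tensor `⊗_{x} e_{row x}` antisymmetrized along the columns
of the diagram, i.e. `∑_σ sgn(σ) ⊗_x e_{row (σ x)}`, the sum being over the permutations of the
boxes that preserve every column (the determinant below is this signed sum, read off at the basis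
tensor `⊗_x e_{f x}`). -/
def hwVec (γ : Staircase d) : Tensor γ :=
  WithLp.toLp 2 fun f => Matrix.det (Matrix.of fun x y : Box γ =>
    if (x.2 : ℕ) = (y.2 : ℕ) ∧ f x = y.1 then (1 : ℂ) else 0)

/-- The irreducible representation `Q_γ` with highest weight `γ`: the subspace of the tensor power
generated by the highest weight vector under `U(d)`. -/
def Q (γ : Staircase d) : Submodule ℂ (Tensor γ) :=
  Submodule.span ℂ (Set.range fun g : U d => tensorRep γ g (hwVec γ))

theorem tensorRep_mem_Q (γ : Staircase d) (g : U d) :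
    ∀ v ∈ Q γ, tensorRep γ g v ∈ Q γ := by
  intro v hv
  have : Q γ ≤ (Q γ).comap (tensorRep γ g) := by
    refine Submodule.span_le.2 ?_
    rintro _ ⟨h, rfl⟩
    refine Submodule.subset_span ⟨g * h, ?_⟩
    simp [map_mul]
  exact this hv

/-- The action of `U(d)` on `Q_γ`. -/
def irrep (γ : Staircase d) : Representation ℂ (U d) (Q γ) where
  toFun g := (tensorRep γ g).restrict (tensorRep_mem_Q γ g)
  map_one' := by
    ext v : 2
    simp
  map_mul' g h := by
    ext v : 2
    simp [map_mul]

/-- `dim Q_γ`. -/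
def dimQ (γ : Staircase d) : ℕ := Module.finrank ℂ (Q γ)

/-- A choice of an orthonormal basis in every `Q_γ`. Transposes and complex conjugates are taken
in these bases, and operators are written as matrices in them. -/
abbrev Bases (d : ℕ) : Type :=
  ∀ γ : Staircase d, OrthonormalBasis (Fin (dimQ γ)) ℂ (Q γ)

/-! ### Matrix representations -/

/-- A representation of `U(d)` by matrices. -/
abbrev MatRep (d : ℕ) (n : Type) [Fintype n] [DecidableEq n] : Type :=
  U d →* Matrix n n ℂ

/-- `Q_γ` written in the chosen basis. -/
def rep (b : Bases d) (γ : Staircase d) : MatRep d (Fin (dimQ γ)) where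
  toFun g := LinearMap.toMatrix (b γ).toBasis (b γ).toBasis (irrep γ g)
  map_one' := by rw [map_one]; exact LinearMap.toMatrix_one _
  map_mul' g h := by rw [map_mul]; exact LinearMap.toMatrix_mul _ _ _

variable {m n : Type} [Fintype m] [DecidableEq m] [Fintype n] [DecidableEq n]

/-- The dual (complex conjugate) representation `g ↦ conj (r g)`. -/
def conjRep (R : MatRep d m) : MatRep d m where
  toFun g := (R g).map star
  map_one' := by rw [map_one]; exact Matrix.map_one _ (star_zero ℂ) (star_one ℂ)
  map_mul' g h := by
    rw [map_mul]
    ext i j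
    simp [Matrix.mul_apply]

/-- The tensor product of two representations. -/
def tensor (R : MatRep d m) (S : MatRep d n) : MatRep d (m × n) where
  toFun g := R g ⊗ₖ S g
  map_one' := by rw [map_one, map_one]; exact Matrix.one_kronecker_one
  map_mul' g h := by rw [map_mul, map_mul]; exact Matrix.mul_kronecker_mul _ _ _ _

/-- The space of operators from `R` to `S` that commute with the action of `U(d)`. -/
def intertwiners (R : MatRep d m) (S : MatRep d n) : Submodule ℂ (Matrix n m ℂ) where
  carrier := {M | ∀ g, S g * M = M * R g}
  add_mem' := by
    intro A B hA hB g
    rw [Matrix.mul_add, Matrix.add_mul, hA g, hB g]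
  zero_mem' := by intro g; simp
  smul_mem' := by
    intro c A hA g
    rw [Matrix.mul_smul, Matrix.smul_mul, hA g]

/-- The multiplicity of `Q_γ` in `R ⊗ S`. For `R`, `S` irreducible this is the
Littlewood-Richardson coefficient. Using `U(d)` rather than `SU(d)` here separates the labels `γ`
and `γ + (k, …, k)`, which give isomorphic representations of `SU(d)`. -/
def mult (b : Bases d) (R : MatRep d m) (S : MatRep d n) (γ : Staircase d) : ℕ :=
  Module.finrank ℂ (intertwiners (rep b γ) (tensor R S))

/-- The set of labels `γ` for which `Q_γ` occurs in `R ⊗ S`. -/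
def labels (b : Bases d) (R : MatRep d m) (S : MatRep d n) : Set (Staircase d) :=
  {γ | 1 ≤ mult b R S γ}

/-! ### Clebsch-Gordan transforms -/

/-- A Clebsch-Gordan transform: a unitary
`R ⊗ S → ⨁_γ Q_γ ⊗ ℂ^{c_γ}` commuting with the action of `SU(d)`, where `γ` runs over the (finite)
set `support` of all labels that occur in `R ⊗ S`, and `c_γ` is the multiplicity of `Q_γ`. -/
structure CGTransform (b : Bases d) (R : MatRep d m) (S : MatRep d n) where
  support : Finset (Staircase d)
  mem_support : ∀ γ, γ ∈ support ↔ γ ∈ labels b R S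
  mat : Matrix (Σ γ : support, Fin (dimQ γ.1) × Fin (mult b R S γ.1)) (m × n) ℂ
  mul_conjTranspose : mat * matᴴ = 1
  conjTranspose_mul : matᴴ * mat = 1
  commutes : ∀ g : SU d,
    mat * tensor R S (SU.incl g) =
      Matrix.blockDiagonal' (fun γ : support =>
        rep b γ.1 (SU.incl g) ⊗ₖ (1 : Matrix (Fin (mult b R S γ.1)) (Fin (mult b R S γ.1)) ℂ))
        * mat

/-- The embedding `ι^{γ,ψ} : Q_γ → R ⊗ S`, `q ↦ U_CG^* (q ⊗ ψ)`. -/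
def CGTransform.embed {b : Bases d} {R : MatRep d m} {S : MatRep d n} (T : CGTransform b R S)
    (γ : Staircase d) (ψ : Fin (mult b R S γ) → ℂ) : Matrix (m × n) (Fin (dimQ γ)) ℂ :=
  Matrix.of fun x q => ∑ k, T.matᴴ x ⟨⟨γ, (T.mem_support γ).2 k.pos⟩, (q, k)⟩ * ψ k

/-- The operator `1_{Q_γ} ⊗ |ψ⟩⟨ψ|` on `⨁_γ' Q_γ' ⊗ ℂ^{c_γ'}`, zero on the summands
`γ' ≠ γ`. -/
def CGTransform.block {b : Bases d} {R : MatRep d m} {S : MatRep d n} (T : CGTransform b R S)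
    (γ : Staircase d) (hγ : γ ∈ labels b R S) (ψ : Fin (mult b R S γ) → ℂ) :
    Matrix (Σ γ : T.support, Fin (dimQ γ.1) × Fin (mult b R S γ.1))
      (Σ γ : T.support, Fin (dimQ γ.1) × Fin (mult b R S γ.1)) ℂ :=
  Matrix.blockDiagonal' (Pi.single
    (M := fun γ' : T.support => Matrix (Fin (dimQ γ'.1) × Fin (mult b R S γ'.1))
      (Fin (dimQ γ'.1) × Fin (mult b R S γ'.1)) ℂ)
    ⟨γ, (T.mem_support γ).2 hγ⟩
    ((1 : Matrix (Fin (dimQ γ)) (Fin (dimQ γ)) ℂ) ⊗ₖ Matrix.vecMulVec ψ (star ψ)))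

/-! ### Quantum channels -/

/-- The partial trace over the first tensor factor. -/
def traceFst (X : Matrix (m × n) (m × n) ℂ) : Matrix n n ℂ :=
  Matrix.of fun a a' => ∑ i, X (i, a) (i, a')

/-- The partial trace over the second tensor factor. -/
def traceSnd (X : Matrix (m × n) (m × n) ℂ) : Matrix m m ℂ :=
  Matrix.of fun i i' => ∑ a, X (i, a) (i', a)

/-- Complete positivity: `id_k ⊗ Φ` maps positive operators to positive operators, for all `k`. -/
def IsCP (Φ : Matrix m m ℂ →ₗ[ℂ] Matrix n n ℂ) : Prop :=
  ∀ (k : ℕ) (X : Matrix (Fin k × m) (Fin k × m) ℂ), X.PosSemidef →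
    (Matrix.of fun p q : Fin k × n =>
      Φ (Matrix.of fun i j => X (p.1, i) (q.1, j)) p.2 q.2).PosSemidef

/-- A quantum channel: completely positive and trace preserving. -/
def IsChannel (Φ : Matrix m m ℂ →ₗ[ℂ] Matrix n n ℂ) : Prop :=
  IsCP Φ ∧ ∀ A, (Φ A).trace = A.trace

/-- The set of `SU(d)`-equivariant quantum channels from `R` to `S`. -/
def equivariantChannels (R : MatRep d m) (S : MatRep d n) :
    Set (Matrix m m ℂ →ₗ[ℂ] Matrix n n ℂ) :=
  {Φ | IsChannel Φ ∧ ∀ (g : SU d) (A : Matrix m m ℂ),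
    Φ (R (SU.incl g) * A * (R (SU.incl g))ᴴ) = S (SU.incl g) * Φ A * (S (SU.incl g))ᴴ}

/-- The Choi matrix `∑_{ij} |i⟩⟨j| ⊗ Φ(|i⟩⟨j|)`. -/
def choi (Φ : Matrix m m ℂ →ₗ[ℂ] Matrix n n ℂ) : Matrix (m × n) (m × n) ℂ :=
  ∑ i, ∑ j, Matrix.single i j (1 : ℂ) ⊗ₖ Φ (Matrix.single i j 1)

/-- The linear map with a given Choi matrix. -/
def ofChoi (C : Matrix (m × n) (m × n) ℂ) : Matrix m m ℂ →ₗ[ℂ] Matrix n n ℂ where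
  toFun A := Matrix.of fun a a' => ∑ i, ∑ j, A i j * C (i, a) (j, a')
  map_add' A B := by
    ext a a'
    simp [add_mul, Finset.sum_add_distrib]
  map_smul' c A := by
    ext a a'
    simp [mul_assoc, Finset.mul_sum]

theorem choi_ofChoi (C : Matrix (m × n) (m × n) ℂ) : choi (ofChoi C) = C := by
  ext ⟨i, a⟩ ⟨j, a'⟩
  simp [choi, ofChoi, Matrix.sum_apply, Matrix.single_apply, ite_and]

theorem ofChoi_choi (Φ : Matrix m m ℂ →ₗ[ℂ] Matrix n n ℂ) : ofChoi (choi Φ) = Φ := by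
  refine Matrix.ext_linearMap _ fun i j => ?_
  ext a a'
  simp [choi, ofChoi, Matrix.sum_apply, Matrix.single_apply, ite_and]

/-- The map `Φ_{λ,μ}^{γ,ψ}`, defined through its Choi matrix
`(dim Q_λ / dim Q_γ) · U_CG^* (1_{Q_γ} ⊗ |ψ⟩⟨ψ|) U_CG`, where `U_CG = T` is a Clebsch-Gordan
transform of `conj Q_λ ⊗ Q_μ`. -/
def extremalMap {b : Bases d} {lam mu : Staircase d}
    (T : CGTransform b (conjRep (rep b lam)) (rep b mu))
    (γ : Staircase d) (hγ : γ ∈ labels b (conjRep (rep b lam)) (rep b mu))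
    (ψ : Fin (mult b (conjRep (rep b lam)) (rep b mu) γ) → ℂ) :
    Matrix (Fin (dimQ lam)) (Fin (dimQ lam)) ℂ →ₗ[ℂ] Matrix (Fin (dimQ mu)) (Fin (dimQ mu)) ℂ :=
  ofChoi (((dimQ lam : ℂ) / (dimQ γ : ℂ)) • (T.matᴴ * T.block γ hγ ψ * T.mat))

end EquivChannel

end

/-!
Passing to Choi matrices turns an equivariant channel into a positive operator on
`conj Q_λ ⊗ Q_μ` that commutes with the group. By Schur's lemma a Clebsch-Gordan transform
identifies such operators with families of positive matrices on the multiplicity spaces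
`ℂ^{c_γ}`, and since `Q_λ` is irreducible, trace preservation becomes one linear equation: the
weighted sum of the traces equals `1`. The extreme points of the resulting convex set are the
families concentrated on a single `γ` and of rank one there.

The two other forms of the extremal channels come from reading an invariant tensor of
`Q_λ`, `Q_μ`, `Q_γ` as an operator in three ways. Moving a leg from output to input preserves
invariance and Hilbert-Schmidt inner products, so, up to a scalar, an orthonormal basis of
intertwiners for one of the three tensor products yields one for each of the others.

Schur's lemma needs `Q_γ` to be irreducible and the `Q_γ` to be pairwise inequivalent. Both follow
by differentiating at the identity: every nonzero invariant subspace contains a highest weight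
vector, whose weight and, in `Q_γ`, direction are determined. The group `SU(d)` may be replaced by
`U(d)` because the centre of `U(d)` acts by scalars on all the representations involved.
-/

noncomputable section

namespace EquivChannel

/-! ### One-parameter subgroups of the unitary group -/

section OneParameter

open selfAdjoint Unitary Complex

theorem expUnitary_argSelfAdjoint_of_continuousOn {A : Type*} [CStarAlgebra A] {u : unitary A}
    (hu : ContinuousOn arg (spectrum ℂ (u : A))) : expUnitary (argSelfAdjoint u) = u := by
  ext
  rw [expUnitary_coe, argSelfAdjoint_coe, ← CFC.exp_eq_normedSpace_exp (𝕜 := ℂ),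
    ← cfc_comp_smul .., ← cfc_comp' ..]
  conv_rhs => rw [← cfc_id' ℂ (u : A)]
  refine cfc_congr fun z hz => ?_
  have hz1 : ‖z‖ = 1 := spectrum.norm_eq_one_of_unitary u.2 hz
  simpa [← exp_eq_exp_ℂ, hz1, mul_comm I] using norm_mul_exp_arg_mul_I z

theorem eq_exp_smul_of_hasDerivAt_zero {𝔸 : Type*} [NormedRing 𝔸] [NormedAlgebra ℝ 𝔸]
    [CompleteSpace 𝔸] {u : ℝ → 𝔸} {a : 𝔸} (hzero : u 0 = 1) (hadd : ∀ s t, u (s + t) = u s * u t)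
    (hderiv : HasDerivAt u a 0) (t : ℝ) : u t = NormedSpace.exp (t • a) := by
  have hu (t : ℝ) : HasDerivAt u (u t * a) t := by
    have h := (hderiv.scomp_of_eq t ((hasDerivAt_id t).sub_const t) (by simp)).const_mul (u t)
    rw [one_smul] at h
    exact h.congr_of_eventuallyEq (.of_forall fun s => by simp [← hadd])
  let +nondep : NormedAlgebra ℚ 𝔸 := .restrictScalars ℚ ℝ 𝔸
  have hconst : u t * NormedSpace.exp (t • -a) = u 0 * NormedSpace.exp ((0 : ℝ) • -a) := by
    have hd (s : ℝ) : HasDerivAt (fun s => u s * NormedSpace.exp (s • -a)) 0 s :=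
      ((hu s).mul (hasDerivAt_exp_smul_const' (-a) s)).congr_deriv (by simp [mul_assoc])
    exact is_const_of_deriv_eq_zero (fun s => (hd s).differentiableAt) (fun s => (hd s).deriv) t 0
  have hinv : NormedSpace.exp (t • -a) * NormedSpace.exp (t • a) = 1 := by
    rw [← NormedSpace.exp_add_of_commute (((Commute.refl a).neg_left.smul_left t).smul_right t)]
    simp
  simpa only [mul_assoc, hinv, zero_smul, NormedSpace.exp_zero, hzero, one_mul, mul_one] using
    congrArg (· * NormedSpace.exp (t • a)) hconst

open scoped Matrix.Norms.L2Operator in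
theorem exists_expUnitary_eq {d : ℕ} (g : U d) :
    ∃ H : selfAdjoint (Matrix (Fin d) (Fin d) ℂ), expUnitary H = g :=
  ⟨argSelfAdjoint g,
    expUnitary_argSelfAdjoint_of_continuousOn ((Matrix.finite_spectrum _).continuousOn _)⟩

theorem expUnitary_add_smul {A : Type*} [CStarAlgebra A] (H : selfAdjoint A) (s t : ℝ) :
    expUnitary ((s + t) • H) = expUnitary (s • H) * expUnitary (t • H) := by
  rw [add_smul, Commute.expUnitary_add]
  exact ((Commute.refl (H : A)).smul_left s).smul_right t

theorem expUnitary_neg_smul {A : Type*} [CStarAlgebra A] (H : selfAdjoint A) (t : ℝ) :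
    expUnitary (-t • H) = (expUnitary (t • H))⁻¹ := by
  rw [eq_inv_iff_mul_eq_one, ← expUnitary_add_smul, neg_add_cancel, zero_smul, expUnitary_zero]

theorem hasDerivAt_expUnitary {A : Type*} [CStarAlgebra A] (H : selfAdjoint A) :
    HasDerivAt (fun t : ℝ => (expUnitary (t • H) : A)) (I • (H : A)) 0 := by
  simpa [smul_comm I] using hasDerivAt_exp_smul_const (𝕂 := ℝ) (I • (H : A)) 0

theorem expUnitary_conj {A : Type*} [CStarAlgebra A] (g : unitary A) (H : selfAdjoint A) :
    expUnitary ⟨(g : A) * H * star (g : A), H.2.conjugate _⟩ = g * expUnitary H * g⁻¹ := by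
  let +nondep : NormedAlgebra ℚ A := .restrictScalars ℚ ℂ A
  ext
  simpa [mul_assoc, ← star_eq_inv] using
    NormedSpace.exp_units_conj (Unitary.toUnits g) (I • (H : A))

end OneParameter

/-! ### Differentials of unitary representations -/

section MatrixExponential

variable {n : Type*} [Fintype n] [DecidableEq n] {A : Matrix n n ℂ} {v : n → ℂ}

open scoped Matrix.Norms.L2Operator in
theorem hasSum_exp_mulVec (A : Matrix n n ℂ) (v : n → ℂ) :
    HasSum (fun k : ℕ => (k.factorial⁻¹ : ℂ) • A ^ k *ᵥ v) (NormedSpace.exp A *ᵥ v) := by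
  have h := ((Matrix.mulVecBilin ℂ ℂ).flip v).toContinuousLinearMap.hasSum
    (NormedSpace.exp_series_hasSum_exp' (𝕂 := ℂ) A)
  simpa [Matrix.smul_mulVec] using h

theorem exp_mulVec_of_mulVec_eq_smul {a : ℂ} (hv : A *ᵥ v = a • v) :
    NormedSpace.exp A *ᵥ v = Complex.exp a • v := by
  have hpow (k : ℕ) : A ^ k *ᵥ v = a ^ k • v := by
    induction k with
    | zero => simp
    | succ k ih => simp [pow_succ, ← Matrix.mulVec_mulVec, hv, Matrix.mulVec_smul, ih, smul_smul,
      mul_comm a]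
  have hsum : HasSum (fun k : ℕ => (k.factorial⁻¹ : ℂ) • a ^ k) (Complex.exp a) := by
    rw [Complex.exp_eq_exp_ℂ]
    exact NormedSpace.exp_series_hasSum_exp' a
  refine (hasSum_exp_mulVec A v).unique ?_
  simpa only [hpow, smul_assoc] using hsum.smul_const v

end MatrixExponential

section Differentials

open selfAdjoint Unitary Complex
open scoped Matrix.Norms.L2Operator ComplexStarModule

variable {d : ℕ} {m n : Type} [Fintype m] [DecidableEq m] [Fintype n] [DecidableEq n]

/-- `D` is the differential at the identity of the unitary representation `R`, extended
complex-linearly from Hermitian matrices to all of `𝔤𝔩_d`; it is normalized so that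
`R (exp (i H)) = exp (i D H)` for Hermitian `H`. -/
structure IsDifferential (R : MatRep d n) (D : Matrix (Fin d) (Fin d) ℂ →ₗ[ℂ] Matrix n n ℂ) :
    Prop where
  unitary : ∀ g, R g ∈ Matrix.unitaryGroup n ℂ
  hasDerivAt : ∀ H : selfAdjoint (Matrix (Fin d) (Fin d) ℂ),
    HasDerivAt (fun t : ℝ => R (expUnitary (t • H))) (I • D H) 0

theorem linearMap_ext_selfAdjoint {A E : Type*} [AddCommGroup A] [Module ℂ A] [StarAddMonoid A]
    [StarModule ℂ A] [AddCommMonoid E] [Module ℂ E] {f g : A →ₗ[ℂ] E}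
    (h : ∀ a : selfAdjoint A, f a = g a) : f = g := by
  ext a
  rw [← realPart_add_I_smul_imaginaryPart a, map_add, map_add, map_smul, map_smul, h, h]

namespace IsDifferential

variable {R : MatRep d n} {D : Matrix (Fin d) (Fin d) ℂ →ₗ[ℂ] Matrix n n ℂ}
  {V : Submodule ℂ (n → ℂ)}

theorem map_inv (h : IsDifferential R D) (g : U d) : R g⁻¹ = star (R g) :=
  left_inv_eq_right_inv (by rw [← map_mul, inv_mul_cancel, map_one])
    (Matrix.mem_unitaryGroup_iff.1 (h.unitary g))

theorem map_expUnitary_smul (h : IsDifferential R D) (H : selfAdjoint (Matrix (Fin d) (Fin d) ℂ))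
    (t : ℝ) : R (expUnitary (t • H)) = NormedSpace.exp (t • I • D H) :=
  eq_exp_smul_of_hasDerivAt_zero (u := fun t : ℝ => R (expUnitary (t • H))) (by simp)
    (fun s t => by rw [expUnitary_add_smul, map_mul]) (h.hasDerivAt H) t

theorem map_expUnitary (h : IsDifferential R D) (H : selfAdjoint (Matrix (Fin d) (Fin d) ℂ)) :
    R (expUnitary H) = NormedSpace.exp (I • D H) := by
  simpa using h.map_expUnitary_smul H 1

theorem hasDerivAt_neg (h : IsDifferential R D) (H : selfAdjoint (Matrix (Fin d) (Fin d) ℂ)) :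
    HasDerivAt (fun t : ℝ => R (expUnitary (-t • H))) (-(I • D H)) 0 := by
  have hcomp := (h.hasDerivAt H).scomp_of_eq (0 : ℝ) (_root_.hasDerivAt_neg 0) neg_zero.symm
  rwa [neg_one_smul] at hcomp

theorem isSelfAdjoint_apply (h : IsDifferential R D)
    (H : selfAdjoint (Matrix (Fin d) (Fin d) ℂ)) : IsSelfAdjoint (D H) := by
  have hstar := (h.hasDerivAt H).star
  simp only [← h.map_inv, ← expUnitary_neg_smul] at hstar
  simpa [IsSelfAdjoint] using hstar.unique (h.hasDerivAt_neg H)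

theorem map_star (h : IsDifferential R D) (X : Matrix (Fin d) (Fin d) ℂ) :
    D (star X) = star (D X) := by
  rw [← realPart_add_I_smul_imaginaryPart X]
  simp [(h.isSelfAdjoint_apply (ℜ X)).star_eq, (h.isSelfAdjoint_apply (ℑ X)).star_eq]

theorem map_conj (h : IsDifferential R D) (g : U d)
    (H : selfAdjoint (Matrix (Fin d) (Fin d) ℂ)) :
    D (g * H * star (g : Matrix (Fin d) (Fin d) ℂ)) = R g * D H * R g⁻¹ := by
  have hconj := h.hasDerivAt ⟨g * H * star (g : Matrix (Fin d) (Fin d) ℂ), H.2.conjugate _⟩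
  have hexp (t : ℝ) : expUnitary
      (t • (⟨g * H * star (g : Matrix (Fin d) (Fin d) ℂ), H.2.conjugate _⟩ :
        selfAdjoint (Matrix (Fin d) (Fin d) ℂ))) = g * expUnitary (t • H) * g⁻¹ := by
    rw [← expUnitary_conj]
    congr 1
    ext1
    simp
  simp only [hexp, map_mul] at hconj
  have := hconj.unique (((h.hasDerivAt H).const_mul (R g)).mul_const (R g⁻¹))
  simpa using this

theorem map_lie_selfAdjoint (h : IsDifferential R D)
    (H K : selfAdjoint (Matrix (Fin d) (Fin d) ℂ)) :
    D ⁅(H : Matrix (Fin d) (Fin d) ℂ), (K : Matrix (Fin d) (Fin d) ℂ)⁆ = ⁅D H, D K⁆ := by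
  have hconj := ((hasDerivAt_expUnitary H).mul_const (K : Matrix (Fin d) (Fin d) ℂ)).fun_mul
    (hasDerivAt_expUnitary H).star
  have hleft := (D.toContinuousLinearMap.restrictScalars ℝ).hasFDerivAt.comp_hasDerivAt
    (0 : ℝ) hconj
  have hright := ((h.hasDerivAt H).mul_const (D K)).fun_mul (h.hasDerivAt_neg H)
  have heq := hright.unique (hleft.congr_of_eventuallyEq (.of_forall fun t => ?_))
  · refine smul_right_injective _ I_ne_zero ?_
    simpa [Ring.lie_def, sub_eq_add_neg] using heq.symm
  · exact (congrArg (_ * R ·) (expUnitary_neg_smul H t)).trans (h.map_conj _ K).symm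

theorem map_lie (h : IsDifferential R D) (X Y : Matrix (Fin d) (Fin d) ℂ) :
    D ⁅X, Y⁆ = ⁅D X, D Y⁆ := by
  let bracket := LinearMap.mul ℂ (Matrix n n ℂ) - (LinearMap.mul ℂ (Matrix n n ℂ)).flip
  let bracket' := LinearMap.mul ℂ (Matrix (Fin d) (Fin d) ℂ) - (LinearMap.mul ℂ _).flip
  have hext : bracket'.compr₂ D = bracket.compl₁₂ D D :=
    linearMap_ext_selfAdjoint fun H => linearMap_ext_selfAdjoint fun K =>
      h.map_lie_selfAdjoint H K
  exact LinearMap.congr_fun₂ hext X Y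

theorem intertwines {R' : MatRep d m} {D' : Matrix (Fin d) (Fin d) ℂ →ₗ[ℂ] Matrix m m ℂ}
    (h : IsDifferential R D) (h' : IsDifferential R' D') {M : Matrix m n ℂ}
    (hM : M ∈ intertwiners R R') (X : Matrix (Fin d) (Fin d) ℂ) : D' X * M = M * D X := by
  have hsa (H : selfAdjoint (Matrix (Fin d) (Fin d) ℂ)) : D' H * M = M * D H := by
    have hleft := ((mulRightLinearMap m ℂ M).toContinuousLinearMap.restrictScalars
      ℝ).hasFDerivAt.comp_hasDerivAt (0 : ℝ) (h'.hasDerivAt H)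
    have hright := ((mulLeftLinearMap n ℂ M).toContinuousLinearMap.restrictScalars
      ℝ).hasFDerivAt.comp_hasDerivAt (0 : ℝ) (h.hasDerivAt H)
    have := (hleft.congr_of_eventuallyEq (.of_forall fun t => (hM _).symm)).unique hright
    simpa using this
  exact LinearMap.congr_fun (linearMap_ext_selfAdjoint
    (f := mulRightLinearMap m ℂ M ∘ₗ D') (g := mulLeftLinearMap n ℂ M ∘ₗ D) hsa) X

theorem apply_mulVec_mem (h : IsDifferential R D) (hV : ∀ g, ∀ v ∈ V, R g *ᵥ v ∈ V)
    (X : Matrix (Fin d) (Fin d) ℂ) {v : n → ℂ} (hv : v ∈ V) : D X *ᵥ v ∈ V := by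
  have hsa (H : selfAdjoint (Matrix (Fin d) (Fin d) ℂ)) : D H *ᵥ v ∈ V := by
    have hderiv := (((Matrix.mulVecBilin ℂ ℂ).flip v).toContinuousLinearMap.restrictScalars
      ℝ).hasFDerivAt.comp_hasDerivAt (0 : ℝ) (h.hasDerivAt H)
    have hlim := V.closed_of_finiteDimensional.mem_of_tendsto
      (hasDerivAt_iff_tendsto_slope.1 hderiv)
      (.of_forall fun t => V.smul_of_tower_mem _ (V.sub_mem (hV _ v hv) (hV _ v hv)))
    simpa [Matrix.smul_mulVec, V.smul_mem_iff I_ne_zero] using hlim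
  rw [← realPart_add_I_smul_imaginaryPart X, map_add, map_smul, Matrix.add_mulVec,
    Matrix.smul_mulVec]
  exact V.add_mem (hsa _) (V.smul_mem I (hsa _))

end IsDifferential

end Differentials

/-! ### The tensor representations and their highest weight vectors -/

section TensorRepresentations

section Det

variable {ι : Type*} [Fintype ι] [DecidableEq ι]

theorem sum_det_updateRow_mul {R : Type*} [CommRing R] (M N : Matrix ι ι R) :
    ∑ x, (M.updateRow x ((M * N) x)).det = N.trace * M.det := by
  have hrow (x : ι) : (M.updateRow x ((M * N) x)).det = (M * N * M.adjugate) x x := by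
    rw [← Matrix.cramer_transpose_apply, Matrix.cramer_eq_adjugate_mulVec,
      ← Matrix.adjugate_transpose, Matrix.mulVec_transpose]
    rfl
  calc ∑ x, (M.updateRow x ((M * N) x)).det = (M * N * M.adjugate).trace :=
        Finset.sum_congr rfl fun x _ => hrow x
    _ = N.trace * M.det := by
        rw [Matrix.trace_mul_comm, ← Matrix.mul_assoc, Matrix.adjugate_mul, Matrix.smul_mul,
          Matrix.one_mul, Matrix.trace_smul, smul_eq_mul, mul_comm]

theorem hasDerivAt_det_of_eq_one {M : ℝ → Matrix ι ι ℂ} {M' : Matrix ι ι ℂ} {t : ℝ}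
    (hone : M t = 1) (hM : ∀ i j, HasDerivAt (fun s => M s i j) (M' i j) t) :
    HasDerivAt (fun s => (M s).det) M'.trace t := by
  let det : ContinuousMultilinearMap ℂ (fun _ : ι => ι → ℂ) ℂ :=
    ⟨Matrix.detRowAlternating.toMultilinearMap, continuous_id.matrix_det⟩
  have hcurve : HasDerivAt (fun s => Matrix.of.symm (M s)) M' t :=
    hasDerivAt_pi.2 fun i => hasDerivAt_pi.2 fun j => hM i j
  refine (((det.hasFDerivAt _).restrictScalars ℝ).comp_hasDerivAt t hcurve).congr_deriv ?_
  calc det.linearDeriv (M t) M' = ∑ x, ((M t).updateRow x (M' x)).det := det.linearDeriv_apply ..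
    _ = M'.trace := by simpa [hone] using sum_det_updateRow_mul 1 M'

end Det

variable {d : ℕ} {γ : Staircase d}

theorem one_apply_prod_erase {ι : Type*} [Fintype ι] [DecidableEq ι] (f f' : ι → Fin d) (x : ι) :
    ∏ y ∈ Finset.univ.erase x, (1 : Matrix (Fin d) (Fin d) ℂ) (f y) (f' y) =
      if ∀ y, y ≠ x → f y = f' y then 1 else 0 := by
  simp [Matrix.one_apply, Finset.prod_ite_zero]

variable (γ) in
/-- The differential of `tensorMat γ`: a multiple of the trace, plus the sum over all tensor
factors of the action of `X` on that factor. -/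
def tensorDeriv :
    Matrix (Fin d) (Fin d) ℂ →ₗ[ℂ] Matrix (Box γ → Fin d) (Box γ → Fin d) ℂ where
  toFun X := Matrix.of fun f f' => (1 : Matrix _ _ ℂ) f f' * (γ.last * X.trace) +
    ∑ x, if ∀ y, y ≠ x → f y = f' y then X (f x) (f' x) else 0
  map_add' X Y := by
    ext f f'
    simp only [Matrix.trace_add, Matrix.add_apply, Matrix.of_apply, ← Finset.sum_add_distrib,
      ← ite_add_zero, mul_add, add_add_add_comm]
  map_smul' c X := by
    ext f f'
    simp [mul_add, Finset.mul_sum, mul_left_comm c]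

theorem tensorMat_mem_unitaryGroup (g : U d) : tensorMat γ g ∈ Matrix.unitaryGroup _ ℂ := by
  have hstar : star (tensorMat γ g) = tensorMat γ g⁻¹ := by
    ext f f'
    simp [tensorMat, ← Unitary.star_eq_inv, Matrix.star_eq_conjTranspose,
      Matrix.det_conjTranspose]
  rw [Matrix.mem_unitaryGroup_iff', hstar, ← map_mul, inv_mul_cancel, map_one]

open scoped Matrix.Norms.L2Operator in
open selfAdjoint Complex in
theorem isDifferential_tensorMat : IsDifferential (tensorMat γ) (tensorDeriv γ) where
  unitary := tensorMat_mem_unitaryGroup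
  hasDerivAt H := by
    have hentry (i j : Fin d) : HasDerivAt (fun t : ℝ => (expUnitary (t • H)).1 i j)
        ((I • (H : Matrix (Fin d) (Fin d) ℂ)) i j) 0 :=
      hasDerivAt_pi.1 (hasDerivAt_pi.1 (hasDerivAt_expUnitary H) i) j
    have hone : (expUnitary ((0 : ℝ) • H)).1 = 1 := by simp
    have hdet := (hasDerivAt_zpow γ.last (1 : ℂ) (.inl one_ne_zero)).comp_of_eq (0 : ℝ)
      (hasDerivAt_det_of_eq_one hone hentry) (by simp)
    rw [← map_smul]
    refine hasDerivAt_pi.2 fun f => hasDerivAt_pi.2 fun f' => ?_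
    have hprod := HasDerivAt.fun_finsetProd (u := Finset.univ) fun x (_ : x ∈ Finset.univ) =>
      hentry (f x) (f' x)
    refine (hdet.mul hprod).congr_deriv ?_
    have hprod_one : ∏ x, (1 : Matrix (Fin d) (Fin d) ℂ) (f x) (f' x) =
        (1 : Matrix (Box γ → Fin d) _ ℂ) f f' := by
      simp [Matrix.one_apply, Finset.prod_ite_zero, funext_iff]
    simp only [hone, one_apply_prod_erase, hprod_one]
    generalize I • (H : Matrix (Fin d) (Fin d) ℂ) = X
    simp [tensorDeriv, mul_comm]

theorem tensorDeriv_mulVec (X : Matrix (Fin d) (Fin d) ℂ) (v : (Box γ → Fin d) → ℂ)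
    (f : Box γ → Fin d) :
    (tensorDeriv γ X *ᵥ v) f =
      γ.last * X.trace * v f + ∑ x, ∑ k, X (f x) k * v (Function.update f x k) := by
  have hslot (x : Box γ) : ∑ f', (if ∀ y, y ≠ x → f y = f' y then X (f x) (f' x) else 0) * v f' =
      ∑ k, X (f x) k * v (Function.update f x k) := by
    refine (Finset.sum_of_injOn (Function.update f x) (Function.update_injective f x).injOn
      (by simp) (fun f' _ hf' => ?_) fun k _ => ?_).symm
    · rw [if_neg, zero_mul]
      exact fun h => hf' ⟨f' x, by simp, Function.update_eq_iff.2 ⟨rfl, h⟩⟩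
    · rw [if_pos fun y hy => by rw [Function.update_of_ne hy], Function.update_self]
  simp only [Matrix.mulVec, dotProduct, tensorDeriv, LinearMap.coe_mk, AddHom.coe_mk,
    Matrix.of_apply, add_mul, Finset.sum_add_distrib, Finset.sum_mul]
  rw [Finset.sum_comm]
  simp only [hslot]
  simp [Matrix.one_apply]

theorem Staircase.rowLen_antitone (γ : Staircase d) : Antitone γ.rowLen := by
  intro i j h
  have := γ.2 h
  simp only [Staircase.rowLen]
  omega

theorem Staircase.rowLen_add_last (γ : Staircase d) (i : Fin d) :
    (γ.rowLen i : ℤ) + γ.last = γ.1 i := by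
  have hd : 0 < d := i.pos
  have : γ.1 ⟨d - 1, by omega⟩ ≤ γ.1 i := γ.2 (Fin.le_def.2 (by simp; omega))
  simp only [Staircase.rowLen, Staircase.last, hd, dif_pos]
  omega

theorem Box.ext_iff {x y : Box γ} : x = y ↔ (x.2 : ℕ) = y.2 ∧ x.1 = y.1 := by
  obtain ⟨i, c⟩ := x
  obtain ⟨i', c'⟩ := y
  refine ⟨fun h => by cases h; simp, fun ⟨hc, hi⟩ => ?_⟩
  obtain rfl : i = i' := hi
  exact congrArg (Sigma.mk i) (Fin.ext hc)

variable (γ) in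
/-- The matrix whose determinant is the entry at `f` of the highest weight vector. -/
def hwMatrix (f : Box γ → Fin d) : Matrix (Box γ) (Box γ) ℂ :=
  Matrix.of fun x y => if (x.2 : ℕ) = y.2 ∧ f x = y.1 then 1 else 0

variable (γ) in
/-- The action of `X` on the rows of the boxes, column by column. -/
def columnMatrix (X : Matrix (Fin d) (Fin d) ℂ) : Matrix (Box γ) (Box γ) ℂ :=
  Matrix.of fun x y => if (x.2 : ℕ) = y.2 then X x.1 y.1 else 0

theorem hwVec_apply (f : Box γ → Fin d) : (hwVec γ).ofLp f = (hwMatrix γ f).det := rfl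

theorem trace_columnMatrix (X : Matrix (Fin d) (Fin d) ℂ) :
    (columnMatrix γ X).trace = ∑ i, γ.rowLen i * X i i := by
  simp [columnMatrix, Matrix.trace, Fintype.sum_sigma]

theorem hwMatrix_mul_columnMatrix {X : Matrix (Fin d) (Fin d) ℂ} (hX : X.BlockTriangular id)
    (f : Box γ → Fin d) (x y : Box γ) :
    (hwMatrix γ f * columnMatrix γ X) x y = if (x.2 : ℕ) = y.2 then X (f x) y.1 else 0 := by
  simp only [Matrix.mul_apply, hwMatrix, columnMatrix, Matrix.of_apply, ite_mul, one_mul, zero_mul,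
    ← ite_and]
  by_cases hlt : (x.2 : ℕ) < γ.rowLen (f x)
  · rw [Fintype.sum_eq_single ⟨f x, x.2, hlt⟩]
    · simp
    · exact fun z hne => if_neg fun h => hne (Box.ext_iff.2 ⟨h.1.1.symm, h.1.2.symm⟩)
  · have hzero : (if (x.2 : ℕ) = y.2 then X (f x) y.1 else 0) = 0 :=
      ite_eq_right_iff.2 fun hxy => hX (lt_of_not_ge fun hle => hlt <|
        hxy.trans_lt (y.2.2.trans_le (γ.rowLen_antitone hle)))
    rw [hzero]
    exact Finset.sum_eq_zero fun z _ => if_neg fun h => hlt (by rw [h.1.1, h.1.2]; exact z.2.2)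

theorem sum_mul_hwVec_update {X : Matrix (Fin d) (Fin d) ℂ} (hX : X.BlockTriangular id)
    (f : Box γ → Fin d) (x : Box γ) :
    ∑ k, X (f x) k * (hwVec γ).ofLp (Function.update f x k) =
      ((hwMatrix γ f).updateRow x ((hwMatrix γ f * columnMatrix γ X) x)).det := by
  have hrow : (hwMatrix γ f * columnMatrix γ X) x =
      ∑ k, X (f x) k • hwMatrix γ (Function.update f x k) x := by
    ext y
    simp only [hwMatrix_mul_columnMatrix hX]
    simp [hwMatrix, Finset.sum_apply, ite_and]
  have hupdate (k : Fin d) : hwMatrix γ (Function.update f x k) =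
      (hwMatrix γ f).updateRow x (hwMatrix γ (Function.update f x k) x) := by
    ext x' y
    obtain rfl | hne := eq_or_ne x' x
    · simp
    · simp [Matrix.updateRow_ne hne, hwMatrix, Function.update_of_ne hne]
  let detRow := (Matrix.detRowAlternating (R := ℂ)).toMultilinearMap.toLinearMap (hwMatrix γ f) x
  calc _ = ∑ k, X (f x) k • detRow (hwMatrix γ (Function.update f x k) x) :=
        Finset.sum_congr rfl fun k _ => congrArg (_ * Matrix.det ·) (hupdate k)
    _ = detRow ((hwMatrix γ f * columnMatrix γ X) x) := by simp only [hrow, map_sum, map_smul]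
    _ = _ := rfl

theorem tensorDeriv_mulVec_hwVec {X : Matrix (Fin d) (Fin d) ℂ} (hX : X.BlockTriangular id) :
    tensorDeriv γ X *ᵥ (hwVec γ).ofLp = (∑ i, γ.1 i * X i i) • (hwVec γ).ofLp := by
  have hweight : ∑ i, (γ.1 i : ℂ) * X i i = γ.last * X.trace + ∑ i, γ.rowLen i * X i i := by
    simp only [← γ.rowLen_add_last, Int.cast_add, Int.cast_natCast, add_mul,
      Finset.sum_add_distrib, Matrix.trace, Matrix.diag_apply, Finset.mul_sum]
    exact add_comm _ _
  funext f
  rw [tensorDeriv_mulVec, Finset.sum_congr rfl fun x _ => sum_mul_hwVec_update hX f x,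
    sum_det_updateRow_mul, trace_columnMatrix, Pi.smul_apply, smul_eq_mul, hweight, add_mul,
    hwVec_apply]

theorem hwVec_ne_zero : hwVec γ ≠ 0 := by
  have hone : hwMatrix γ Sigma.fst = 1 := by
    ext x y
    simp only [hwMatrix, Matrix.of_apply, Matrix.one_apply, Box.ext_iff]
  intro h
  simpa [h, hone] using hwVec_apply (γ := γ) Sigma.fst

end TensorRepresentations

section DifferentialOperators

open selfAdjoint Complex
open scoped Matrix.Norms.L2Operator

variable {d : ℕ} {m n : Type} [Fintype m] [DecidableEq m] [Fintype n] [DecidableEq n]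
  {R : MatRep d m} {S : MatRep d n} {D : Matrix (Fin d) (Fin d) ℂ →ₗ[ℂ] Matrix m m ℂ}
  {D' : Matrix (Fin d) (Fin d) ℂ →ₗ[ℂ] Matrix n n ℂ}

variable (D D') in
/-- The Leibniz rule: the differential of `tensor R S` in terms of those of `R` and `S`. -/
def tensorDifferential : Matrix (Fin d) (Fin d) ℂ →ₗ[ℂ] Matrix (m × n) (m × n) ℂ where
  toFun X := D X ⊗ₖ 1 + 1 ⊗ₖ D' X
  map_add' X Y := by
    rw [map_add, map_add, Matrix.add_kronecker, Matrix.kronecker_add, add_add_add_comm]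
  map_smul' c X := by
    simp [Matrix.smul_kronecker, Matrix.kronecker_smul]

namespace IsDifferential

theorem of_isometry (h : IsDifferential S D') {B : Matrix n m ℂ} (hB : Bᴴ * B = 1)
    (hBR : B ∈ intertwiners R S) :
    IsDifferential R (mulRightLinearMap m ℂ B ∘ₗ mulLeftLinearMap n ℂ Bᴴ ∘ₗ D') := by
  have hR (g : U d) : R g = Bᴴ * S g * B := by
    rw [Matrix.mul_assoc, hBR g, ← Matrix.mul_assoc, hB, Matrix.one_mul]
  refine ⟨fun g => ?_, fun H => ?_⟩
  · have hstar : star (R g) = R g⁻¹ := by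
      rw [hR, hR, h.map_inv]
      simp [Matrix.star_eq_conjTranspose, Matrix.mul_assoc]
    rw [Matrix.mem_unitaryGroup_iff', hstar, ← map_mul, inv_mul_cancel, map_one]
  · have hderiv := ((mulRightLinearMap m ℂ B ∘ₗ mulLeftLinearMap n ℂ Bᴴ).toContinuousLinearMap
      |>.restrictScalars ℝ).hasFDerivAt.comp_hasDerivAt (0 : ℝ) (h.hasDerivAt H)
    simpa [Function.comp_def, hR] using hderiv

theorem conjRep (h : IsDifferential R D) :
    IsDifferential (conjRep R) (-((Matrix.transposeLinearEquiv m m ℂ ℂ).toLinearMap ∘ₗ D)) where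
  unitary g := by
    rw [Matrix.mem_unitaryGroup_iff']
    have hstar : star (EquivChannel.conjRep R g) = (R g)ᵀ := by
      ext i j
      exact star_star _
    have hg := congrArg Matrix.transpose (Matrix.mem_unitaryGroup_iff'.1 (h.unitary g))
    rw [Matrix.transpose_mul, Matrix.transpose_one] at hg
    rwa [hstar]
  hasDerivAt H := by
    have hderiv := ((Matrix.transposeLinearEquiv m m ℂ ℂ).toLinearMap.toContinuousLinearMap
      |>.restrictScalars ℝ).hasFDerivAt.comp_hasDerivAt (0 : ℝ) (h.hasDerivAt H).star
    refine hderiv.congr_deriv ?_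
    simp [(h.isSelfAdjoint_apply H).star_eq]

theorem tensor (h : IsDifferential R D) (h' : IsDifferential S D') :
    IsDifferential (tensor R S) (tensorDifferential D D') where
  unitary g := Matrix.kronecker_mem_unitary (h.unitary g) (h'.unitary g)
  hasDerivAt H := by
    refine hasDerivAt_pi.2 fun i => hasDerivAt_pi.2 fun j => ?_
    have hderiv := (hasDerivAt_pi.1 (hasDerivAt_pi.1 (h.hasDerivAt H) i.1) j.1).mul
      (hasDerivAt_pi.1 (hasDerivAt_pi.1 (h'.hasDerivAt H) i.2) j.2)
    refine hderiv.congr_deriv ?_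
    simp [tensorDifferential, mul_add, mul_assoc, mul_left_comm I]

end IsDifferential

/-- `R` is unitary and differentiable along one-parameter subgroups. -/
def IsSmooth (R : MatRep d m) : Prop := ∃ D, IsDifferential R D

theorem IsSmooth.conjRep : IsSmooth R → IsSmooth (conjRep R) := fun ⟨_, h⟩ => ⟨_, h.conjRep⟩

theorem IsSmooth.tensor : IsSmooth R → IsSmooth S → IsSmooth (tensor R S) :=
  fun ⟨_, h⟩ ⟨_, h'⟩ => ⟨_, h.tensor h'⟩

theorem IsSmooth.mem_unitaryGroup (hR : IsSmooth R) (g : U d) : R g ∈ Matrix.unitaryGroup m ℂ :=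
  hR.elim fun _ h => h.unitary g

theorem IsSmooth.map_inv (hR : IsSmooth R) (g : U d) : R g⁻¹ = (R g)ᴴ :=
  hR.elim fun _ h => h.map_inv g

/-! ### The representations `Q_γ` in coordinates -/

section Coordinates

variable {b : Bases d} {γ : Staircase d}

variable (b γ) in
/-- The matrix of the inclusion of `Q γ` into the tensor power: its columns are the basis vectors
of `Q γ`. -/
def basisMat : Matrix (Box γ → Fin d) (Fin (dimQ γ)) ℂ :=
  Matrix.of fun f q => (b γ q : Tensor γ).ofLp f

theorem conjTranspose_basisMat_mul_self : (basisMat b γ)ᴴ * basisMat b γ = 1 := by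
  ext p q
  have horth := orthonormal_iff_ite.1 (b γ).orthonormal p q
  rw [Submodule.coe_inner, EuclideanSpace.inner_eq_star_dotProduct, dotProduct_comm] at horth
  rwa [Matrix.one_apply]

theorem basisMat_mulVec (x : Fin (dimQ γ) → ℂ) :
    basisMat b γ *ᵥ x = ((∑ q, x q • b γ q : Q γ) : Tensor γ).ofLp := by
  funext f
  simp [Matrix.mulVec, dotProduct, basisMat, mul_comm]

theorem basisMat_mulVec_repr (v : Q γ) :
    basisMat b γ *ᵥ ((b γ).repr v).ofLp = (v : Tensor γ).ofLp := by
  rw [basisMat_mulVec, (b γ).sum_repr]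

theorem basisMat_mem_intertwiners : basisMat b γ ∈ intertwiners (rep b γ) (tensorMat γ) := by
  intro g
  ext f q
  have hcol : (rep b γ g).col q = ((b γ).repr (irrep γ g (b γ q))).ofLp := by
    ext p
    simp [rep, LinearMap.toMatrix_apply]
  have hrepr := congrFun (basisMat_mulVec_repr (b := b) (irrep γ g (b γ q))) f
  rw [← hcol] at hrepr
  exact hrepr.symm

variable (b γ) in
/-- The highest weight vector of `Q γ` in coordinates. -/
def hwCoord : Fin (dimQ γ) → ℂ := (basisMat b γ)ᴴ *ᵥ (hwVec γ).ofLp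

theorem hwVec_mem_Q : hwVec γ ∈ Q γ := Submodule.subset_span ⟨1, by simp⟩

theorem conjTranspose_basisMat_mulVec (v : Q γ) :
    (basisMat b γ)ᴴ *ᵥ (v : Tensor γ).ofLp = ((b γ).repr v).ofLp := by
  rw [← basisMat_mulVec_repr (b := b), Matrix.mulVec_mulVec, conjTranspose_basisMat_mul_self,
    Matrix.one_mulVec]

theorem basisMat_mulVec_hwCoord : basisMat b γ *ᵥ hwCoord b γ = (hwVec γ).ofLp := by
  rw [hwCoord, conjTranspose_basisMat_mulVec ⟨_, hwVec_mem_Q⟩, basisMat_mulVec_repr]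

theorem hwCoord_ne_zero : hwCoord b γ ≠ 0 := by
  intro h
  have hvec := basisMat_mulVec_hwCoord (b := b) (γ := γ)
  rw [h, Matrix.mulVec_zero] at hvec
  exact hwVec_ne_zero (WithLp.ofLp_injective 2 hvec.symm)

theorem dimQ_pos : 0 < dimQ γ := by
  have : Nontrivial (Q γ) := ⟨⟨hwVec γ, hwVec_mem_Q⟩, 0, by simpa using hwVec_ne_zero⟩
  exact Module.finrank_pos

theorem span_rep_mulVec_hwCoord :
    Submodule.span ℂ (Set.range fun g : U d => rep b γ g *ᵥ hwCoord b γ) = ⊤ := by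
  set W := Submodule.span ℂ (Set.range fun g : U d => rep b γ g *ᵥ hwCoord b γ)
  have hQ : Q γ ≤ (W.map (basisMat b γ).mulVecLin).comap
      (WithLp.linearEquiv 2 ℂ (_ → ℂ)).toLinearMap := by
    refine Submodule.span_le.2 ?_
    rintro _ ⟨g, rfl⟩
    refine ⟨rep b γ g *ᵥ hwCoord b γ, Submodule.subset_span ⟨g, rfl⟩, ?_⟩
    rw [Matrix.mulVecLin_apply, Matrix.mulVec_mulVec, ← basisMat_mem_intertwiners g,
      ← Matrix.mulVec_mulVec, basisMat_mulVec_hwCoord]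
    rfl
  have hinj : Function.Injective (basisMat b γ).mulVecLin :=
    Function.LeftInverse.injective (g := (basisMat b γ)ᴴ.mulVecLin) fun x => by
      simp [Matrix.mulVec_mulVec, conjTranspose_basisMat_mul_self]
  refine eq_top_iff.2 fun x _ => ?_
  obtain ⟨w, hw, hwx⟩ := hQ (∑ q, x q • b γ q : Q γ).2
  rwa [← hinj (hwx.trans (basisMat_mulVec x).symm)]

end Coordinates

end DifferentialOperators

/-! ### Highest weight theory -/

section HighestWeights

open Complex

theorem lie_mem_pow {K A : Type*} [CommSemiring K] [Ring A] [Algebra K A] {P : Submodule K A}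
    {p : A} (hp : ∀ a ∈ P, ⁅p, a⁆ ∈ P) (k : ℕ) {a : A} (ha : a ∈ P ^ k) : ⁅p, a⁆ ∈ P ^ k := by
  induction ha using Submodule.pow_induction_on_left' with
  | algebraMap r => simp [Ring.lie_def, Algebra.commutes]
  | add x y i hx hy hpx hpy =>
    rw [Ring.lie_def, mul_add, add_mul, add_sub_add_comm]
    exact add_mem hpx hpy
  | mem_mul x hx i y hy hpy =>
    have hleibniz : ⁅p, x * y⁆ = ⁅p, x⁆ * y + x * ⁅p, y⁆ := by
      simp only [Ring.lie_def]
      noncomm_ring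
    rw [hleibniz, pow_succ']
    exact add_mem (Submodule.mul_mem_mul (hp x hx) hy) (Submodule.mul_mem_mul hx hpy)

theorem exists_strictLower_add_blockTriangular {d : ℕ} (X : Matrix (Fin d) (Fin d) ℂ) :
    ∃ L T : Matrix (Fin d) (Fin d) ℂ, Lᴴ.BlockTriangular id ∧ L.diag = 0 ∧ T.BlockTriangular id ∧
      X = L + T := by
  refine ⟨.of fun i j => if j < i then X i j else 0, .of fun i j => if j < i then 0 else X i j,
    fun i j hij => ?_, ?_, fun i j hij => ?_, ?_⟩
  · simp [(show j < i from hij).not_gt]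
  · ext i; simp
  · simp [show j < i from hij]
  · ext i j
    by_cases hij : j < i <;> simp [hij]

variable {d : ℕ} {m n : Type} [Fintype m] [Fintype n]
  {D : Matrix (Fin d) (Fin d) ℂ →ₗ[ℂ] Matrix m m ℂ}
  {D' : Matrix (Fin d) (Fin d) ℂ →ₗ[ℂ] Matrix n n ℂ} {γ : Fin d → ℤ}

/-- A highest weight vector of weight `γ`, up to being nonzero: upper triangular matrices act on
`w` through the character `γ` of their diagonal. -/
def IsHighestWeight (D : Matrix (Fin d) (Fin d) ℂ →ₗ[ℂ] Matrix m m ℂ) (γ : Fin d → ℤ)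
    (w : m → ℂ) : Prop :=
  ∀ X : Matrix (Fin d) (Fin d) ℂ, X.BlockTriangular id → D X *ᵥ w = (∑ i, γ i * X i i) • w

/-- A singular vector: one annihilated by the raising operators, that is by the strictly upper
triangular matrices. -/
def IsSingular (D : Matrix (Fin d) (Fin d) ℂ →ₗ[ℂ] Matrix m m ℂ) (v : m → ℂ) : Prop :=
  ∀ X : Matrix (Fin d) (Fin d) ℂ, X.BlockTriangular id → X.diag = 0 → D X *ᵥ v = 0

theorem IsHighestWeight.isSingular {w : m → ℂ} (hw : IsHighestWeight D γ w) : IsSingular D w := by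
  intro X hX hdiag
  have hentry (i : Fin d) : X i i = 0 := congrFun hdiag i
  simp [hw X hX, hentry]

/-- The matrix coefficient `A ↦ ⟨v, A w⟩`. -/
def coeff (v w : m → ℂ) : Matrix m m ℂ →ₗ[ℂ] ℂ where
  toFun A := star v ⬝ᵥ (A *ᵥ w)
  map_add' A B := by rw [Matrix.add_mulVec, dotProduct_add]
  map_smul' c A := by rw [Matrix.smul_mulVec, dotProduct_smul, RingHom.id_apply]

theorem coeff_mul_of_isHighestWeight {w : m → ℂ} (hw : IsHighestWeight D γ w)
    {T : Matrix (Fin d) (Fin d) ℂ} (hT : T.BlockTriangular id) (v : m → ℂ) (A : Matrix m m ℂ) :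
    coeff v w (A * D T) = (∑ i, γ i * T i i) * coeff v w A := by
  change star v ⬝ᵥ ((A * D T) *ᵥ w) = _
  rw [← Matrix.mulVec_mulVec, hw T hT, Matrix.mulVec_smul, dotProduct_smul, smul_eq_mul]
  rfl

variable [DecidableEq m] [DecidableEq n] {R : MatRep d m} {S : MatRep d n}

theorem coeff_mul_eq_zero_of_isSingular (h : IsDifferential R D) {v : m → ℂ}
    (hv : IsSingular D v) {L : Matrix (Fin d) (Fin d) ℂ} (hL : Lᴴ.BlockTriangular id)
    (hdiag : L.diag = 0) (w : m → ℂ) (A : Matrix m m ℂ) : coeff v w (D L * A) = 0 := by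
  have hkill : D Lᴴ *ᵥ v = 0 := hv _ hL (by rw [Matrix.diag_conjTranspose, hdiag, star_zero])
  have hadj : star v ᵥ* D L = star (D Lᴴ *ᵥ v) := by
    rw [Matrix.star_mulVec, ← Matrix.star_eq_conjTranspose (D Lᴴ), ← h.map_star,
      Matrix.star_eq_conjTranspose, Matrix.conjTranspose_conjTranspose]
  change star v ⬝ᵥ ((D L * A) *ᵥ w) = 0
  rw [← Matrix.mulVec_mulVec, Matrix.dotProduct_mulVec, hadj, hkill, star_zero, zero_dotProduct]

section Proportional

variable {v w : m → ℂ} {v' w' : n → ℂ}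

/-- Commuting the upper triangular matrices to the right, where they act by scalars, and the
strictly lower triangular ones to the left, where they vanish, evaluates all coefficients. -/
theorem coeff_proportional_of_mem_pow (h : IsDifferential R D) (h' : IsDifferential S D')
    (hv : IsSingular D v) (hv' : IsSingular D' v') (hw : IsHighestWeight D γ w)
    (hw' : IsHighestWeight D' γ w') {k : ℕ} {a : Matrix m m ℂ × Matrix n n ℂ}
    (ha : a ∈ LinearMap.range (D.prod D') ^ k) :
    coeff v w a.1 * coeff v' w' 1 = coeff v' w' a.2 * coeff v w 1 := by
  set P := LinearMap.range (D.prod D')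
  have hlie (X : Matrix (Fin d) (Fin d) ℂ) : ∀ a ∈ P, ⁅D.prod D' X, a⁆ ∈ P := by
    rintro _ ⟨Y, rfl⟩
    exact ⟨⁅X, Y⁆, Prod.ext (h.map_lie X Y) (h'.map_lie X Y)⟩
  induction k generalizing a with
  | zero =>
    obtain ⟨c, rfl⟩ := Submodule.mem_one.1 (pow_zero P ▸ ha)
    simp [Algebra.algebraMap_eq_smul_one, mul_assoc, mul_comm (coeff v w 1)]
  | succ k ih =>
    rw [pow_succ'] at ha
    refine Submodule.mul_induction_on ha ?_ fun x y hx hy => by simp [add_mul, hx, hy]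
    rintro _ ⟨X, rfl⟩ a ha
    obtain ⟨L, T, hL, hdiag, hT, rfl⟩ := exists_strictLower_add_blockTriangular X
    have hcomm := ih (lie_mem_pow (hlie T) k ha)
    have hsplit : D.prod D' (L + T) * a =
        D.prod D' L * a + (a * D.prod D' T + ⁅D.prod D' T, a⁆) := by
      rw [map_add, Ring.lie_def]
      noncomm_ring
    rw [hsplit]
    simp only [Prod.fst_add, Prod.snd_add, Prod.fst_mul, Prod.snd_mul, LinearMap.prod_apply,
      Function.prod, map_add, coeff_mul_eq_zero_of_isSingular h hv hL hdiag,
      coeff_mul_eq_zero_of_isSingular h' hv' hL hdiag, coeff_mul_of_isHighestWeight hw hT,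
      coeff_mul_of_isHighestWeight hw' hT, zero_add, add_mul, mul_assoc, ih ha] at hcomm ⊢
    rw [hcomm]

/-- The matrix coefficients between singular and highest weight vectors depend on the weight only,
up to a constant. -/
theorem coeff_proportional (h : IsDifferential R D) (h' : IsDifferential S D')
    (hv : IsSingular D v) (hv' : IsSingular D' v') (hw : IsHighestWeight D γ w)
    (hw' : IsHighestWeight D' γ w') (g : U d) :
    coeff v w (R g) * coeff v' w' 1 = coeff v' w' (S g) * coeff v w 1 := by
  obtain ⟨H, rfl⟩ := exists_expUnitary_eq g
  have hsum {n : Type} [Fintype n] [DecidableEq n] (v w : n → ℂ) (A : Matrix n n ℂ) :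
      HasSum (fun k : ℕ => (k.factorial⁻¹ : ℂ) * coeff v w (A ^ k))
        (coeff v w (NormedSpace.exp A)) := by
    have := (hasSum_exp_mulVec A w).mapL (dotProductBilin ℂ ℂ (star v)).toContinuousLinearMap
    simpa [coeff] using this
  have hmem : D.prod D' (I • H) ∈ LinearMap.range (D.prod D') := ⟨_, rfl⟩
  have hpow (k : ℕ) : coeff v w (D (I • H) ^ k) * coeff v' w' 1 =
      coeff v' w' (D' (I • H) ^ k) * coeff v w 1 := by
    simpa only [Prod.pow_fst, Prod.pow_snd, LinearMap.prod_apply, Function.prod] using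
      coeff_proportional_of_mem_pow h h' hv hv' hw hw' (Submodule.pow_mem_pow _ hmem k)
  rw [h.map_expUnitary, h'.map_expUnitary, ← map_smul, ← map_smul]
  refine ((hsum v w _).mul_right _).unique ?_
  convert (hsum v' w' _).mul_right (coeff v w 1) using 2 with k
  rw [mul_assoc, mul_assoc, hpow]

end Proportional

end HighestWeights

section Irreducibility

open Complex selfAdjoint
open scoped Matrix.Norms.L2Operator

section CommonEigenvector

open Module

theorem exists_common_eigenvector {K M ι : Type*} [Field K] [IsAlgClosed K] [AddCommGroup M]
    [Module K M] [FiniteDimensional K M] {V : Submodule K M} (hV : V ≠ ⊥) {f : ι → End K M}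
    (hf : ∀ i, ∀ v ∈ V, f i v ∈ V) (hcomm : ∀ i j, Commute (f i) (f j)) :
    ∃ v ∈ V, v ≠ 0 ∧ ∀ i, ∃ a : K, f i v = a • v := by
  obtain ⟨W, hWV, ⟨⟨hW, hfW⟩, hmin⟩⟩ := exists_minimal_le_of_wellFoundedLT
    (fun W : Submodule K M => W ≠ ⊥ ∧ ∀ i, ∀ v ∈ W, f i v ∈ W) V ⟨hV, hf⟩
  obtain ⟨v, hv, hv0⟩ := W.ne_bot_iff.1 hW
  refine ⟨v, hWV hv, hv0, fun i => ?_⟩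
  have : Nontrivial W := Submodule.nontrivial_iff_ne_bot.2 hW
  obtain ⟨a, ha⟩ := End.exists_eigenvalue ((f i).restrict (hfW i))
  obtain ⟨u, hu⟩ := ha.exists_hasEigenvector
  have hu_mem : (u : M) ∈ W ⊓ (f i).eigenspace a :=
    ⟨u.2, End.mem_eigenspace_iff.2 (congrArg Subtype.val hu.apply_eq_smul)⟩
  have hle : W ≤ W ⊓ (f i).eigenspace a := by
    refine hmin ⟨?_, fun j w hw => ⟨hfW j w hw.1, ?_⟩⟩ inf_le_left
    · exact (Submodule.ne_bot_iff _).2 ⟨u, hu_mem, fun h => hu.2 (Subtype.ext h)⟩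
    · exact End.mapsTo_genEigenspace_of_comm (hcomm i j) a 1 hw.2
  exact ⟨a, End.mem_eigenspace_iff.1 (hle hv).2⟩

end CommonEigenvector

theorem lie_diagonal_single {ι K : Type*} [Fintype ι] [DecidableEq ι] [CommRing K] (x : ι → K)
    (i j : ι) : ⁅Matrix.diagonal x, Matrix.single i j (1 : K)⁆ =
      (x i - x j) • Matrix.single i j (1 : K) := by
  ext k l
  simp only [Ring.lie_def, Matrix.sub_apply, Matrix.diagonal_mul, Matrix.mul_diagonal,
    Matrix.smul_apply, Matrix.single_apply, smul_eq_mul]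
  split_ifs with h
  · rw [← h.1, ← h.2, mul_one, one_mul, mul_one]
  · simp only [mul_zero, zero_mul, sub_zero]

variable {d : ℕ} {n : Type} [Fintype n]
  {D : Matrix (Fin d) (Fin d) ℂ →ₗ[ℂ] Matrix n n ℂ} {γ : Fin d → ℤ} {v : n → ℂ}

theorem isHighestWeight_of_single
    (hraise : ∀ i j, i < j → D (Matrix.single i j 1) *ᵥ v = 0)
    (hdiag : ∀ i, D (Matrix.single i i 1) *ᵥ v = (γ i : ℂ) • v) : IsHighestWeight D γ v := by
  intro X hX
  have hentry (i j : Fin d) : D (Matrix.single i j (X i j)) *ᵥ v =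
      if j = i then ((γ i : ℂ) * X i i) • v else 0 := by
    rw [← mul_one (X i j), ← smul_eq_mul, ← Matrix.smul_single, map_smul, Matrix.smul_mulVec]
    split_ifs with hij
    · rw [hij, hdiag, smul_smul, mul_comm]
    · rcases lt_or_gt_of_ne hij with hlt | hgt
      · rw [hX hlt, zero_smul]
      · rw [hraise i j hgt, smul_zero]
  conv_lhs => rw [Matrix.matrix_eq_sum_single X]
  simp only [map_sum, Matrix.sum_mulVec, hentry, Finset.sum_ite_eq', Finset.mem_univ, if_true,
    Finset.sum_smul]

variable [DecidableEq n] {R : MatRep d n}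

namespace IsDifferential

/-- The one-parameter subgroup `t ↦ diag(1, …, exp (i t), …, 1)` is `2π`-periodic. -/
theorem exists_int_eq_of_mulVec_eq_smul (h : IsDifferential R D) (hv : v ≠ 0) {i : Fin d} {a : ℂ}
    (ha : D (Matrix.single i i 1) *ᵥ v = a • v) : ∃ k : ℤ, a = k := by
  let H : selfAdjoint (Matrix (Fin d) (Fin d) ℂ) :=
    ⟨Matrix.single i i (2 * Real.pi), by
      simp [mem_iff, Matrix.star_eq_conjTranspose, Matrix.conjTranspose_single]⟩
  have hperiod : expUnitary H = 1 := by
    have hentry : NormedSpace.exp (Pi.single i (2 * Real.pi * I) : Fin d → ℂ) = 1 := by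
      ext k
      rw [Pi.coe_exp, ← Complex.exp_eq_exp_ℂ]
      obtain rfl | hk := eq_or_ne k i <;> simp [Complex.exp_two_pi_mul_I, *]
    ext1
    rw [expUnitary_coe, OneMemClass.coe_one, ← Matrix.diagonal_one, ← Pi.one_def,
      ← hentry, ← Matrix.exp_diagonal, Matrix.diagonal_single, Matrix.smul_single, smul_eq_mul,
      mul_comm]
  have hact : (I • D H) *ᵥ v = (2 * Real.pi * I * a) • v := by
    have hH : (H : Matrix (Fin d) (Fin d) ℂ) = (2 * Real.pi : ℂ) • Matrix.single i i 1 := by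
      simp [H, Matrix.smul_single]
    rw [hH, map_smul, Matrix.smul_mulVec, Matrix.smul_mulVec, ha, smul_smul, smul_smul]
    ring_nf
  have hfix := exp_mulVec_of_mulVec_eq_smul hact
  rw [← h.map_expUnitary, hperiod, map_one, Matrix.one_mulVec] at hfix
  have hexp : Complex.exp (2 * Real.pi * I * a) = 1 :=
    smul_left_injective ℂ hv (by simpa using hfix.symm)
  obtain ⟨k, hk⟩ := Complex.exp_eq_one_iff.1 hexp
  exact ⟨k, mul_left_cancel₀ two_pi_I_ne_zero (by rw [hk, mul_comm])⟩

/-- The squared norm of the lowered vector `E_ji v` is `(γ_i - γ_j) ‖v‖²`. -/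
theorem antitone_of_isHighestWeight (h : IsDifferential R D) (hv : v ≠ 0)
    (hγ : IsHighestWeight D γ v) : Antitone γ := by
  intro i j hij
  obtain rfl | hij := hij.eq_or_lt
  · rfl
  have hraise : D (Matrix.single i j 1) *ᵥ v = 0 :=
    hγ.isSingular _ (Matrix.blockTriangular_single hij.le 1)
      (Matrix.diag_single_of_ne _ _ _ hij.ne)
  have hdiag (k : Fin d) : D (Matrix.single k k 1) *ᵥ v = (γ k : ℂ) • v := by
    simpa [Matrix.single_apply] using hγ _ (Matrix.blockTriangular_single le_rfl 1)
  have hraiseLower : D (Matrix.single i j 1) *ᵥ (D (Matrix.single j i 1) *ᵥ v) =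
      ((γ i : ℂ) - γ j) • v := by
    have hlie : ⁅Matrix.single i j (1 : ℂ), Matrix.single j i (1 : ℂ)⁆ =
        Matrix.single i i 1 - Matrix.single j j 1 := by simp [Ring.lie_def]
    have := congrArg (· *ᵥ v) (h.map_lie (Matrix.single i j 1) (Matrix.single j i 1))
    simpa only [hlie, map_sub, Ring.lie_def, Matrix.sub_mulVec, ← Matrix.mulVec_mulVec, hraise,
      hdiag, Matrix.mulVec_zero, sub_zero, ← sub_smul] using this.symm
  have hnorm : star (D (Matrix.single j i 1) *ᵥ v) ⬝ᵥ (D (Matrix.single j i 1) *ᵥ v) =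
      ((γ i : ℂ) - γ j) * (star v ⬝ᵥ v) := by
    rw [Matrix.star_mulVec, ← Matrix.dotProduct_mulVec, ← Matrix.star_eq_conjTranspose,
      ← h.map_star, Matrix.star_eq_conjTranspose, Matrix.conjTranspose_single, star_one,
      hraiseLower, dotProduct_smul, smul_eq_mul]
  have hnonneg : (0 : ℂ) ≤ (γ i : ℂ) - γ j := by
    refine le_of_mul_le_mul_right ?_ (Matrix.dotProduct_star_self_pos_iff.2 hv)
    rw [zero_mul, ← hnorm]
    exact dotProduct_star_self_nonneg _
  exact_mod_cast sub_nonneg.1 hnonneg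

theorem mulVec_mulVec_eq_add_lie (h : IsDifferential R D) (X Y : Matrix (Fin d) (Fin d) ℂ)
    (v : n → ℂ) : D X *ᵥ (D Y *ᵥ v) = D Y *ᵥ (D X *ᵥ v) + D ⁅X, Y⁆ *ᵥ v := by
  rw [h.map_lie, Ring.lie_def, Matrix.sub_mulVec, Matrix.mulVec_mulVec, Matrix.mulVec_mulVec,
    add_sub_cancel]

theorem commute_diagonal (h : IsDifferential R D) (x y : Fin d → ℂ) :
    Commute (D (Matrix.diagonal x)).mulVecLin (D (Matrix.diagonal y)).mulVecLin := by
  have hlie : ⁅Matrix.diagonal x, Matrix.diagonal y⁆ = 0 := by simp [Ring.lie_def, mul_comm]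
  exact LinearMap.ext fun v => by
    simpa [hlie] using h.mulVec_mulVec_eq_add_lie (Matrix.diagonal x) (Matrix.diagonal y) v

/-- Among the joint eigenvectors of the diagonal matrices in `V`, one of largest eigenvalue for
`diag (0, -1, …, 1 - d)` is killed by the raising operators, since these increase it. -/
theorem exists_weightVector_raising_eq_zero (h : IsDifferential R D) {V : Submodule ℂ (n → ℂ)}
    (hV0 : V ≠ ⊥) (hVD : ∀ X, ∀ v ∈ V, D X *ᵥ v ∈ V) :
    ∃ v ∈ V, v ≠ 0 ∧ (∀ i j, i < j → D (Matrix.single i j 1) *ᵥ v = 0) ∧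
      ∀ x, ∃ a : ℂ, D (Matrix.diagonal x) *ᵥ v = a • v := by
  let H : Fin d → ℂ := fun i => -i
  let eigenspace (c : ℂ) := V ⊓ Module.End.eigenspace (D (Matrix.diagonal H)).mulVecLin c
  have hfin : {c | eigenspace c ≠ ⊥}.Finite :=
    (Module.End.finite_hasEigenvalue (D (Matrix.diagonal H)).mulVecLin).subset
      fun c hc => ne_bot_of_le_ne_bot hc inf_le_right
  have hne : {c | eigenspace c ≠ ⊥}.Nonempty := by
    obtain ⟨v, hv, hv0, ha⟩ := exists_common_eigenvector hV0
      (fun x => hVD (Matrix.diagonal x)) h.commute_diagonal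
    obtain ⟨a, ha⟩ := ha H
    exact ⟨a, (Submodule.ne_bot_iff _).2 ⟨v, ⟨hv, Module.End.mem_eigenspace_iff.2 ha⟩, hv0⟩⟩
  obtain ⟨c, hc, hmax⟩ := Set.exists_max_image _ re hfin hne
  obtain ⟨v, hv, hv0, ha⟩ := exists_common_eigenvector hc
    (fun x v hv => ⟨hVD (Matrix.diagonal x) v hv.1,
      Module.End.mapsTo_genEigenspace_of_comm (h.commute_diagonal H x) c 1 hv.2⟩) h.commute_diagonal
  have hvH : D (Matrix.diagonal H) *ᵥ v = c • v := Module.End.mem_eigenspace_iff.1 hv.2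
  refine ⟨v, hv.1, hv0, fun i j hij => by_contra fun hne => ?_, ha⟩
  have hbracket : ⁅Matrix.diagonal H, Matrix.single i j (1 : ℂ)⁆ =
      ((j : ℂ) - i) • Matrix.single i j (1 : ℂ) := by
    rw [lie_diagonal_single, neg_sub_neg]
  have hmem : eigenspace (c + (j - i)) ≠ ⊥ := by
    refine (Submodule.ne_bot_iff _).2 ⟨_, ⟨hVD _ v hv.1, Module.End.mem_eigenspace_iff.2 ?_⟩, hne⟩
    rw [Matrix.mulVecLin_apply, h.mulVec_mulVec_eq_add_lie, hvH, hbracket, Matrix.mulVec_smul,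
      map_smul, Matrix.smul_mulVec, add_smul]
  have hle := hmax _ hmem
  simp only [add_re, sub_re, natCast_re] at hle
  have hlt : ((i : ℕ) : ℝ) < (j : ℕ) := by exact_mod_cast hij
  linarith

theorem exists_isHighestWeight (h : IsDifferential R D) {V : Submodule ℂ (n → ℂ)} (hV0 : V ≠ ⊥)
    (hV : ∀ g, ∀ v ∈ V, R g *ᵥ v ∈ V) :
    ∃ v ∈ V, v ≠ 0 ∧ ∃ γ : Staircase d, IsHighestWeight D γ.1 v := by
  obtain ⟨v, hv, hv0, hraise, hdiag⟩ :=
    h.exists_weightVector_raising_eq_zero hV0 fun X v hv => h.apply_mulVec_mem hV X hv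
  have hweight (i : Fin d) : ∃ k : ℤ, D (Matrix.single i i 1) *ᵥ v = (k : ℂ) • v := by
    obtain ⟨a, ha⟩ := hdiag (Pi.single i 1)
    rw [Matrix.diagonal_single] at ha
    obtain ⟨k, rfl⟩ := h.exists_int_eq_of_mulVec_eq_smul hv0 ha
    exact ⟨k, ha⟩
  choose γ hγ using hweight
  have hvγ := isHighestWeight_of_single hraise hγ
  exact ⟨v, hv, hv0, ⟨γ, h.antitone_of_isHighestWeight hv0 hvγ⟩, hvγ⟩

end IsDifferential

end Irreducibility

section HighestWeight

variable {d : ℕ} {m n : Type} [Fintype m] [Fintype n]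
  {D : Matrix (Fin d) (Fin d) ℂ →ₗ[ℂ] Matrix m m ℂ}
  {D' : Matrix (Fin d) (Fin d) ℂ →ₗ[ℂ] Matrix n n ℂ} {γ γ' : Fin d → ℤ}
  {u w : m → ℂ} {w' : n → ℂ}

theorem IsHighestWeight.weight_unique (h : IsHighestWeight D γ w) (h' : IsHighestWeight D γ' w)
    (hw : w ≠ 0) : γ = γ' := by
  funext i
  have hX := Matrix.blockTriangular_single (b := id) (le_refl i) (1 : ℂ)
  have hsum := smul_left_injective ℂ hw ((h _ hX).symm.trans (h' _ hX))
  simpa [Matrix.single_apply] using hsum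

theorem IsHighestWeight.mulVec (h : IsHighestWeight D γ w) {M : Matrix n m ℂ}
    (hM : ∀ X, D' X * M = M * D X) : IsHighestWeight D' γ (M *ᵥ w) := fun X hX => by
  rw [Matrix.mulVec_mulVec, hM, ← Matrix.mulVec_mulVec, h X hX, Matrix.mulVec_smul]

theorem IsSingular.sub_smul (hu : IsSingular D u) (hw : IsSingular D w) (c : ℂ) :
    IsSingular D (u - c • w) := fun X hX hdiag => by
  rw [Matrix.mulVec_sub, Matrix.mulVec_smul, hu X hX hdiag, hw X hX hdiag, smul_zero, sub_zero]

variable [DecidableEq m] [DecidableEq n] {R : MatRep d m} {S : MatRep d n}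

theorem eq_zero_of_isSingular (h : IsDifferential R D) (hw : IsHighestWeight D γ w)
    (hspan : Submodule.span ℂ (Set.range fun g => R g *ᵥ w) = ⊤) (hw0 : w ≠ 0)
    (hu : IsSingular D u) (horth : star u ⬝ᵥ w = 0) : u = 0 := by
  have hcoeff (g : U d) : star u ⬝ᵥ (R g *ᵥ w) = 0 := by
    have hprop := coeff_proportional h h hu hw.isSingular hw hw g
    have hone : coeff u w 1 = 0 := by simpa [coeff] using horth
    rw [hone, mul_zero] at hprop
    refine (mul_eq_zero.1 hprop).resolve_right ?_
    simpa [coeff] using hw0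
  have hzero : dotProductBilin ℂ ℂ (star u) = 0 :=
    LinearMap.ext_on_range hspan fun g => by simpa using hcoeff g
  exact dotProduct_star_self_eq_zero.1 (LinearMap.congr_fun hzero u)

theorem exists_eq_smul_of_isSingular (h : IsDifferential R D) (hw : IsHighestWeight D γ w)
    (hspan : Submodule.span ℂ (Set.range fun g => R g *ᵥ w) = ⊤) (hw0 : w ≠ 0)
    (hu : IsSingular D u) : ∃ c : ℂ, u = c • w := by
  have hnorm : star w ⬝ᵥ w ≠ 0 := by simpa using hw0
  let c := star (star u ⬝ᵥ w / star w ⬝ᵥ w)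
  refine ⟨c, sub_eq_zero.1
    (eq_zero_of_isSingular h hw hspan hw0 (hu.sub_smul hw.isSingular c) ?_)⟩
  rw [star_sub, star_smul, star_star, sub_dotProduct, smul_dotProduct, smul_eq_mul,
    div_mul_cancel₀ _ hnorm, sub_self]

/-- Proportionality of the matrix coefficients makes `∑ a_g S g w'` orthogonal to every `S g w'`,
hence to itself. -/
theorem linearCombination_eq_zero_of_isHighestWeight (h : IsDifferential R D)
    (h' : IsDifferential S D') (hw : IsHighestWeight D γ w) (hw' : IsHighestWeight D' γ w')
    (hw0 : w ≠ 0) {a : U d →₀ ℂ}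
    (ha : Finsupp.linearCombination ℂ (fun g => R g *ᵥ w) a = 0) :
    Finsupp.linearCombination ℂ (fun g => S g *ᵥ w') a = 0 := by
  let f := Finsupp.linearCombination ℂ fun g => R g *ᵥ w
  let f' := Finsupp.linearCombination ℂ fun g => S g *ᵥ w'
  have hcoeff (g : U d) (a : U d →₀ ℂ) : (star w ⬝ᵥ (R g *ᵥ f a)) * coeff w' w' 1 =
      (star w' ⬝ᵥ (S g *ᵥ f' a)) * coeff w w 1 := by
    induction a using Finsupp.induction_linear with
    | zero => simp
    | add a a' ha ha' => simp [Matrix.mulVec_add, add_mul, ha, ha']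
    | single k c =>
      have hprop := coeff_proportional h h' hw.isSingular hw'.isSingular hw hw' (g * k)
      simpa [f, f', Matrix.mulVec_smul, mul_assoc, coeff] using Or.inl hprop
  have horth (g : U d) : star (f' a) ⬝ᵥ (S g *ᵥ w') = 0 := by
    have hcoeff := hcoeff g⁻¹ a
    rw [show f a = 0 from ha, Matrix.mulVec_zero, dotProduct_zero, zero_mul, eq_comm,
      mul_eq_zero] at hcoeff
    have hzero := hcoeff.resolve_right (by simpa [coeff] using hw0)
    rw [h'.map_inv, Matrix.star_eq_conjTranspose, Matrix.dotProduct_mulVec,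
      ← Matrix.star_mulVec] at hzero
    rw [Matrix.star_dotProduct, hzero, star_zero]
  have hzero : dotProductBilin ℂ ℂ (star (f' a)) ∘ₗ f' = 0 :=
    Finsupp.lhom_ext fun g c => by simp [f', horth]
  exact dotProduct_star_self_eq_zero.1 (LinearMap.congr_fun hzero a)

/-- The intertwiner is `R g w ↦ S g w'`, which respects linear relations. -/
theorem exists_mem_intertwiners_mulVec_eq (h : IsDifferential R D) (h' : IsDifferential S D')
    (hw : IsHighestWeight D γ w) (hw' : IsHighestWeight D' γ w')
    (hspan : Submodule.span ℂ (Set.range fun g => R g *ᵥ w) = ⊤) (hw0 : w ≠ 0) :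
    ∃ M ∈ intertwiners R S, M *ᵥ w = w' := by
  let f := Finsupp.linearCombination ℂ fun g => R g *ᵥ w
  let f' := Finsupp.linearCombination ℂ fun g => S g *ᵥ w'
  obtain ⟨r, hr⟩ := f.exists_rightInverse_of_surjective
    ((Finsupp.range_linearCombination _).trans hspan)
  let M := LinearMap.toMatrix' (f' ∘ₗ r)
  have hM (g : U d) : M *ᵥ (R g *ᵥ w) = S g *ᵥ w' := by
    have hrel : f' (r (f (.single g 1)) - .single g 1) = 0 :=
      linearCombination_eq_zero_of_isHighestWeight h h' hw hw' hw0
        (by rw [map_sub, sub_eq_zero]; exact LinearMap.congr_fun hr _)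
    rw [LinearMap.toMatrix'_mulVec]
    simpa [f, f', sub_eq_zero] using hrel
  refine ⟨M, fun g => Matrix.toLin'.injective (LinearMap.ext_on_range hspan fun k => ?_), ?_⟩
  · rw [Matrix.toLin'_apply, Matrix.toLin'_apply, ← Matrix.mulVec_mulVec, ← Matrix.mulVec_mulVec,
      Matrix.mulVec_mulVec _ (R g), ← map_mul, hM, hM, Matrix.mulVec_mulVec, ← map_mul]
  · simpa using hM 1

end HighestWeight

/-! ### Schur's lemma and complete reducibility -/

section Schur

variable {d : ℕ} {b : Bases d} {γ γ' : Staircase d} {n : Type} [Fintype n] [DecidableEq n]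
  {R : MatRep d n}

theorem exists_isDifferential_rep (b : Bases d) (γ : Staircase d) :
    ∃ D, IsDifferential (rep b γ) D ∧ IsHighestWeight D γ.1 (hwCoord b γ) := by
  refine ⟨_, isDifferential_tensorMat.of_isometry conjTranspose_basisMat_mul_self
    basisMat_mem_intertwiners, fun X hX => ?_⟩
  change (((basisMat b γ)ᴴ * tensorDeriv γ X) * basisMat b γ) *ᵥ hwCoord b γ = _
  rw [← Matrix.mulVec_mulVec, basisMat_mulVec_hwCoord, ← Matrix.mulVec_mulVec,
    tensorDeriv_mulVec_hwVec hX, Matrix.mulVec_smul]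
  rfl

theorem isSmooth_rep : IsSmooth (rep b γ) :=
  let ⟨D, hD, _⟩ := exists_isDifferential_rep b γ
  ⟨D, hD⟩

theorem intertwiner_eq_zero_of_mulVec_hwCoord {M : Matrix n (Fin (dimQ γ)) ℂ}
    (hM : M ∈ intertwiners (rep b γ) R) (hzero : M *ᵥ hwCoord b γ = 0) : M = 0 :=
  Matrix.toLin'.injective <| LinearMap.ext_on_range span_rep_mulVec_hwCoord fun g => by
    rw [Matrix.toLin'_apply, Matrix.mulVec_mulVec, ← hM g, ← Matrix.mulVec_mulVec, hzero,
      Matrix.mulVec_zero, map_zero, LinearMap.zero_apply]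

theorem exists_mulVec_hwCoord_eq_smul {M : Matrix (Fin (dimQ γ')) (Fin (dimQ γ)) ℂ}
    (hM : M ∈ intertwiners (rep b γ) (rep b γ')) :
    ∃ c : ℂ, M *ᵥ hwCoord b γ = c • hwCoord b γ' ∧ (γ ≠ γ' → c = 0) := by
  obtain ⟨D, hD, hw⟩ := exists_isDifferential_rep b γ
  obtain ⟨D', hD', hw'⟩ := exists_isDifferential_rep b γ'
  have hMw : IsHighestWeight D' γ.1 (M *ᵥ hwCoord b γ) := hw.mulVec (hD.intertwines hD' hM)
  obtain ⟨c, hc⟩ := exists_eq_smul_of_isSingular hD' hw' span_rep_mulVec_hwCoord hwCoord_ne_zero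
    hMw.isSingular
  refine ⟨c, hc, fun hne => by_contra fun hc0 => hne (Subtype.ext ?_)⟩
  refine hMw.weight_unique (fun X hX => ?_) (by rw [hc]; exact smul_ne_zero hc0 hwCoord_ne_zero)
  rw [hc, Matrix.mulVec_smul, hw' X hX, smul_comm]

theorem schur_of_ne (hne : γ ≠ γ') {M : Matrix (Fin (dimQ γ')) (Fin (dimQ γ)) ℂ}
    (hM : M ∈ intertwiners (rep b γ) (rep b γ')) : M = 0 := by
  obtain ⟨c, hc, hc0⟩ := exists_mulVec_hwCoord_eq_smul hM
  exact intertwiner_eq_zero_of_mulVec_hwCoord hM (by rw [hc, hc0 hne, zero_smul])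

theorem one_mem_intertwiners : 1 ∈ intertwiners R R := fun g => by
  rw [Matrix.mul_one, Matrix.one_mul]

theorem schur {M : Matrix (Fin (dimQ γ)) (Fin (dimQ γ)) ℂ}
    (hM : M ∈ intertwiners (rep b γ) (rep b γ)) : ∃ c : ℂ, M = c • 1 := by
  obtain ⟨c, hc, _⟩ := exists_mulVec_hwCoord_eq_smul hM
  have hmem := Submodule.sub_mem _ hM (Submodule.smul_mem _ c one_mem_intertwiners)
  refine ⟨c, sub_eq_zero.1 (intertwiner_eq_zero_of_mulVec_hwCoord hmem ?_)⟩
  rw [Matrix.sub_mulVec, hc, Matrix.smul_mulVec, Matrix.one_mulVec, sub_self]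

theorem exists_intertwiner_of_stable (b : Bases d) (hR : IsSmooth R)
    {V : Submodule ℂ (n → ℂ)} (hV0 : V ≠ ⊥) (hV : ∀ g, ∀ v ∈ V, R g *ᵥ v ∈ V) :
    ∃ γ, ∃ M ∈ intertwiners (rep b γ) R, M ≠ 0 ∧ ∀ x, M *ᵥ x ∈ V := by
  obtain ⟨D, hD⟩ := hR
  obtain ⟨v, hv, hv0, γ, hvγ⟩ := hD.exists_isHighestWeight hV0 hV
  obtain ⟨D', hD', hw⟩ := exists_isDifferential_rep b γ
  obtain ⟨M, hM, hMv⟩ := exists_mem_intertwiners_mulVec_eq hD' hD hw hvγ span_rep_mulVec_hwCoord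
    hwCoord_ne_zero
  refine ⟨γ, M, hM, fun hM0 => hv0 (by rw [← hMv, hM0, Matrix.zero_mulVec]), fun x => ?_⟩
  have hle : ⊤ ≤ V.comap M.mulVecLin := by
    rw [← span_rep_mulVec_hwCoord (b := b), Submodule.span_le]
    rintro _ ⟨g, rfl⟩
    change M *ᵥ (rep b γ g *ᵥ hwCoord b γ) ∈ V
    rw [Matrix.mulVec_mulVec, ← hM g, ← Matrix.mulVec_mulVec, hMv]
    exact hV g v hv
  exact hle Submodule.mem_top

end Schur

/-! ### Orthonormal families of intertwiners -/

section OrthoBasis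

variable {d : ℕ} {b : Bases d} {γ γ' : Staircase d} {l m n : Type} [Fintype l] [DecidableEq l]
  [Fintype m] [DecidableEq m] [Fintype n] [DecidableEq n]
  {P : MatRep d l} {R : MatRep d m} {S : MatRep d n}

theorem mul_mem_intertwiners {N : Matrix l n ℂ} {M : Matrix n m ℂ} (hN : N ∈ intertwiners S P)
    (hM : M ∈ intertwiners R S) : N * M ∈ intertwiners R P := fun g => by
  rw [← Matrix.mul_assoc, hN g, Matrix.mul_assoc, hM g, Matrix.mul_assoc]

theorem conjTranspose_mem_intertwiners (hR : IsSmooth R) (hS : IsSmooth S) {M : Matrix n m ℂ}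
    (hM : M ∈ intertwiners R S) : Mᴴ ∈ intertwiners S R := fun g => by
  have hadj := congrArg Matrix.conjTranspose (hM g⁻¹)
  rw [hR.map_inv, hS.map_inv, Matrix.conjTranspose_mul, Matrix.conjTranspose_mul,
    Matrix.conjTranspose_conjTranspose, Matrix.conjTranspose_conjTranspose] at hadj
  exact hadj.symm

theorem conjTranspose_mul_mem_intertwiners (hR : IsSmooth R)
    {M : Matrix m (Fin (dimQ γ)) ℂ} {N : Matrix m (Fin (dimQ γ')) ℂ}
    (hM : M ∈ intertwiners (rep b γ) R) (hN : N ∈ intertwiners (rep b γ') R) :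
    Mᴴ * N ∈ intertwiners (rep b γ') (rep b γ) :=
  mul_mem_intertwiners (conjTranspose_mem_intertwiners isSmooth_rep hR hM) hN

theorem conjTranspose_mul_eq_zero_of_ne (hR : IsSmooth R) (hne : γ ≠ γ')
    {M : Matrix m (Fin (dimQ γ)) ℂ} {N : Matrix m (Fin (dimQ γ')) ℂ}
    (hM : M ∈ intertwiners (rep b γ) R) (hN : N ∈ intertwiners (rep b γ') R) : Mᴴ * N = 0 :=
  schur_of_ne hne.symm (conjTranspose_mul_mem_intertwiners hR hM hN)

theorem dimQ_ne_zero : (dimQ γ : ℂ) ≠ 0 := Nat.cast_ne_zero.2 dimQ_pos.ne'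

instance : NeZero (dimQ γ) := ⟨dimQ_pos.ne'⟩

theorem eq_trace_div_smul_one {M : Matrix (Fin (dimQ γ)) (Fin (dimQ γ)) ℂ}
    (hM : M ∈ intertwiners (rep b γ) (rep b γ)) : M = (M.trace / dimQ γ) • 1 := by
  obtain ⟨c, rfl⟩ := schur hM
  rw [Matrix.trace_smul, Matrix.trace_one, Fintype.card_fin, smul_eq_mul,
    mul_div_cancel_right₀ _ dimQ_ne_zero]

/-- An orthonormal basis of the space of intertwiners from `Q_γ` to `R`, for the inner product
that Schur's lemma reads off from `Mᴴ * N = ⟪M, N⟫ • 1`. -/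
structure IsOrthoBasis (b : Bases d) (R : MatRep d m) (γ : Staircase d) {c : ℕ}
    (J : Fin c → Matrix m (Fin (dimQ γ)) ℂ) : Prop where
  card : c = Module.finrank ℂ (intertwiners (rep b γ) R)
  mem (k : Fin c) : J k ∈ intertwiners (rep b γ) R
  ortho (k l : Fin c) : (J k)ᴴ * J l = if k = l then 1 else 0

namespace IsOrthoBasis

variable {c : ℕ} {J : Fin c → Matrix m (Fin (dimQ γ)) ℂ}

theorem conjTranspose_mul_sum (hJ : IsOrthoBasis b R γ J) (a : Fin c → ℂ) (k : Fin c) :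
    (J k)ᴴ * ∑ l, a l • J l = a k • 1 := by
  simp [Matrix.mul_sum, hJ.ortho]

theorem exists_eq_sum (hJ : IsOrthoBasis b R γ J) {M : Matrix m (Fin (dimQ γ)) ℂ}
    (hM : M ∈ intertwiners (rep b γ) R) : ∃ a : Fin c → ℂ, M = ∑ k, a k • J k := by
  let J' (k : Fin c) : intertwiners (rep b γ) R := ⟨J k, hJ.mem k⟩
  have hindep : LinearIndependent ℂ J' := by
    refine Fintype.linearIndependent_iff.2 fun a ha k => ?_
    have hcoord := hJ.conjTranspose_mul_sum a k
    have hsum : ∑ l, a l • J l = 0 := by simpa [J'] using congrArg Subtype.val ha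
    rw [hsum, Matrix.mul_zero] at hcoord
    exact (smul_eq_zero.1 hcoord.symm).resolve_right one_ne_zero
  have hspan := hindep.span_eq_top_of_card_eq_finrank' ((Fintype.card_fin c).trans hJ.card)
  obtain ⟨a, ha⟩ := (Submodule.mem_span_range_iff_exists_fun ℂ).1
    (hspan ▸ Submodule.mem_top : (⟨M, hM⟩ : intertwiners (rep b γ) R) ∈ _)
  exact ⟨a, by simpa [J'] using (congrArg Subtype.val ha).symm⟩

end IsOrthoBasis

theorem exists_isOrthoBasis (b : Bases d) (hR : IsSmooth R) (γ : Staircase d) :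
    ∃ J : Fin (Module.finrank ℂ (intertwiners (rep b γ) R)) → Matrix m (Fin (dimQ γ)) ℂ,
      IsOrthoBasis b R γ J := by
  let core : InnerProductSpace.Core ℂ (intertwiners (rep b γ) R) :=
    { inner M N := (M.1ᴴ * N.1).trace / dimQ γ
      conj_inner_symm M N := by
        simp [starRingEnd_apply, ← Matrix.trace_conjTranspose]
      re_inner_nonneg M := by
        have hpos := (Matrix.posSemidef_conjTranspose_mul_self M.1).trace_nonneg
        exact (RCLike.nonneg_iff.1 (div_nonneg hpos (Nat.cast_nonneg _))).1
      add_left M N P := by simp [Matrix.add_mul, add_div]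
      smul_left M N c := by simp [mul_div_assoc]
      definite M hM := by
        have htrace := (div_eq_zero_iff.1 hM).resolve_right dimQ_ne_zero
        exact Subtype.ext (Matrix.trace_conjTranspose_mul_self_eq_zero_iff.1 htrace) }
  let := core.toNormedAddCommGroup
  let := InnerProductSpace.ofCore core.toCore
  let e := stdOrthonormalBasis ℂ (intertwiners (rep b γ) R)
  refine ⟨fun k => e k, rfl, fun k => (e k).2, fun k l => ?_⟩
  rw [eq_trace_div_smul_one (conjTranspose_mul_mem_intertwiners hR (e k).2 (e l).2)]
  have horth : ((e k).1ᴴ * (e l).1).trace / dimQ γ = if k = l then 1 else 0 :=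
    orthonormal_iff_ite.1 e.orthonormal k l
  rw [horth, ite_smul, one_smul, zero_smul]

end OrthoBasis

/-! ### Existence of Clebsch-Gordan transforms -/

section FamilyMat

variable {d : ℕ} {b : Bases d} {m n : Type} {c : Staircase d → ℕ} {supp : Finset (Staircase d)}
  {J : ∀ γ, Fin (c γ) → Matrix n (Fin (dimQ γ)) ℂ}

variable (supp J) in
/-- The matrix whose rows are the adjoints of the columns of the `J γ k`, that is the operator
`v ↦ ⨁ γ, ∑ k, (J γ k)ᴴ v ⊗ e_k`. -/
def familyMat : Matrix (Σ γ : supp, Fin (dimQ γ.1) × Fin (c γ.1)) n ℂ :=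
  Matrix.of fun p x => star (J p.1.1 p.2.2 x p.2.1)

theorem blockDiagonal'_mul_familyMat
    (A : ∀ γ : supp, Matrix (Fin (dimQ γ.1)) (Fin (dimQ γ.1)) ℂ) (γ : supp) (q : Fin (dimQ γ.1))
    (k : Fin (c γ.1)) (x : n) :
    (Matrix.blockDiagonal' (fun γ : supp => A γ ⊗ₖ (1 : Matrix (Fin (c γ.1)) (Fin (c γ.1)) ℂ)) *
      familyMat supp J) ⟨γ, q, k⟩ x = (A γ * (J γ.1 k)ᴴ) q x := by
  rw [Matrix.mul_apply, Fintype.sum_sigma, Finset.sum_eq_single γ]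
  · simp [Fintype.sum_prod_type, Matrix.one_apply, Matrix.mul_apply, familyMat]
  · intro γ' _ hne
    exact Finset.sum_eq_zero fun p _ => by
      rw [Matrix.blockDiagonal'_apply_ne _ _ _ hne.symm, zero_mul]
  · simp

variable [Fintype n]

theorem familyMat_mul_conjTranspose_apply (γ γ' : supp) (q : Fin (dimQ γ.1)) (q' : Fin (dimQ γ'.1))
    (k : Fin (c γ.1)) (k' : Fin (c γ'.1)) :
    (familyMat supp J * (familyMat supp J)ᴴ) ⟨γ, q, k⟩ ⟨γ', q', k'⟩ =
      ((J γ.1 k)ᴴ * J γ'.1 k') q q' := by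
  simp [Matrix.mul_apply, familyMat]

variable [DecidableEq n] {R : MatRep d n}

theorem familyMat_mul_apply (hR : IsSmooth R) (hJ : ∀ γ, IsOrthoBasis b R γ (J γ)) (g : U d) :
    familyMat supp J * R g = Matrix.blockDiagonal' (fun γ : supp =>
      rep b γ.1 g ⊗ₖ (1 : Matrix (Fin (c γ.1)) (Fin (c γ.1)) ℂ)) * familyMat supp J := by
  ext ⟨γ, q, k⟩ x
  rw [blockDiagonal'_mul_familyMat,
    conjTranspose_mem_intertwiners isSmooth_rep hR ((hJ γ.1).mem k) g]
  rfl

theorem familyMat_mul_conjTranspose (hR : IsSmooth R) (hJ : ∀ γ, IsOrthoBasis b R γ (J γ)) :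
    familyMat supp J * (familyMat supp J)ᴴ = 1 := by
  ext ⟨γ, q, k⟩ ⟨γ', q', k'⟩
  rw [familyMat_mul_conjTranspose_apply]
  obtain rfl | hne := eq_or_ne γ γ'
  · rw [(hJ γ.1).ortho]
    by_cases hk : k = k' <;> simp [hk, Matrix.one_apply]
  · rw [conjTranspose_mul_eq_zero_of_ne hR (Subtype.coe_ne_coe.2 hne) ((hJ _).mem _) ((hJ _).mem _),
      Matrix.zero_apply, Matrix.one_apply_ne fun heq => hne (congrArg Sigma.fst heq)]

theorem familyMat_ker_eq_bot (hR : IsSmooth R) (hJ : ∀ γ, IsOrthoBasis b R γ (J γ))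
    (hsupp : ∀ γ, 0 < c γ → γ ∈ supp) :
    LinearMap.ker (familyMat supp J).mulVecLin = ⊥ := by
  by_contra hker
  obtain ⟨γ, M, hM, hM0, hMker⟩ := exists_intertwiner_of_stable b hR hker fun g v hv => by
    rw [LinearMap.mem_ker, Matrix.mulVecLin_apply] at hv ⊢
    rw [Matrix.mulVec_mulVec, familyMat_mul_apply hR hJ, ← Matrix.mulVec_mulVec, hv,
      Matrix.mulVec_zero]
  obtain ⟨a, rfl⟩ := (hJ γ).exists_eq_sum hM
  refine hM0 (Finset.sum_eq_zero fun k _ => ?_)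
  have hcoord : (J γ k)ᴴ * ∑ l, a l • J γ l = 0 := by
    refine Matrix.toLin'.injective (LinearMap.ext fun x => ?_)
    rw [Matrix.toLin'_apply, ← Matrix.mulVec_mulVec, map_zero]
    funext q
    exact congrFun (hMker x) ⟨⟨γ, hsupp γ k.pos⟩, q, k⟩
  rw [(hJ γ).conjTranspose_mul_sum] at hcoord
  rw [(smul_eq_zero.1 hcoord).resolve_right one_ne_zero, zero_smul]

theorem familyMat_conjTranspose_mul (hR : IsSmooth R) (hJ : ∀ γ, IsOrthoBasis b R γ (J γ))
    (hsupp : ∀ γ, 0 < c γ → γ ∈ supp) : (familyMat supp J)ᴴ * familyMat supp J = 1 := by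
  have hinj := LinearMap.ker_eq_bot.1 (familyMat_ker_eq_bot hR hJ hsupp)
  refine Matrix.toLin'.injective (LinearMap.ext fun x => hinj ?_)
  simp only [Matrix.toLin'_apply, Matrix.mulVecLin_apply, Matrix.mulVec_mulVec]
  rw [← Matrix.mul_assoc, familyMat_mul_conjTranspose hR hJ, Matrix.one_mul, Matrix.mul_one]

end FamilyMat

section CGTransform

variable {d : ℕ} {b : Bases d} {m n : Type} [Fintype m] [DecidableEq m] [Fintype n] [DecidableEq n]
  {R : MatRep d m} {S : MatRep d n} {J : ∀ γ, Fin (mult b R S γ) → Matrix (m × n) (Fin (dimQ γ)) ℂ}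

theorem exists_isOrthoBasis_tensor (b : Bases d) (h : IsSmooth (tensor R S)) :
    ∃ J : ∀ γ, Fin (mult b R S γ) → Matrix (m × n) (Fin (dimQ γ)) ℂ,
      ∀ γ, IsOrthoBasis b (tensor R S) γ (J γ) :=
  Classical.skolem.1 (exists_isOrthoBasis b h)

/-- The first columns of intertwiners from distinct `Q_γ` are orthonormal. -/
theorem finite_labels (h : IsSmooth (tensor R S)) : (labels b R S).Finite := by
  obtain ⟨J, hJ⟩ := exists_isOrthoBasis_tensor b h
  let v (γ : labels b R S) : EuclideanSpace ℂ (m × n) := WithLp.toLp 2 ((J γ.1 ⟨0, γ.2⟩).col 0)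
  have hv : Orthonormal ℂ v := by
    refine orthonormal_iff_ite.2 fun γ γ' => ?_
    have hinner : inner ℂ (v γ) (v γ') = ((J γ.1 ⟨0, γ.2⟩)ᴴ * J γ'.1 ⟨0, γ'.2⟩) 0 0 := by
      rw [EuclideanSpace.inner_eq_star_dotProduct, dotProduct_comm]
      rfl
    rw [hinner]
    obtain rfl | hne := eq_or_ne γ γ'
    · rw [(hJ γ.1).ortho, if_pos rfl, if_pos rfl, Matrix.one_apply_eq]
    · rw [conjTranspose_mul_eq_zero_of_ne h (Subtype.coe_ne_coe.2 hne) ((hJ _).mem _)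
        ((hJ _).mem _), Matrix.zero_apply, if_neg hne]
  have := hv.linearIndependent.finite
  exact Set.toFinite _

namespace CGTransform

/-- The Clebsch-Gordan transform assembled from orthonormal bases of intertwiners. -/
def ofFamily (h : IsSmooth (tensor R S)) (hJ : ∀ γ, IsOrthoBasis b (tensor R S) γ (J γ)) :
    CGTransform b R S where
  support := (finite_labels h).toFinset
  mem_support _ := Set.Finite.mem_toFinset _
  mat := familyMat _ J
  mul_conjTranspose := familyMat_mul_conjTranspose h hJ
  conjTranspose_mul := familyMat_conjTranspose_mul h hJ fun _ hpos =>
    (Set.Finite.mem_toFinset _).2 hpos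
  commutes _ := familyMat_mul_apply h hJ _

theorem embed_ofFamily (h : IsSmooth (tensor R S))
    (hJ : ∀ γ, IsOrthoBasis b (tensor R S) γ (J γ)) (γ : Staircase d)
    (ψ : Fin (mult b R S γ) → ℂ) : (ofFamily h hJ).embed γ ψ = ∑ k, ψ k • J γ k := by
  ext x q
  simp [embed, ofFamily, familyMat, Matrix.sum_apply, mul_comm]

end CGTransform

theorem exists_CGTransform (b : Bases d) (h : IsSmooth (tensor R S)) :
    Nonempty (CGTransform b R S) := by
  obtain ⟨J, hJ⟩ := exists_isOrthoBasis_tensor b h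
  exact ⟨CGTransform.ofFamily h hJ⟩

theorem exists_CGTransform_embed_eq (h : IsSmooth (tensor R S)) {γ : Staircase d}
    {K : Fin (mult b R S γ) → Matrix (m × n) (Fin (dimQ γ)) ℂ}
    (hK : IsOrthoBasis b (tensor R S) γ K) :
    ∃ T : CGTransform b R S, ∀ ψ, T.embed γ ψ = ∑ k, ψ k • K k := by
  obtain ⟨J, hJ⟩ := exists_isOrthoBasis_tensor b h
  have hJK (γ') : IsOrthoBasis b (tensor R S) γ' (Function.update J γ K γ') := by
    obtain rfl | hne := eq_or_ne γ' γ
    · rwa [Function.update_self]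
    · rw [Function.update_of_ne hne]
      exact hJ γ'
  exact ⟨CGTransform.ofFamily h hJK, fun ψ => by
    rw [CGTransform.embed_ofFamily, Function.update_self]⟩

end CGTransform

/-! ### From `SU(d)` to `U(d)` -/

section Center

variable {d : ℕ} {m n : Type} [Fintype m] [DecidableEq m] [Fintype n] [DecidableEq n]
  {R : MatRep d m} {S : MatRep d n}

theorem exists_center_mul_incl (g : U d) :
    ∃ (u : U d) (s : SU d) (z : ℂ), (u : Matrix (Fin d) (Fin d) ℂ) = z • 1 ∧
      g = u * SU.incl s := by
  have hdet : ‖(g : Matrix (Fin d) (Fin d) ℂ).det‖ = 1 :=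
    CStarRing.norm_of_mem_unitary (Matrix.det_of_mem_unitary g.2)
  obtain ⟨z, hz1, hz⟩ : ∃ z : ℂ, ‖z‖ = 1 ∧ z ^ d = (g : Matrix (Fin d) (Fin d) ℂ).det := by
    obtain rfl | hd := Nat.eq_zero_or_pos d
    · exact ⟨1, norm_one, by simp⟩
    · obtain ⟨z, hz⟩ := IsAlgClosed.exists_pow_nat_eq (g : Matrix (Fin d) (Fin d) ℂ).det hd
      rw [← hz, norm_pow] at hdet
      exact ⟨z, (pow_eq_one_iff_of_nonneg (norm_nonneg z) hd.ne').1 hdet, hz⟩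
  have hzs : z * star z = 1 := by
    rw [Complex.star_def, Complex.mul_conj, Complex.normSq_eq_norm_sq, hz1, one_pow,
      Complex.ofReal_one]
  let u : U d := ⟨z • 1, by
    rw [Matrix.mem_unitaryGroup_iff, star_smul, star_one, smul_mul_smul_comm, hzs, one_smul,
      one_mul]⟩
  let s : SU d := ⟨star z • (g : Matrix (Fin d) (Fin d) ℂ),
    Matrix.mem_specialUnitaryGroup_iff.2 ⟨by
      rw [Matrix.mem_unitaryGroup_iff, star_smul, star_star, smul_mul_smul_comm, mul_comm, hzs,
        one_smul, Matrix.mem_unitaryGroup_iff.1 g.2], by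
      rw [Matrix.det_smul, Fintype.card_fin, ← hz, ← mul_pow, mul_comm, hzs, one_pow]⟩⟩
  refine ⟨u, s, z, rfl, Subtype.ext ?_⟩
  change (g : Matrix (Fin d) (Fin d) ℂ) = (z • 1) * (star z • (g : Matrix (Fin d) (Fin d) ℂ))
  rw [smul_mul_smul_comm, hzs, one_smul, one_mul]

/-- The scalar matrices of `U d`, which together with `SU d` generate it, act by scalars. -/
def HasScalarCenter (R : MatRep d m) : Prop :=
  ∀ (g : U d) (z : ℂ), (g : Matrix (Fin d) (Fin d) ℂ) = z • 1 → ∃ c : ℂ, R g = c • 1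

theorem hasScalarCenter_tensorMat (γ : Staircase d) : HasScalarCenter (tensorMat γ) := by
  refine fun g z hg => ⟨(g : Matrix (Fin d) (Fin d) ℂ).det ^ γ.last * z ^ Fintype.card (Box γ), ?_⟩
  ext f f'
  change (g : Matrix (Fin d) (Fin d) ℂ).det ^ γ.last *
    ∏ x, (g : Matrix (Fin d) (Fin d) ℂ) (f x) (f' x) = _
  rw [Matrix.smul_apply, Matrix.one_apply, smul_eq_mul]
  obtain rfl | hne := eq_or_ne f f'
  · simp [hg]
  · obtain ⟨x, hx⟩ := Function.ne_iff.1 hne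
    rw [Finset.prod_eq_zero (Finset.mem_univ x) (by simp [hg, hx]), if_neg hne, mul_zero, mul_zero]

theorem hasScalarCenter_rep {b : Bases d} {γ : Staircase d} : HasScalarCenter (rep b γ) := by
  intro g z hg
  obtain ⟨c, hc⟩ := hasScalarCenter_tensorMat γ g z hg
  refine ⟨c, ?_⟩
  calc rep b γ g = (basisMat b γ)ᴴ * (basisMat b γ * rep b γ g) := by
        rw [← Matrix.mul_assoc, conjTranspose_basisMat_mul_self, Matrix.one_mul]
    _ = c • 1 := by
        rw [← basisMat_mem_intertwiners g, hc, Matrix.smul_mul, Matrix.one_mul, Matrix.mul_smul,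
          conjTranspose_basisMat_mul_self]

theorem HasScalarCenter.conjRep (h : HasScalarCenter R) : HasScalarCenter (conjRep R) := by
  intro g z hg
  obtain ⟨c, hc⟩ := h g z hg
  refine ⟨star c, ?_⟩
  change (R g).map star = _
  ext i j
  by_cases hij : i = j <;> simp [hc, hij]

theorem HasScalarCenter.tensor (h : HasScalarCenter R) (h' : HasScalarCenter S) :
    HasScalarCenter (tensor R S) := by
  intro g z hg
  obtain ⟨c, hc⟩ := h g z hg
  obtain ⟨c', hc'⟩ := h' g z hg
  refine ⟨c * c', ?_⟩
  change R g ⊗ₖ S g = _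
  rw [hc, hc', Matrix.smul_kronecker, Matrix.kronecker_smul, Matrix.one_kronecker_one, smul_smul]

/-- A nonzero `U(d)`-intertwiner forces the centre to act on `R` and on `S` by the same scalars. -/
theorem mem_intertwiners_of_SU (hR : HasScalarCenter R) (hS : HasScalarCenter S)
    {N : Matrix n m ℂ} (hN : N ∈ intertwiners R S) (hN0 : N ≠ 0) {M : Matrix n m ℂ}
    (hM : ∀ s : SU d, S (SU.incl s) * M = M * R (SU.incl s)) : M ∈ intertwiners R S := by
  intro g
  obtain ⟨u, s, z, hu, rfl⟩ := exists_center_mul_incl g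
  obtain ⟨c, hc⟩ := hR u z hu
  obtain ⟨c', hc'⟩ := hS u z hu
  have hcN := hN u
  rw [hc, hc', Matrix.smul_mul, Matrix.one_mul, Matrix.mul_smul, Matrix.mul_one] at hcN
  obtain rfl : c' = c := smul_left_injective ℂ hN0 hcN
  simp only [map_mul, hc, hc', Matrix.smul_mul, Matrix.one_mul, Matrix.mul_smul, hM]

theorem mem_intertwiners_self_of_SU (hR : HasScalarCenter R) {M : Matrix m m ℂ}
    (hM : ∀ s : SU d, R (SU.incl s) * M = M * R (SU.incl s)) : M ∈ intertwiners R R := by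
  obtain rfl | hM0 := eq_or_ne M 0
  · exact zero_mem _
  · refine mem_intertwiners_of_SU hR hR one_mem_intertwiners (fun hone => hM0 ?_) hM
    rw [← Matrix.one_mul M, hone, Matrix.zero_mul]

end Center

/-! ### The intertwiners carried by a Clebsch-Gordan transform -/

namespace CGTransform

variable {d : ℕ} {b : Bases d} {m n : Type} [Fintype m] [DecidableEq m] [Fintype n] [DecidableEq n]
  {R : MatRep d m} {S : MatRep d n} (T : CGTransform b R S)

/-- The embeddings `ι^{γ,e_k}` along the standard basis of the multiplicity space. -/
def family (γ : Staircase d) (k : Fin (mult b R S γ)) : Matrix (m × n) (Fin (dimQ γ)) ℂ :=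
  Matrix.of fun x q => T.matᴴ x ⟨⟨γ, (T.mem_support γ).2 k.pos⟩, (q, k)⟩

theorem familyMat_family : familyMat T.support T.family = T.mat := by
  ext p x
  exact star_star _

theorem embed_eq_sum (γ : Staircase d) (ψ : Fin (mult b R S γ) → ℂ) :
    T.embed γ ψ = ∑ k, ψ k • T.family γ k := by
  ext x q
  simp [embed, family, Matrix.sum_apply, mul_comm]

theorem family_ortho (γ : Staircase d) (k l : Fin (mult b R S γ)) :
    (T.family γ k)ᴴ * T.family γ l = if k = l then 1 else 0 := by
  ext q q'
  let γ' : T.support := ⟨γ, (T.mem_support γ).2 k.pos⟩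
  have hentry := familyMat_mul_conjTranspose_apply (J := T.family) γ' γ' q q' k l
  rw [T.familyMat_family, T.mul_conjTranspose] at hentry
  rw [← hentry]
  by_cases hkl : k = l <;> simp [hkl, Matrix.one_apply]

theorem family_mem (hRS : IsSmooth (tensor R S)) (hc : HasScalarCenter (tensor R S))
    (γ : Staircase d) (k : Fin (mult b R S γ)) :
    T.family γ k ∈ intertwiners (rep b γ) (tensor R S) := by
  have : Nontrivial (intertwiners (rep b γ) (tensor R S)) := Module.nontrivial_of_finrank_pos k.pos
  obtain ⟨N, hN0⟩ := exists_ne (0 : intertwiners (rep b γ) (tensor R S))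
  have hadj : (T.family γ k)ᴴ ∈ intertwiners (tensor R S) (rep b γ) := by
    refine mem_intertwiners_of_SU hc hasScalarCenter_rep
      (conjTranspose_mem_intertwiners isSmooth_rep hRS N.2) ?_ fun s => ?_
    · rw [Ne, Matrix.conjTranspose_eq_zero]
      exact fun hN => hN0 (Subtype.ext hN)
    · ext q x
      rw [← blockDiagonal'_mul_familyMat (J := T.family) (fun γ => rep b γ.1 (SU.incl s))
        ⟨γ, (T.mem_support γ).2 k.pos⟩, T.familyMat_family, ← T.commutes, ← T.familyMat_family]
      rfl
  rw [← Matrix.conjTranspose_conjTranspose (T.family γ k)]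
  exact conjTranspose_mem_intertwiners hRS isSmooth_rep hadj

end CGTransform

/-! ### Extreme points of the normalized families of positive matrices -/

section RankOne

variable {n : Type*} [Fintype n]

theorem star_dotProduct_self_eq_one_iff (ψ : n → ℂ) :
    star ψ ⬝ᵥ ψ = 1 ↔ ∑ k, ‖ψ k‖ ^ 2 = 1 := by
  have hsum : star ψ ⬝ᵥ ψ = ((∑ k, ‖ψ k‖ ^ 2 : ℝ) : ℂ) := by
    simp only [dotProduct, Pi.star_apply, Complex.star_def, Complex.conj_mul', Complex.ofReal_sum,
      Complex.ofReal_pow]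
  rw [hsum]
  norm_cast

theorem trace_vecMulVec_star_self (ψ : n → ℂ) :
    (Matrix.vecMulVec ψ (star ψ)).trace = star ψ ⬝ᵥ ψ := by
  rw [Matrix.trace_vecMulVec, dotProduct_comm]

theorem exists_eq_sum_smul_vecMulVec_star {A : Matrix n n ℂ}
    (hA : A.PosSemidef) :
    ∃ (e : n → ℝ) (u : n → n → ℂ), (∀ k, 0 ≤ e k) ∧ (∀ k, star (u k) ⬝ᵥ u k = 1) ∧
      A = ∑ k, e k • Matrix.vecMulVec (u k) (star (u k)) := by
  classical
  set V : Matrix n n ℂ := (hA.isHermitian.eigenvectorUnitary : Matrix n n ℂ) with hV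
  have hVV : Vᴴ * V = 1 := Matrix.mem_unitaryGroup_iff'.1 hA.isHermitian.eigenvectorUnitary.2
  refine ⟨hA.isHermitian.eigenvalues, Vᵀ, hA.eigenvalues_nonneg, fun k => ?_, ?_⟩
  · have hkk := congrFun₂ hVV k k
    rwa [Matrix.mul_apply, Matrix.one_apply_eq] at hkk
  · have hspec := hA.isHermitian.spectral_theorem
    rw [Unitary.conjStarAlgAut_apply, ← hV] at hspec
    conv_lhs => rw [hspec]
    ext i j
    rw [Matrix.mul_apply, Matrix.sum_apply]
    refine Finset.sum_congr rfl fun k _ => ?_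
    simp only [Matrix.mul_diagonal, Matrix.smul_apply, Matrix.vecMulVec_apply, Function.comp_apply,
      Pi.star_apply, Matrix.transpose_apply, Complex.real_smul, Complex.coe_algebraMap,
      Matrix.star_apply]
    ring

theorem mulVec_eq_zero_of_add_mulVec_eq_zero {y z : Matrix n n ℂ} (hy : y.PosSemidef)
    (hz : z.PosSemidef) {φ : n → ℂ} (h : (y + z) *ᵥ φ = 0) : y *ᵥ φ = 0 := by
  rw [← hy.dotProduct_mulVec_zero_iff]
  have hadd : star φ ⬝ᵥ y *ᵥ φ + star φ ⬝ᵥ z *ᵥ φ = 0 := by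
    rw [← dotProduct_add, ← Matrix.add_mulVec, h, dotProduct_zero]
  exact ((add_eq_zero_iff_of_nonneg (hy.dotProduct_mulVec_nonneg φ)
    (hz.dotProduct_mulVec_nonneg φ)).1 hadd).1

theorem exists_eq_smul_vecMulVec_star {y : Matrix n n ℂ} (hy : y.IsHermitian)
    {ψ : n → ℂ} (hψ : star ψ ⬝ᵥ ψ = 1) (h : ∀ φ, star ψ ⬝ᵥ φ = 0 → y *ᵥ φ = 0) :
    ∃ t : ℂ, y = t • Matrix.vecMulVec ψ (star ψ) := by
  classical
  have hrange : y = Matrix.vecMulVec (y *ᵥ ψ) (star ψ) := by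
    refine Matrix.toLin'.injective (LinearMap.ext fun φ => ?_)
    have hφ := h (φ - (star ψ ⬝ᵥ φ) • ψ) (by
      rw [dotProduct_sub, dotProduct_smul, hψ, smul_eq_mul, mul_one, sub_self])
    rw [Matrix.mulVec_sub, Matrix.mulVec_smul, sub_eq_zero] at hφ
    rw [Matrix.toLin'_apply, Matrix.toLin'_apply, hφ, Matrix.vecMulVec_mulVec, op_smul_eq_smul]
  have hherm : y = Matrix.vecMulVec ψ (star (y *ᵥ ψ)) := by
    conv_lhs => rw [← hy.eq, hrange, Matrix.conjTranspose_vecMulVec, star_star]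
  have hψy : y *ᵥ ψ = (star (y *ᵥ ψ) ⬝ᵥ ψ) • ψ := by
    conv_lhs => rw [hherm, Matrix.vecMulVec_mulVec, op_smul_eq_smul]
  exact ⟨star (y *ᵥ ψ) ⬝ᵥ ψ, by rw [← Matrix.smul_vecMulVec, ← hψy, ← hrange]⟩

end RankOne

section NormalizedFamilies

variable {ι : Type*} [Fintype ι] {n : ι → Type*} [∀ i, Fintype (n i)]

/-- The families of positive semidefinite matrices whose traces, weighted by `w`, sum to `1`: the
convex set of Choi matrices of equivariant channels, once it is cut into blocks. -/
def normalizedFamilies (n : ι → Type*) [∀ i, Fintype (n i)] (w : ι → ℝ) :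
    Set (∀ i, Matrix (n i) (n i) ℂ) :=
  {P | (∀ i, (P i).PosSemidef) ∧ ∑ i, w i • (P i).trace = 1}

variable {w : ι → ℝ}

theorem convex_normalizedFamilies : Convex ℝ (normalizedFamilies n w) := by
  intro P hP Q hQ a b ha hb hab
  refine ⟨fun i => ((hP.1 i).smul ha).add ((hQ.1 i).smul hb), ?_⟩
  calc ∑ i, w i • ((a • P + b • Q) i).trace
      = a • ∑ i, w i • (P i).trace + b • ∑ i, w i • (Q i).trace := by
        simp only [Pi.add_apply, Pi.smul_apply, Matrix.trace_add, Matrix.trace_smul, smul_add,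
          Finset.sum_add_distrib, Finset.smul_sum, smul_comm (w _)]
    _ = 1 := by rw [hP.2, hQ.2, ← add_smul, hab, one_smul]

variable [DecidableEq ι]

/-- The normalized family concentrated at the index `i`, where it is a multiple of `|ψ⟩⟨ψ|`. -/
def rankOneFamily (w : ι → ℝ) (i : ι) (ψ : n i → ℂ) : ∀ i, Matrix (n i) (n i) ℂ :=
  Pi.single i ((w i)⁻¹ • Matrix.vecMulVec ψ (star ψ))

theorem rankOneFamily_mem (hw : ∀ i, 0 < w i) (i : ι) {ψ : n i → ℂ} (hψ : star ψ ⬝ᵥ ψ = 1) :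
    rankOneFamily w i ψ ∈ normalizedFamilies n w := by
  constructor
  · intro j
    obtain rfl | hj := eq_or_ne j i
    · rw [rankOneFamily, Pi.single_eq_same]
      exact (Matrix.posSemidef_vecMulVec_self_star ψ).smul (inv_nonneg.2 (hw j).le)
    · rw [rankOneFamily, Pi.single_eq_of_ne hj]
      exact Matrix.PosSemidef.zero
  · rw [Finset.sum_eq_single i (fun j _ hj => by
      rw [rankOneFamily, Pi.single_eq_of_ne hj, Matrix.trace_zero, smul_zero]) (by simp)]
    rw [rankOneFamily, Pi.single_eq_same, Matrix.trace_smul, trace_vecMulVec_star_self, hψ,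
      smul_inv_smul₀ (hw i).ne']

theorem sum_smul_rankOneFamily (hw : ∀ i, w i ≠ 0) (e : ∀ i, n i → ℝ)
    (u : ∀ i, n i → n i → ℂ) :
    ∑ x : Σ i, n i, (w x.1 * e x.1 x.2) • rankOneFamily w x.1 (u x.1 x.2) =
      fun i => ∑ k, e i k • Matrix.vecMulVec (u i k) (star (u i k)) := by
  funext j
  rw [Fintype.sum_sigma, Finset.sum_apply, Finset.sum_eq_single j]
  · rw [Finset.sum_apply]
    refine Finset.sum_congr rfl fun k _ => ?_
    rw [Pi.smul_apply, rankOneFamily, Pi.single_eq_same, smul_smul, mul_right_comm,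
      mul_inv_cancel₀ (hw j), one_mul]
  · intro i _ hij
    rw [Finset.sum_apply]
    refine Finset.sum_eq_zero fun k _ => ?_
    rw [Pi.smul_apply, rankOneFamily, Pi.single_eq_of_ne hij.symm, smul_zero]
  · simp

theorem normalizedFamilies_eq_convexHull (hw : ∀ i, 0 < w i) :
    normalizedFamilies n w =
      convexHull ℝ {Q | ∃ (i : ι) (ψ : n i → ℂ), star ψ ⬝ᵥ ψ = 1 ∧ Q = rankOneFamily w i ψ} := by
  refine Set.Subset.antisymm (fun P hP => ?_) (convexHull_min ?_ convex_normalizedFamilies)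
  · choose e u he hu hdec using fun i => exists_eq_sum_smul_vecMulVec_star (hP.1 i)
    have hsum : P = ∑ x : Σ i, n i, (w x.1 * e x.1 x.2) • rankOneFamily w x.1 (u x.1 x.2) := by
      rw [sum_smul_rankOneFamily fun i => (hw i).ne']
      exact funext hdec
    have htrace : ∀ i, (P i).trace = ((∑ k, e i k : ℝ) : ℂ) := by
      intro i
      simp only [hdec i, Matrix.trace_sum, Matrix.trace_smul, trace_vecMulVec_star_self, hu,
        Complex.real_smul, mul_one, Complex.ofReal_sum]
    have hone : ∑ x : Σ i, n i, w x.1 * e x.1 x.2 = 1 := by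
      have h := hP.2
      simp only [htrace, Complex.real_smul] at h
      simp only [Fintype.sum_sigma, ← Finset.mul_sum]
      exact_mod_cast h
    rw [hsum]
    exact (convex_convexHull ℝ _).sum_mem (fun x _ => mul_nonneg (hw _).le (he _ _)) hone
      fun x _ => subset_convexHull ℝ _ ⟨x.1, u x.1 x.2, hu _ _, rfl⟩
  · rintro _ ⟨i, ψ, hψ, rfl⟩
    exact rankOneFamily_mem hw i hψ

theorem eq_rankOneFamily_of_mulVec_eq_zero (hw : ∀ i, w i ≠ 0) {i : ι}
    {ψ : n i → ℂ} (hψ : star ψ ⬝ᵥ ψ = 1) {P : ∀ i, Matrix (n i) (n i) ℂ}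
    (hP : P ∈ normalizedFamilies n w)
    (hker : ∀ j φ, rankOneFamily w i ψ j *ᵥ φ = 0 → P j *ᵥ φ = 0) :
    P = rankOneFamily w i ψ := by
  classical
  have hoff : ∀ j, j ≠ i → P j = 0 := by
    intro j hj
    refine Matrix.toLin'.injective (LinearMap.ext fun φ => ?_)
    rw [Matrix.toLin'_apply, map_zero, LinearMap.zero_apply]
    exact hker j φ (by rw [rankOneFamily, Pi.single_eq_of_ne hj, Matrix.zero_mulVec])
  obtain ⟨t, ht⟩ := exists_eq_smul_vecMulVec_star (hP.1 i).isHermitian hψ fun φ hφ => hker i φ (by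
    rw [rankOneFamily, Pi.single_eq_same, Matrix.smul_mulVec, Matrix.vecMulVec_mulVec, hφ,
      MulOpposite.op_zero, zero_smul, smul_zero])
  have hwt : w i • t = 1 := by
    rw [← hP.2, Finset.sum_eq_single i (fun j _ hj => by
      rw [hoff j hj, Matrix.trace_zero, smul_zero]) (by simp), ht, Matrix.trace_smul,
      trace_vecMulVec_star_self, hψ, smul_eq_mul, mul_one]
  funext j
  obtain rfl | hj := eq_or_ne j i
  · rw [rankOneFamily, Pi.single_eq_same, eq_inv_smul_iff₀ (hw j), ht, ← smul_assoc, hwt, one_smul]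
  · rw [hoff j hj, rankOneFamily, Pi.single_eq_of_ne hj]

theorem rankOneFamily_mem_extremePoints (hw : ∀ i, 0 < w i) (i : ι)
    {ψ : n i → ℂ} (hψ : star ψ ⬝ᵥ ψ = 1) :
    rankOneFamily w i ψ ∈ Set.extremePoints ℝ (normalizedFamilies n w) := by
  refine ⟨rankOneFamily_mem hw i hψ, ?_⟩
  rintro y hy z hz ⟨a, b, ha, hb, -, hab⟩
  refine eq_rankOneFamily_of_mulVec_eq_zero (fun i => (hw i).ne') hψ hy fun j φ hφ => ?_
  have hsmul : (a • y j) *ᵥ φ = 0 := by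
    refine mulVec_eq_zero_of_add_mulVec_eq_zero ((hy.1 j).smul ha.le) ((hz.1 j).smul hb.le) ?_
    rw [← hφ, ← hab, Pi.add_apply, Pi.smul_apply, Pi.smul_apply]
  rw [Matrix.smul_mulVec] at hsmul
  exact (smul_eq_zero.1 hsmul).resolve_left ha.ne'

theorem extremePoints_normalizedFamilies (hw : ∀ i, 0 < w i) :
    Set.extremePoints ℝ (normalizedFamilies n w) =
      {Q | ∃ (i : ι) (ψ : n i → ℂ), star ψ ⬝ᵥ ψ = 1 ∧ Q = rankOneFamily w i ψ} := by
  refine Set.Subset.antisymm ?_ ?_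
  · rw [normalizedFamilies_eq_convexHull hw]
    exact extremePoints_convexHull_subset
  · rintro _ ⟨i, ψ, hψ, rfl⟩
    exact rankOneFamily_mem_extremePoints hw i hψ

end NormalizedFamilies

theorem extremePoints_image_of_injective {𝕜 E F : Type*} [Ring 𝕜] [PartialOrder 𝕜]
    [IsOrderedRing 𝕜] [AddCommGroup E] [Module 𝕜 E] [AddCommGroup F] [Module 𝕜 F] (f : E →ₗ[𝕜] F)
    (hf : Function.Injective f) (s : Set E) :
    Set.extremePoints 𝕜 (f '' s) = f '' Set.extremePoints 𝕜 s := by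
  have hseg : ∀ x y z, f x ∈ openSegment 𝕜 (f y) (f z) ↔ x ∈ openSegment 𝕜 y z := by
    intro x y z
    rw [← LinearMap.coe_toAffineMap, ← image_openSegment, LinearMap.coe_toAffineMap,
      hf.mem_set_image]
  refine Set.Subset.antisymm ?_ ?_
  · rintro _ ⟨⟨x, hx, rfl⟩, hext⟩
    exact ⟨x, ⟨hx, fun y hy z hz hyz =>
      hf (hext ⟨y, hy, rfl⟩ ⟨z, hz, rfl⟩ ((hseg x y z).2 hyz))⟩, rfl⟩
  · rintro _ ⟨x, ⟨hx, hext⟩, rfl⟩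
    refine ⟨⟨x, hx, rfl⟩, ?_⟩
    rintro _ ⟨y, hy, rfl⟩ _ ⟨z, hz, rfl⟩ hyz
    rw [hext hy hz ((hseg x y z).1 hyz)]

/-! ### Partial traces and Choi matrices -/

section PartialTrace

variable {m n : Type} [Fintype m] [Fintype n]

theorem one_kronecker_mul_apply [DecidableEq m] {l : Type*} (s : Matrix n n ℂ)
    (X : Matrix (m × n) l ℂ) (i : m) (a : n) (q : l) :
    (((1 : Matrix m m ℂ) ⊗ₖ s) * X) (i, a) q = ∑ b, s a b * X (i, b) q := by
  simp only [Matrix.mul_apply, Fintype.sum_prod_type, Matrix.kroneckerMap_apply, Matrix.one_apply,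
    ite_mul, one_mul, zero_mul]
  rw [Finset.sum_comm]
  simp

theorem mul_one_kronecker_apply [DecidableEq m] {l : Type*} (s : Matrix n n ℂ)
    (X : Matrix l (m × n) ℂ) (p : l) (i : m) (a : n) :
    (X * ((1 : Matrix m m ℂ) ⊗ₖ s)) p (i, a) = ∑ b, X p (i, b) * s b a := by
  simp only [Matrix.mul_apply, Fintype.sum_prod_type, Matrix.kroneckerMap_apply, Matrix.one_apply,
    ite_mul, one_mul, zero_mul, mul_ite, mul_zero]
  rw [Finset.sum_comm]
  simp

theorem kronecker_one_mul_apply [DecidableEq n] {l : Type*} (r : Matrix m m ℂ)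
    (X : Matrix (m × n) l ℂ) (i : m) (a : n) (q : l) :
    ((r ⊗ₖ (1 : Matrix n n ℂ)) * X) (i, a) q = ∑ j, r i j * X (j, a) q := by
  simp [Matrix.mul_apply, Fintype.sum_prod_type, Matrix.one_apply]

theorem mul_kronecker_one_apply [DecidableEq n] {l : Type*} (r : Matrix m m ℂ)
    (X : Matrix l (m × n) ℂ) (p : l) (i : m) (a : n) :
    (X * (r ⊗ₖ (1 : Matrix n n ℂ))) p (i, a) = ∑ j, X p (j, a) * r j i := by
  simp [Matrix.mul_apply, Fintype.sum_prod_type, Matrix.one_apply]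

variable (r : Matrix m m ℂ) (s : Matrix n n ℂ) (X : Matrix (m × n) (m × n) ℂ)

theorem traceFst_one_kronecker_mul [DecidableEq m] :
    traceFst (((1 : Matrix m m ℂ) ⊗ₖ s) * X) = s * traceFst X := by
  ext a a'
  rw [Matrix.mul_apply]
  simp only [traceFst, Matrix.of_apply, one_kronecker_mul_apply, Finset.mul_sum]
  exact Finset.sum_comm

theorem traceFst_mul_one_kronecker [DecidableEq m] :
    traceFst (X * ((1 : Matrix m m ℂ) ⊗ₖ s)) = traceFst X * s := by
  ext a a'
  rw [Matrix.mul_apply]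
  simp only [traceFst, Matrix.of_apply, mul_one_kronecker_apply, Finset.sum_mul]
  exact Finset.sum_comm

theorem traceFst_kronecker_one_mul_comm [DecidableEq n] :
    traceFst ((r ⊗ₖ (1 : Matrix n n ℂ)) * X) = traceFst (X * (r ⊗ₖ (1 : Matrix n n ℂ))) := by
  ext a a'
  simp only [traceFst, Matrix.of_apply, kronecker_one_mul_apply, mul_kronecker_one_apply,
    mul_comm (r _ _)]
  exact Finset.sum_comm

theorem traceSnd_kronecker_one_mul [DecidableEq n] :
    traceSnd ((r ⊗ₖ (1 : Matrix n n ℂ)) * X) = r * traceSnd X := by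
  ext i i'
  rw [Matrix.mul_apply]
  simp only [traceSnd, Matrix.of_apply, kronecker_one_mul_apply, Finset.mul_sum]
  exact Finset.sum_comm

theorem traceSnd_mul_kronecker_one [DecidableEq n] :
    traceSnd (X * (r ⊗ₖ (1 : Matrix n n ℂ))) = traceSnd X * r := by
  ext i i'
  rw [Matrix.mul_apply]
  simp only [traceSnd, Matrix.of_apply, mul_kronecker_one_apply, Finset.sum_mul]
  exact Finset.sum_comm

theorem traceSnd_one_kronecker_mul_comm [DecidableEq m] :
    traceSnd (((1 : Matrix m m ℂ) ⊗ₖ s) * X) = traceSnd (X * ((1 : Matrix m m ℂ) ⊗ₖ s)) := by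
  ext i i'
  simp only [traceSnd, Matrix.of_apply, one_kronecker_mul_apply, mul_one_kronecker_apply,
    mul_comm (s _ _)]
  exact Finset.sum_comm

theorem trace_traceSnd : (traceSnd X).trace = X.trace := by
  simp [traceSnd, Matrix.trace, Fintype.sum_prod_type]

end PartialTrace

section Choi

variable {m n : Type} [Fintype m]

theorem choi_apply [DecidableEq m] (Φ : Matrix m m ℂ →ₗ[ℂ] Matrix n n ℂ) (i j : m) (a a' : n) :
    choi Φ (i, a) (j, a') = Φ (Matrix.single i j 1) a a' := by
  simp [choi, Matrix.sum_apply, Matrix.single_apply, ite_and]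

theorem ofChoi_apply (C : Matrix (m × n) (m × n) ℂ) (A : Matrix m m ℂ) (a a' : n) :
    ofChoi C A a a' = ∑ i, ∑ j, A i j * C (i, a) (j, a') := rfl

theorem posSemidef_choi [DecidableEq m] {Φ : Matrix m m ℂ →ₗ[ℂ] Matrix n n ℂ} (h : IsCP Φ) :
    (choi Φ).PosSemidef := by
  let e := Fintype.equivFin m
  -- the unnormalized maximally entangled vector `∑ i, |i⟩ ⊗ |i⟩`
  let ω : Fin (Fintype.card m) × m → ℂ := fun p => if p.1 = e p.2 then 1 else 0
  have hω := (h _ _ (Matrix.posSemidef_vecMulVec_self_star ω)).submatrix (Prod.map e (id : n → n))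
  convert hω using 1
  ext ⟨p, a⟩ ⟨q, a'⟩
  have hsingle : Matrix.single p q (1 : ℂ) =
      Matrix.of fun i j => Matrix.vecMulVec ω (star ω) (e p, i) (e q, j) := by
    ext i j
    by_cases hp : p = i <;> by_cases hq : q = j <;>
      simp [ω, hp, hq, Matrix.vecMulVec_apply]
  rw [choi_apply, hsingle]
  rfl

theorem isCP_ofChoi [Finite n] {C : Matrix (m × n) (m × n) ℂ} (hC : C.PosSemidef) :
    IsCP (ofChoi C) := by
  classical
  cases nonempty_fintype n
  intro k X hX
  let f (x : (Fin k × n) × m) : (Fin k × m) × (m × n) := ((x.1.1, x.2), (x.2, x.1.2))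
  let V : Matrix ((Fin k × n) × m) (Fin k × n) ℂ := (1 : Matrix _ _ ℂ).submatrix Prod.fst id
  suffices hV : Matrix.of (fun p q : Fin k × n =>
      ofChoi C (Matrix.of fun i j => X (p.1, i) (q.1, j)) p.2 q.2) =
      Vᴴ * (X ⊗ₖ C).submatrix f f * V by
    rw [hV]
    exact ((hX.kronecker hC).submatrix f).conjTranspose_mul_mul_same V
  ext p q
  rw [Matrix.of_apply, ofChoi_apply, Finset.sum_comm]
  simp [V, f, Matrix.mul_apply, Fintype.sum_prod_type, Matrix.one_apply]

/-- The Choi correspondence between bipartite matrices and linear maps, as a linear equivalence. -/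
def ofChoiEquiv [DecidableEq m] [Fintype n] [DecidableEq n] :
    Matrix (m × n) (m × n) ℂ ≃ₗ[ℂ] (Matrix m m ℂ →ₗ[ℂ] Matrix n n ℂ) where
  toFun := ofChoi
  map_add' C C' := by
    refine LinearMap.ext fun A => Matrix.ext fun a a' => ?_
    simp only [ofChoi_apply, LinearMap.add_apply, Matrix.add_apply, mul_add,
      Finset.sum_add_distrib]
  map_smul' c C := by
    refine LinearMap.ext fun A => Matrix.ext fun a a' => ?_
    simp only [ofChoi_apply, LinearMap.smul_apply, Matrix.smul_apply, RingHom.id_apply,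
      smul_eq_mul, Finset.mul_sum, mul_left_comm]
  invFun := choi
  left_inv := choi_ofChoi
  right_inv := ofChoi_choi

theorem ofChoiEquiv_apply [DecidableEq m] [Fintype n] [DecidableEq n]
    (C : Matrix (m × n) (m × n) ℂ) : ofChoiEquiv C = ofChoi C := rfl

variable [Fintype n]

theorem trace_ofChoi (C : Matrix (m × n) (m × n) ℂ) (A : Matrix m m ℂ) :
    (ofChoi C A).trace = (A * (traceSnd C)ᵀ).trace := by
  simp only [Matrix.trace, Matrix.diag_apply, ofChoi_apply, traceSnd, Matrix.mul_apply,
    Matrix.transpose_apply, Matrix.of_apply, Finset.mul_sum]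
  rw [Finset.sum_comm]
  exact Finset.sum_congr rfl fun i _ => Finset.sum_comm

theorem trace_ofChoi_eq_iff [DecidableEq m] (C : Matrix (m × n) (m × n) ℂ) :
    (∀ A, (ofChoi C A).trace = A.trace) ↔ traceSnd C = 1 := by
  simp only [trace_ofChoi]
  rw [← Matrix.transpose_eq_one]
  refine ⟨fun h => ?_, fun h A => by rw [h, Matrix.mul_one]⟩
  refine Matrix.ext_iff_trace_mul_left.2 fun A => ?_
  rw [h, Matrix.mul_one]

theorem ofChoi_eq_traceFst [DecidableEq n] (C : Matrix (m × n) (m × n) ℂ) (A : Matrix m m ℂ) :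
    ofChoi C A = traceFst (C * (Aᵀ ⊗ₖ (1 : Matrix n n ℂ))) := by
  ext a a'
  simp only [ofChoi_apply, traceFst, Matrix.of_apply, mul_kronecker_one_apply,
    Matrix.transpose_apply, mul_comm (A _ _)]

theorem ofChoi_conj (C : Matrix (m × n) (m × n) ℂ) (r A : Matrix m m ℂ) (s : Matrix n n ℂ) :
    ofChoi (((r.map star) ⊗ₖ s) * C * ((r.map star) ⊗ₖ s)ᴴ) A =
      s * ofChoi C (rᴴ * A * r) * sᴴ := by
  classical
  have hK : (r.map star) ⊗ₖ s = (1 ⊗ₖ s) * ((r.map star) ⊗ₖ 1) := by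
    rw [← Matrix.mul_kronecker_mul, Matrix.one_mul, Matrix.mul_one]
  have hrA : ((r.map star) ⊗ₖ s)ᴴ * (Aᵀ ⊗ₖ 1) = ((rᵀ * Aᵀ) ⊗ₖ 1) * (1 ⊗ₖ sᴴ) := by
    rw [Matrix.conjTranspose_kronecker, ← Matrix.mul_kronecker_mul, ← Matrix.mul_kronecker_mul,
      Matrix.mul_one, Matrix.mul_one, Matrix.one_mul]
    congr 2
    ext i j
    simp
  have hAr : rᵀ * Aᵀ * r.map star = (rᴴ * A * r)ᵀ := by
    rw [Matrix.transpose_mul, Matrix.transpose_mul, Matrix.mul_assoc]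
    rfl
  rw [ofChoi_eq_traceFst, ofChoi_eq_traceFst]
  calc traceFst ((r.map star) ⊗ₖ s * C * ((r.map star) ⊗ₖ s)ᴴ * Aᵀ ⊗ₖ 1)
      = traceFst (1 ⊗ₖ s * ((r.map star) ⊗ₖ 1 * (C * (rᵀ * Aᵀ) ⊗ₖ 1)) * 1 ⊗ₖ sᴴ) := by
        rw [Matrix.mul_assoc _ _ (Aᵀ ⊗ₖ 1), hrA, hK]
        simp only [Matrix.mul_assoc]
    _ = s * traceFst (C * (rᵀ * Aᵀ) ⊗ₖ 1 * (r.map star) ⊗ₖ 1) * sᴴ := by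
        rw [traceFst_mul_one_kronecker, traceFst_one_kronecker_mul, traceFst_kronecker_one_mul_comm]
    _ = s * traceFst (C * (rᴴ * A * r)ᵀ ⊗ₖ 1) * sᴴ := by
        rw [Matrix.mul_assoc C, ← Matrix.mul_kronecker_mul, hAr, Matrix.one_mul]

variable [DecidableEq m] [DecidableEq n]

theorem map_star_kronecker_mem_unitaryGroup {r : Matrix m m ℂ} {s : Matrix n n ℂ}
    (hr : r ∈ Matrix.unitaryGroup m ℂ) (hs : s ∈ Matrix.unitaryGroup n ℂ) :
    (r.map star) ⊗ₖ s ∈ Matrix.unitaryGroup (m × n) ℂ := by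
  refine Matrix.kronecker_mem_unitary ?_ hs
  have hrr := congrArg Matrix.transpose (Matrix.mem_unitaryGroup_iff'.1 hr)
  rw [Matrix.transpose_mul, Matrix.transpose_one] at hrr
  rw [Matrix.mem_unitaryGroup_iff', ← hrr]
  congr 1
  ext i j
  simp [Matrix.star_apply]

theorem ofChoi_equivariant_iff {r : Matrix m m ℂ} {s : Matrix n n ℂ}
    (hr : r ∈ Matrix.unitaryGroup m ℂ) (hs : s ∈ Matrix.unitaryGroup n ℂ)
    (C : Matrix (m × n) (m × n) ℂ) :
    (∀ A, ofChoi C (r * A * rᴴ) = s * ofChoi C A * sᴴ) ↔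
      ((r.map star) ⊗ₖ s) * C = C * ((r.map star) ⊗ₖ s) := by
  have hr₁ : rᴴ * r = 1 := Matrix.mem_unitaryGroup_iff'.1 hr
  have hr₂ : r * rᴴ = 1 := Matrix.mem_unitaryGroup_iff.1 hr
  have hK := map_star_kronecker_mem_unitaryGroup hr hs
  set K := (r.map star) ⊗ₖ s with hKdef
  calc (∀ A, ofChoi C (r * A * rᴴ) = s * ofChoi C A * sᴴ)
      ↔ ∀ A, ofChoi C A = ofChoi (K * C * Kᴴ) A := by
        simp only [hKdef, ofChoi_conj]
        constructor
        · intro h A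
          rw [← h]
          simp only [← Matrix.mul_assoc, hr₂, Matrix.one_mul]
          rw [Matrix.mul_assoc, hr₂, Matrix.mul_one]
        · intro h A
          rw [h]
          simp only [← Matrix.mul_assoc, hr₁, Matrix.one_mul]
          rw [Matrix.mul_assoc A, hr₁, Matrix.mul_one]
    _ ↔ C = K * C * Kᴴ := by
        rw [← LinearMap.ext_iff, ← ofChoiEquiv_apply, ← ofChoiEquiv_apply,
          ofChoiEquiv.injective.eq_iff]
    _ ↔ K * C = C * K := by
        have hK₁ : Kᴴ * K = 1 := Matrix.mem_unitaryGroup_iff'.1 hK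
        have hK₂ : K * Kᴴ = 1 := Matrix.mem_unitaryGroup_iff.1 hK
        constructor
        · intro h
          conv_rhs => rw [h, Matrix.mul_assoc, hK₁, Matrix.mul_one]
        · intro h
          rw [h, Matrix.mul_assoc, hK₂, Matrix.mul_one]

end Choi

section Intertwiners

variable {d : ℕ} {m n : Type} [Fintype m] [DecidableEq m] [Fintype n] [DecidableEq n]

theorem traceSnd_mem_intertwiners {R : MatRep d m} {S : MatRep d n}
    {C : Matrix (m × n) (m × n) ℂ} (hC : C ∈ intertwiners (tensor R S) (tensor R S)) :
    traceSnd C ∈ intertwiners R R := by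
  intro g
  have hRS : (R g ⊗ₖ S g) * C = C * (R g ⊗ₖ S g) := hC g
  have hleft : R g ⊗ₖ (1 : Matrix n n ℂ) = (1 ⊗ₖ S g⁻¹) * (R g ⊗ₖ S g) := by
    rw [← Matrix.mul_kronecker_mul, Matrix.one_mul, ← map_mul, inv_mul_cancel, map_one]
  have hright : (R g ⊗ₖ S g) * (1 ⊗ₖ S g⁻¹) = R g ⊗ₖ (1 : Matrix n n ℂ) := by
    rw [← Matrix.mul_kronecker_mul, Matrix.mul_one, ← map_mul, mul_inv_cancel, map_one]
  calc R g * traceSnd C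
      = traceSnd (1 ⊗ₖ S g⁻¹ * (C * (R g ⊗ₖ S g))) := by
        rw [← traceSnd_kronecker_one_mul, hleft, Matrix.mul_assoc, hRS]
    _ = traceSnd (C * (R g ⊗ₖ 1)) := by
        rw [traceSnd_one_kronecker_mul_comm, Matrix.mul_assoc, hright]
    _ = traceSnd C * R g := traceSnd_mul_kronecker_one _ _

theorem eq_trace_div_smul_one_of_conjRep {b : Bases d} {γ : Staircase d}
    {M : Matrix (Fin (dimQ γ)) (Fin (dimQ γ)) ℂ}
    (hM : M ∈ intertwiners (conjRep (rep b γ)) (conjRep (rep b γ))) :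
    M = (M.trace / dimQ γ) • 1 := by
  have hconj : M.map star ∈ intertwiners (rep b γ) (rep b γ) := by
    intro g
    ext i j
    simpa [conjRep, Matrix.mul_apply] using congrArg star (congrFun₂ (hM g) i j)
  have htrace : (M.map star).trace = star M.trace := by
    simp [Matrix.trace]
  have hM' := eq_trace_div_smul_one hconj
  rw [htrace] at hM'
  ext i j
  rw [← star_inj, ← Matrix.map_apply (f := star), hM']
  by_cases h : i = j <;> simp [h]

end Intertwiners

/-! ### Operators commuting with a tensor product -/

theorem mul_blockDiagonal'_apply {o l : Type*} [Fintype o] [DecidableEq o] {n : o → Type*}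
    [∀ i, Fintype (n i)] {α : Type*} [NonUnitalNonAssocSemiring α] (A : Matrix l (Σ i, n i) α)
    (M : ∀ i, Matrix (n i) (n i) α) (x : l) (i : o) (p : n i) :
    (A * Matrix.blockDiagonal' M) x ⟨i, p⟩ = ∑ p', A x ⟨i, p'⟩ * M i p' p := by
  rw [Matrix.mul_apply, Fintype.sum_sigma, Finset.sum_eq_single i]
  · simp only [Matrix.blockDiagonal'_apply_eq]
  · intro j _ hne
    exact Finset.sum_eq_zero fun p' _ => by
      rw [Matrix.blockDiagonal'_apply_ne _ _ _ hne, mul_zero]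
  · exact fun hi => absurd (Finset.mem_univ i) hi

namespace CGTransform

variable {d : ℕ} {b : Bases d} {m n : Type} [Fintype m] [DecidableEq m] [Fintype n] [DecidableEq n]
  {R : MatRep d m} {S : MatRep d n} (T : CGTransform b R S)

/-- The families of operators on the multiplicity spaces `ℂ^{c_γ}`. -/
abbrev MultOps : Type :=
  ∀ γ : T.support, Matrix (Fin (mult b R S γ.1)) (Fin (mult b R S γ.1)) ℂ

/-- The operator `⨁_γ 1 ⊗ P_γ` on `⨁_γ Q_γ ⊗ ℂ^{c_γ}`, as a linear function of `P`. -/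
def blocks : T.MultOps →ₗ[ℂ]
    Matrix (Σ γ : T.support, Fin (dimQ γ.1) × Fin (mult b R S γ.1))
      (Σ γ : T.support, Fin (dimQ γ.1) × Fin (mult b R S γ.1)) ℂ where
  toFun P := Matrix.blockDiagonal' fun γ =>
    (1 : Matrix (Fin (dimQ γ.1)) (Fin (dimQ γ.1)) ℂ) ⊗ₖ P γ
  map_add' P P' := by
    simp only [Pi.add_apply, Matrix.kronecker_add]
    exact Matrix.blockDiagonal'_add _ _
  map_smul' c P := by
    simp only [Pi.smul_apply, Matrix.kronecker_smul]
    exact Matrix.blockDiagonal'_smul c _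

theorem blocks_apply (P : T.MultOps) : T.blocks P =
    Matrix.blockDiagonal' fun γ : T.support =>
      (1 : Matrix (Fin (dimQ γ.1)) (Fin (dimQ γ.1)) ℂ) ⊗ₖ P γ := rfl

theorem block_eq_blocks (γ : Staircase d) (hγ : γ ∈ labels b R S) (ψ : Fin (mult b R S γ) → ℂ) :
    T.block γ hγ ψ = T.blocks
      (Pi.single ⟨γ, (T.mem_support γ).2 hγ⟩ (Matrix.vecMulVec ψ (star ψ))) := by
  rw [block, blocks_apply]
  congr 1
  funext γ'
  obtain rfl | hne := eq_or_ne γ' ⟨γ, (T.mem_support γ).2 hγ⟩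
  · rw [Pi.single_eq_same, Pi.single_eq_same]
  · rw [Pi.single_eq_of_ne hne, Pi.single_eq_of_ne hne, Matrix.kronecker_zero]

theorem blocks_submatrix (P : T.MultOps) (γ : T.support) :
    (T.blocks P).submatrix (fun k => ⟨γ, 0, k⟩) (fun k => ⟨γ, 0, k⟩) = P γ := by
  ext k l
  simp [blocks_apply]

theorem blocks_injective : Function.Injective T.blocks := by
  intro P P' h
  funext γ
  rw [← T.blocks_submatrix P γ, h, T.blocks_submatrix]

open scoped MatrixOrder in
theorem posSemidef_blocks_iff (P : T.MultOps) :
    (T.blocks P).PosSemidef ↔ ∀ γ, (P γ).PosSemidef := by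
  refine ⟨fun h γ => T.blocks_submatrix P γ ▸ h.submatrix _, fun h => ?_⟩
  choose N hN using fun γ => CStarAlgebra.nonneg_iff_eq_star_mul_self.1 (h γ).nonneg
  have hsq : T.blocks P = (T.blocks N)ᴴ * T.blocks N := by
    rw [blocks_apply, blocks_apply, Matrix.blockDiagonal'_conjTranspose,
      ← Matrix.blockDiagonal'_mul]
    simp only [Matrix.conjTranspose_kronecker, ← Matrix.mul_kronecker_mul,
      Matrix.conjTranspose_one, Matrix.one_mul, hN, Matrix.star_eq_conjTranspose]
  rw [hsq]
  exact Matrix.posSemidef_conjTranspose_mul_self _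

theorem trace_blocks (P : T.MultOps) :
    (T.blocks P).trace = ∑ γ : T.support, (dimQ γ.1 : ℂ) * (P γ).trace := by
  simp only [blocks_apply, Matrix.trace_blockDiagonal', Matrix.trace_kronecker, Matrix.trace_one,
    Fintype.card_fin]

/-- The operator `U^* (⨁_γ 1 ⊗ P_γ) U` on `R ⊗ S`, as a linear function of `P`. -/
def ofBlocks : T.MultOps →ₗ[ℂ] Matrix (m × n) (m × n) ℂ where
  toFun P := T.matᴴ * T.blocks P * T.mat
  map_add' P P' := by rw [map_add, Matrix.mul_add, Matrix.add_mul]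
  map_smul' c P := by rw [map_smul, Matrix.mul_smul, Matrix.smul_mul, RingHom.id_apply]

theorem ofBlocks_apply (P : T.MultOps) : T.ofBlocks P = T.matᴴ * T.blocks P * T.mat := rfl

theorem mat_mul_ofBlocks_mul (P : T.MultOps) : T.mat * T.ofBlocks P * T.matᴴ = T.blocks P :=
  calc T.mat * T.ofBlocks P * T.matᴴ
      = (T.mat * T.matᴴ) * T.blocks P * (T.mat * T.matᴴ) := by
        simp only [ofBlocks_apply, Matrix.mul_assoc]
    _ = T.blocks P := by rw [T.mul_conjTranspose, Matrix.one_mul, Matrix.mul_one]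

theorem eq_ofBlocks {C : Matrix (m × n) (m × n) ℂ} {P : T.MultOps}
    (h : T.mat * C * T.matᴴ = T.blocks P) : C = T.ofBlocks P :=
  calc C = (T.matᴴ * T.mat) * C * (T.matᴴ * T.mat) := by
        rw [T.conjTranspose_mul, Matrix.one_mul, Matrix.mul_one]
    _ = T.ofBlocks P := by
        rw [ofBlocks_apply, ← h]
        simp only [Matrix.mul_assoc]

theorem ofBlocks_injective : Function.Injective T.ofBlocks := by
  intro P P' h
  apply T.blocks_injective
  rw [← T.mat_mul_ofBlocks_mul P, h, T.mat_mul_ofBlocks_mul]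

theorem posSemidef_ofBlocks_iff (P : T.MultOps) :
    (T.ofBlocks P).PosSemidef ↔ ∀ γ, (P γ).PosSemidef := by
  rw [← T.posSemidef_blocks_iff]
  exact ⟨fun h => T.mat_mul_ofBlocks_mul P ▸ h.mul_mul_conjTranspose_same T.mat,
    fun h => h.conjTranspose_mul_mul_same T.mat⟩

theorem trace_ofBlocks (P : T.MultOps) :
    (T.ofBlocks P).trace = ∑ γ : T.support, (dimQ γ.1 : ℂ) * (P γ).trace := by
  rw [ofBlocks_apply, Matrix.trace_mul_cycle, T.mul_conjTranspose, Matrix.one_mul, trace_blocks]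

theorem commute_blockDiagonal'_blocks (A : ∀ γ : T.support, Matrix (Fin (dimQ γ.1)) _ ℂ)
    (P : T.MultOps) : Commute (Matrix.blockDiagonal' fun γ : T.support =>
      A γ ⊗ₖ (1 : Matrix (Fin (mult b R S γ.1)) (Fin (mult b R S γ.1)) ℂ)) (T.blocks P) := by
  simp only [Commute, SemiconjBy, blocks_apply, ← Matrix.blockDiagonal'_mul,
    ← Matrix.mul_kronecker_mul, Matrix.mul_one, Matrix.one_mul]

theorem ofBlocks_commutes (P : T.MultOps) (g : SU d) :
    tensor R S (SU.incl g) * T.ofBlocks P = T.ofBlocks P * tensor R S (SU.incl g) := by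
  have hT := T.commutes g
  have hcomm := T.commute_blockDiagonal'_blocks (fun γ => rep b γ.1 (SU.incl g)) P
  set B := Matrix.blockDiagonal' (fun γ : T.support =>
    rep b γ.1 (SU.incl g) ⊗ₖ (1 : Matrix (Fin (mult b R S γ.1)) (Fin (mult b R S γ.1)) ℂ))
  have hT' : tensor R S (SU.incl g) * T.matᴴ = T.matᴴ * B := by
    calc tensor R S (SU.incl g) * T.matᴴ
        = T.matᴴ * (T.mat * tensor R S (SU.incl g)) * T.matᴴ := by
          rw [← Matrix.mul_assoc, T.conjTranspose_mul, Matrix.one_mul]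
      _ = T.matᴴ * B := by
          rw [hT, Matrix.mul_assoc, Matrix.mul_assoc, T.mul_conjTranspose, Matrix.mul_one]
  calc tensor R S (SU.incl g) * T.ofBlocks P
      = T.matᴴ * (B * T.blocks P) * T.mat := by
        rw [ofBlocks_apply, ← Matrix.mul_assoc, ← Matrix.mul_assoc, hT', Matrix.mul_assoc T.matᴴ]
    _ = T.matᴴ * T.blocks P * (B * T.mat) := by
        rw [hcomm.eq]
        simp only [Matrix.mul_assoc]
    _ = T.ofBlocks P * tensor R S (SU.incl g) := by
        rw [← hT, ofBlocks_apply]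
        simp only [Matrix.mul_assoc]

theorem mat_mul_mul_conjTranspose_apply (C : Matrix (m × n) (m × n) ℂ) (γ γ' : T.support)
    (q : Fin (dimQ γ.1)) (q' : Fin (dimQ γ'.1)) (k : Fin (mult b R S γ.1))
    (k' : Fin (mult b R S γ'.1)) :
    (T.mat * C * T.matᴴ) ⟨γ, q, k⟩ ⟨γ', q', k'⟩ =
      ((T.family γ.1 k)ᴴ * C * T.family γ'.1 k') q q' := by
  simp [Matrix.mul_apply, family]

theorem exists_eq_ofBlocks (hs : IsSmooth (tensor R S)) (hc : HasScalarCenter (tensor R S))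
    {C : Matrix (m × n) (m × n) ℂ} (hC : C ∈ intertwiners (tensor R S) (tensor R S)) :
    ∃ P, C = T.ofBlocks P := by
  have hmem (γ γ' : T.support) k k' : (T.family γ.1 k)ᴴ * C * T.family γ'.1 k' ∈
      intertwiners (rep b γ'.1) (rep b γ.1) :=
    mul_mem_intertwiners (mul_mem_intertwiners (conjTranspose_mem_intertwiners isSmooth_rep hs
      (T.family_mem hs hc γ.1 k)) hC) (T.family_mem hs hc γ'.1 k')
  let P : T.MultOps := fun γ => Matrix.of fun k k' =>
    ((T.family γ.1 k)ᴴ * C * T.family γ.1 k').trace / dimQ γ.1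
  refine ⟨P, T.eq_ofBlocks ?_⟩
  ext ⟨γ, q, k⟩ ⟨γ', q', k'⟩
  rw [mat_mul_mul_conjTranspose_apply, blocks_apply]
  obtain rfl | hne := eq_or_ne γ γ'
  · rw [eq_trace_div_smul_one (hmem γ γ k k'), Matrix.blockDiagonal'_apply_eq,
      Matrix.kroneckerMap_apply, Matrix.smul_apply, smul_eq_mul, mul_comm]
    rfl
  · rw [schur_of_ne (Subtype.coe_ne_coe.2 hne.symm) (hmem γ γ' k k'),
      Matrix.blockDiagonal'_apply_ne _ _ _ hne, Matrix.zero_apply]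

/-- The linear map `R → S` of matrix algebras whose Choi matrix is `T.ofBlocks P`, as a function
of `P`. It is linear over `ℝ`, the field over which extreme points are taken. -/
def ofBlocksMap : T.MultOps →ₗ[ℝ] (Matrix m m ℂ →ₗ[ℂ] Matrix n n ℂ) :=
  (ofChoiEquiv.toLinearMap ∘ₗ T.ofBlocks).restrictScalars ℝ

theorem ofBlocksMap_apply (P : T.MultOps) : T.ofBlocksMap P = ofChoi (T.ofBlocks P) := rfl

theorem ofBlocksMap_injective : Function.Injective T.ofBlocksMap :=
  ofChoiEquiv.injective.comp T.ofBlocks_injective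

theorem conjTranspose_embed_apply (γ : Staircase d) (ψ : Fin (mult b R S γ) → ℂ)
    (q : Fin (dimQ γ)) (x : m × n) : (T.embed γ ψ)ᴴ q x =
      ∑ k, star (ψ k) * T.mat ⟨⟨γ, (T.mem_support γ).2 k.pos⟩, q, k⟩ x := by
  simp [embed, mul_comm]

theorem mat_mul_block_mul (γ : Staircase d) (hγ : γ ∈ labels b R S)
    (ψ : Fin (mult b R S γ) → ℂ) :
    T.matᴴ * T.block γ hγ ψ * T.mat = T.embed γ ψ * (T.embed γ ψ)ᴴ := by
  ext x y
  rw [Matrix.mul_apply, Fintype.sum_sigma,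
    Finset.sum_eq_single ⟨γ, (T.mem_support γ).2 hγ⟩]
  · have hcol (q : Fin (dimQ γ)) (k : Fin (mult b R S γ)) : (T.matᴴ * T.block γ hγ ψ) x
        ⟨⟨γ, (T.mem_support γ).2 hγ⟩, q, k⟩ = T.embed γ ψ x q * star (ψ k) := by
      rw [block, mul_blockDiagonal'_apply, Pi.single_eq_same]
      simp [Fintype.sum_prod_type, Matrix.one_apply, Matrix.vecMulVec_apply, embed,
        Finset.sum_mul, mul_assoc]
    simp only [hcol, Fintype.sum_prod_type, Matrix.mul_apply]
    refine Finset.sum_congr rfl fun q _ => ?_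
    simp only [conjTranspose_embed_apply, Finset.mul_sum, mul_assoc]
  · intro γ' _ hne
    exact Finset.sum_eq_zero fun p _ => by
      rw [block, mul_blockDiagonal'_apply, Pi.single_eq_of_ne hne]
      simp
  · exact fun h => absurd (Finset.mem_univ _) h

end CGTransform

/-! ### The extreme points of the set of equivariant channels -/

section ExtremePoints

variable {d : ℕ} {b : Bases d} {lam mu : Staircase d}

theorem ofChoi_equivariant_iff_mem_intertwiners {m n : Type} [Fintype m] [DecidableEq m]
    [Fintype n] [DecidableEq n] {R : MatRep d m} {S : MatRep d n} (hR : IsSmooth R)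
    (hS : IsSmooth S) (hc : HasScalarCenter (tensor (conjRep R) S))
    (C : Matrix (m × n) (m × n) ℂ) :
    (∀ (g : SU d) A, ofChoi C (R (SU.incl g) * A * (R (SU.incl g))ᴴ) =
        S (SU.incl g) * ofChoi C A * (S (SU.incl g))ᴴ) ↔
      C ∈ intertwiners (tensor (conjRep R) S) (tensor (conjRep R) S) := by
  have hcomm (g : SU d) := ofChoi_equivariant_iff (hR.mem_unitaryGroup (SU.incl g))
    (hS.mem_unitaryGroup (SU.incl g)) C
  exact ⟨fun h => mem_intertwiners_self_of_SU hc fun g => (hcomm g).1 (h g),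
    fun h g => (hcomm g).2 (h (SU.incl g))⟩

theorem isSmooth_conjRep_tensor : IsSmooth (tensor (conjRep (rep b lam)) (rep b mu)) :=
  isSmooth_rep.conjRep.tensor isSmooth_rep

theorem hasScalarCenter_conjRep_tensor :
    HasScalarCenter (tensor (conjRep (rep b lam)) (rep b mu)) :=
  hasScalarCenter_rep.conjRep.tensor hasScalarCenter_rep

theorem traceSnd_eq_one_iff {n : Type} [Fintype n] [DecidableEq n] {S : MatRep d n}
    {C : Matrix (Fin (dimQ lam) × n) (Fin (dimQ lam) × n) ℂ}
    (hC : C ∈ intertwiners (tensor (conjRep (rep b lam)) S) (tensor (conjRep (rep b lam)) S)) :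
    traceSnd C = 1 ↔ C.trace = dimQ lam := by
  have hscalar := eq_trace_div_smul_one_of_conjRep (traceSnd_mem_intertwiners hC)
  rw [trace_traceSnd] at hscalar
  refine ⟨fun h => ?_, fun h => ?_⟩
  · rw [← trace_traceSnd, h, Matrix.trace_one, Fintype.card_fin]
  · rw [hscalar, h, div_self (Nat.cast_ne_zero.2 (NeZero.ne _)), one_smul]

variable (T : CGTransform b (conjRep (rep b lam)) (rep b mu))

theorem trace_ofBlocks_eq_iff (P : T.MultOps) : (T.ofBlocks P).trace = dimQ lam ↔
    ∑ γ : T.support, ((dimQ γ.1 : ℝ) / dimQ lam) • (P γ).trace = 1 := by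
  have hlam : (dimQ lam : ℂ) ≠ 0 := Nat.cast_ne_zero.2 (NeZero.ne _)
  rw [T.trace_ofBlocks, ← div_eq_one_iff_eq hlam, Finset.sum_div]
  refine Eq.congr_left (Finset.sum_congr rfl fun γ _ => ?_)
  rw [Complex.real_smul]
  push_cast
  ring

theorem ofBlocksMap_mem_equivariantChannels_iff (P : T.MultOps) :
    T.ofBlocksMap P ∈ equivariantChannels (rep b lam) (rep b mu) ↔
      P ∈ normalizedFamilies (fun γ : T.support => Fin (mult b _ _ γ.1))
        (fun γ => (dimQ γ.1 : ℝ) / dimQ lam) := by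
  have hC : T.ofBlocks P ∈ intertwiners (tensor (conjRep (rep b lam)) (rep b mu))
      (tensor (conjRep (rep b lam)) (rep b mu)) :=
    mem_intertwiners_self_of_SU hasScalarCenter_conjRep_tensor (T.ofBlocks_commutes P)
  have hCP : IsCP (ofChoi (T.ofBlocks P)) ↔ ∀ γ, (P γ).PosSemidef := by
    rw [← T.posSemidef_ofBlocks_iff]
    exact ⟨fun h => choi_ofChoi (T.ofBlocks P) ▸ posSemidef_choi h, isCP_ofChoi⟩
  have hTP : (∀ A, (ofChoi (T.ofBlocks P) A).trace = A.trace) ↔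
      ∑ γ : T.support, ((dimQ γ.1 : ℝ) / dimQ lam) • (P γ).trace = 1 := by
    rw [trace_ofChoi_eq_iff, traceSnd_eq_one_iff hC, trace_ofBlocks_eq_iff]
  have hE := ofChoi_equivariant_iff_mem_intertwiners (R := rep b lam) (S := rep b mu)
    isSmooth_rep isSmooth_rep hasScalarCenter_conjRep_tensor
  rw [T.ofBlocksMap_apply]
  exact ⟨fun h => ⟨hCP.1 h.1.1, hTP.1 h.1.2⟩,
    fun h => ⟨⟨hCP.2 h.1, hTP.2 h.2⟩, (hE _).2 hC⟩⟩

theorem equivariantChannels_eq_image :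
    equivariantChannels (rep b lam) (rep b mu) = T.ofBlocksMap ''
      normalizedFamilies (fun γ : T.support => Fin (mult b _ _ γ.1))
        (fun γ => (dimQ γ.1 : ℝ) / dimQ lam) := by
  refine Set.Subset.antisymm (fun Φ hΦ => ?_) ?_
  · have hC := (ofChoi_equivariant_iff_mem_intertwiners isSmooth_rep isSmooth_rep
      hasScalarCenter_conjRep_tensor (choi Φ)).1 (by rw [ofChoi_choi]; exact hΦ.2)
    obtain ⟨P, hP⟩ := T.exists_eq_ofBlocks isSmooth_conjRep_tensor hasScalarCenter_conjRep_tensor hC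
    have hΦP : T.ofBlocksMap P = Φ := by rw [T.ofBlocksMap_apply, ← hP, ofChoi_choi]
    exact ⟨P, (ofBlocksMap_mem_equivariantChannels_iff T P).1 (hΦP.symm ▸ hΦ), hΦP⟩
  · rintro _ ⟨P, hP, rfl⟩
    exact (ofBlocksMap_mem_equivariantChannels_iff T P).2 hP

theorem extremalMap_eq_ofBlocksMap (γ : Staircase d)
    (hγ : γ ∈ labels b (conjRep (rep b lam)) (rep b mu))
    (ψ : Fin (mult b (conjRep (rep b lam)) (rep b mu) γ) → ℂ) :
    extremalMap T γ hγ ψ = T.ofBlocksMap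
      (rankOneFamily (fun γ : T.support => (dimQ γ.1 : ℝ) / dimQ lam)
        ⟨γ, (T.mem_support γ).2 hγ⟩ ψ) := by
  have hscalar : ((dimQ lam : ℂ) / dimQ γ) = (((dimQ γ : ℝ) / dimQ lam)⁻¹ : ℝ) := by
    push_cast
    rw [inv_div]
  rw [extremalMap, hscalar, T.block_eq_blocks, ← T.ofBlocks_apply, ← ofChoiEquiv_apply,
    map_smul, rankOneFamily, Pi.single_smul, map_smul, T.ofBlocksMap_apply, ofChoiEquiv_apply]
  exact algebraMap_smul ℂ ((dimQ γ : ℝ) / dimQ lam)⁻¹ _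

theorem extremePoints_equivariantChannels :
    Set.extremePoints ℝ (equivariantChannels (rep b lam) (rep b mu)) =
      {Φ | ∃ (γ : Staircase d) (hγ : γ ∈ labels b (conjRep (rep b lam)) (rep b mu))
        (ψ : Fin (mult b (conjRep (rep b lam)) (rep b mu) γ) → ℂ),
        ∑ k, ‖ψ k‖ ^ 2 = 1 ∧ Φ = extremalMap T γ hγ ψ} := by
  rw [equivariantChannels_eq_image T, extremePoints_image_of_injective _ T.ofBlocksMap_injective,
    extremePoints_normalizedFamilies fun γ =>
      div_pos (Nat.cast_pos.2 dimQ_pos) (Nat.cast_pos.2 dimQ_pos)]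
  ext Φ
  constructor
  · rintro ⟨_, ⟨γ, ψ, hψ, rfl⟩, rfl⟩
    exact ⟨γ.1, (T.mem_support γ.1).1 γ.2, ψ, (star_dotProduct_self_eq_one_iff ψ).1 hψ,
      (extremalMap_eq_ofBlocksMap T _ _ ψ).symm⟩
  · rintro ⟨γ, hγ, ψ, hψ, rfl⟩
    exact ⟨_, ⟨⟨γ, (T.mem_support γ).2 hγ⟩, ψ, (star_dotProduct_self_eq_one_iff ψ).2 hψ, rfl⟩,
      (extremalMap_eq_ofBlocksMap T γ hγ ψ).symm⟩

end ExtremePoints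

/-! ### Invariant tensors with three legs -/

section Rotations

variable {l m n : Type}

/-- Regards a tensor with three legs, two outputs and one input, as an operator from its first
output to the remaining two legs. -/
def rotate : Matrix (m × n) l ℂ ≃ₗ[ℂ] Matrix (n × l) m ℂ where
  toFun M := Matrix.of fun x i => M (i, x.1) x.2
  invFun M := Matrix.of fun x q => M (x.2, q) x.1
  map_add' _ _ := rfl
  map_smul' _ _ := rfl
  left_inv _ := rfl
  right_inv _ := rfl

/-- Exchanges the second output of a tensor with its input. The entries are conjugated, so that
only the first leg is replaced by its dual. -/
def conjSwap : Matrix (m × n) l ℂ ≃ₗ⋆[ℂ] Matrix (m × l) n ℂ where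
  toFun M := Matrix.of fun x a => star (M (x.1, a) x.2)
  invFun M := Matrix.of fun x q => star (M (x.1, q) x.2)
  map_add' _ _ := by
    ext
    exact star_add _ _
  map_smul' _ _ := by
    ext
    exact star_mul' _ _
  left_inv _ := by
    ext
    exact star_star _
  right_inv _ := by
    ext
    exact star_star _

theorem rotate_apply (M : Matrix (m × n) l ℂ) (i : m) (a : n) (q : l) :
    rotate M (a, q) i = M (i, a) q := rfl

theorem conjSwap_apply (M : Matrix (m × n) l ℂ) (i : m) (a : n) (q : l) :
    conjSwap M (i, q) a = star (M (i, a) q) := rfl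

variable [Fintype l] [Fintype m]

section

variable [Fintype n]

theorem kronecker_mul_mul_apply (r : Matrix m m ℂ) (s : Matrix n n ℂ) (M : Matrix (m × n) l ℂ)
    (p : Matrix l l ℂ) (i : m) (a : n) (q : l) : ((r ⊗ₖ s) * M * p) (i, a) q =
      ∑ i', ∑ a', ∑ q', r i i' * s a a' * M (i', a') q' * p q' q := by
  rw [Matrix.mul_assoc, Matrix.mul_apply, Fintype.sum_prod_type]
  simp only [Matrix.kroneckerMap_apply, Matrix.mul_apply, Finset.mul_sum, mul_assoc]

theorem rotate_conj (r : Matrix m m ℂ) (s : Matrix n n ℂ) (p : Matrix l l ℂ)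
    (M : Matrix (m × n) l ℂ) :
    rotate ((r.map star ⊗ₖ s) * M * pᴴ) = (s ⊗ₖ p.map star) * rotate M * rᴴ := by
  ext ⟨a, q⟩ i
  simp only [rotate_apply, kronecker_mul_mul_apply, Matrix.map_apply, Matrix.conjTranspose_apply]
  rw [Finset.sum_comm]
  refine Finset.sum_congr rfl fun a' _ => ?_
  rw [Finset.sum_comm]
  exact Finset.sum_congr rfl fun q' _ => Finset.sum_congr rfl fun i' _ => by ring

theorem conjSwap_conj (r : Matrix m m ℂ) (s : Matrix n n ℂ) (p : Matrix l l ℂ)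
    (M : Matrix (m × n) l ℂ) :
    conjSwap ((r.map star ⊗ₖ s) * M * pᴴ) = (r ⊗ₖ p) * conjSwap M * sᴴ := by
  ext ⟨i, q⟩ a
  simp only [conjSwap_apply, kronecker_mul_mul_apply, Matrix.map_apply,
    Matrix.conjTranspose_apply, star_sum, star_mul', star_star]
  refine Finset.sum_congr rfl fun i' _ => ?_
  rw [Finset.sum_comm]
  exact Finset.sum_congr rfl fun q' _ => Finset.sum_congr rfl fun a' _ => by ring

theorem trace_conjTranspose_mul (M N : Matrix m n ℂ) :
    (Mᴴ * N).trace = ∑ i, ∑ j, star (M i j) * N i j := by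
  rw [Finset.sum_comm]
  simp [Matrix.trace, Matrix.mul_apply]

theorem trace_rotate (M N : Matrix (m × n) l ℂ) :
    ((rotate M)ᴴ * rotate N).trace = (Mᴴ * N).trace := by
  simp only [trace_conjTranspose_mul, Fintype.sum_prod_type, rotate_apply]
  rw [Finset.sum_congr rfl fun a _ => Finset.sum_comm, Finset.sum_comm]

theorem trace_conjSwap (M N : Matrix (m × n) l ℂ) :
    ((conjSwap M)ᴴ * conjSwap N).trace = star (Mᴴ * N).trace := by
  simp only [trace_conjTranspose_mul, Fintype.sum_prod_type, conjSwap_apply, star_sum, star_mul',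
    star_star]
  exact Finset.sum_congr rfl fun i _ => Finset.sum_comm

end

theorem ofChoi_mul_conjTranspose_apply (K : Matrix (m × n) l ℂ) (A : Matrix m m ℂ) (a a' : n) :
    ofChoi (K * Kᴴ) A a a' = ∑ i, ∑ j, ∑ q, A i j * (K (i, a) q * star (K (j, a') q)) := by
  simp only [ofChoi_apply, Matrix.mul_apply, Matrix.conjTranspose_apply, Finset.mul_sum]

theorem ofChoi_eq_traceSnd_rotate (K : Matrix (m × n) l ℂ) (A : Matrix m m ℂ) :
    ofChoi (K * Kᴴ) A = traceSnd (rotate K * A * (rotate K)ᴴ) := by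
  ext a a'
  simp only [ofChoi_mul_conjTranspose_apply, traceSnd, Matrix.of_apply, Matrix.mul_apply,
    Matrix.conjTranspose_apply, rotate_apply, Finset.sum_mul]
  rw [Finset.sum_congr rfl fun i _ => Finset.sum_comm, Finset.sum_comm]
  refine Finset.sum_congr rfl fun q _ => ?_
  rw [Finset.sum_comm]
  exact Finset.sum_congr rfl fun j _ => Finset.sum_congr rfl fun i _ => by ring

theorem ofChoi_eq_conjSwap_compress [DecidableEq l] (K : Matrix (m × n) l ℂ)
    (A : Matrix m m ℂ) :
    ofChoi (K * Kᴴ) A = (conjSwap K)ᴴ * (A ⊗ₖ (1 : Matrix l l ℂ)) * conjSwap K := by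
  ext a a'
  rw [Matrix.mul_assoc, Matrix.mul_apply, ofChoi_mul_conjTranspose_apply]
  simp only [kronecker_one_mul_apply, Fintype.sum_prod_type, Matrix.conjTranspose_apply,
    conjSwap_apply, star_star, Finset.mul_sum]
  refine Finset.sum_congr rfl fun i _ => ?_
  rw [Finset.sum_comm]
  exact Finset.sum_congr rfl fun q _ => Finset.sum_congr rfl fun j _ => by ring

end Rotations

section Multiplicities

variable {d : ℕ} {l m n : Type} [Fintype l] [DecidableEq l] [Fintype m] [DecidableEq m]
  [Fintype n] [DecidableEq n] {A : MatRep d m} {S : MatRep d n} {P : MatRep d l}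

theorem mem_intertwiners_iff_conj (hP : IsSmooth P) {M : Matrix m l ℂ} :
    M ∈ intertwiners P A ↔ ∀ g, A g * M * (P g)ᴴ = M := by
  have hunitary (g : U d) : P g * (P g)ᴴ = 1 ∧ (P g)ᴴ * P g = 1 :=
    (Unitary.mem_iff.1 (hP.mem_unitaryGroup g)).symm
  refine forall_congr' fun g => ⟨fun h => ?_, fun h => ?_⟩
  · rw [h, Matrix.mul_assoc, (hunitary g).1, Matrix.mul_one]
  · conv_rhs => rw [← h]
    rw [Matrix.mul_assoc _ _ (P g), (hunitary g).2, Matrix.mul_one]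

theorem rotate_mem_intertwiners_iff (hA : IsSmooth A) (hP : IsSmooth P)
    {M : Matrix (m × n) l ℂ} : rotate M ∈ intertwiners A (tensor S (conjRep P)) ↔
      M ∈ intertwiners P (tensor (conjRep A) S) := by
  rw [mem_intertwiners_iff_conj hA, mem_intertwiners_iff_conj hP]
  refine forall_congr' fun g => ?_
  rw [← rotate.injective.eq_iff (b := M)]
  exact Eq.congr_left (rotate_conj (A g) (S g) (P g) M).symm

theorem conjSwap_mem_intertwiners_iff (hS : IsSmooth S) (hP : IsSmooth P)
    {M : Matrix (m × n) l ℂ} : conjSwap M ∈ intertwiners S (tensor A P) ↔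
      M ∈ intertwiners P (tensor (conjRep A) S) := by
  rw [mem_intertwiners_iff_conj hS, mem_intertwiners_iff_conj hP]
  refine forall_congr' fun g => ?_
  rw [← conjSwap.injective.eq_iff (b := M)]
  exact Eq.congr_left (conjSwap_conj (A g) (S g) (P g) M).symm

theorem finrank_eq_of_conjLinearEquiv {V W : Type} [AddCommGroup V] [Module ℂ V] [AddCommGroup W]
    [Module ℂ W] (e : V ≃ₗ⋆[ℂ] W) : Module.finrank ℂ V = Module.finrank ℂ W :=
  congrArg Cardinal.toNat <| rank_eq_of_equiv_equiv (starRingEnd ℂ) e.toAddEquiv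
    (starRingAut (R := ℂ)).bijective e.map_smulₛₗ

theorem mult_rotate (b : Bases d) (S : MatRep d n) (lam γ : Staircase d) :
    mult b S (conjRep (rep b γ)) lam = mult b (conjRep (rep b lam)) S γ := by
  have hcomap : (intertwiners (rep b lam) (tensor S (conjRep (rep b γ)))).comap
      (rotate (l := Fin (dimQ γ)) (m := Fin (dimQ lam)) (n := n)).toLinearMap =
      intertwiners (rep b γ) (tensor (conjRep (rep b lam)) S) :=
    Submodule.ext fun _ => rotate_mem_intertwiners_iff isSmooth_rep isSmooth_rep
  rw [mult, mult, ← hcomap]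
  exact (rotate.ofSubmodule' _).finrank_eq.symm

theorem mult_conjSwap (b : Bases d) (A : MatRep d m) (mu γ : Staircase d) :
    mult b A (rep b γ) mu = mult b (conjRep A) (rep b mu) γ := by
  have hcomap : (intertwiners (rep b mu) (tensor A (rep b γ))).comap
      (conjSwap (l := Fin (dimQ γ)) (m := m) (n := Fin (dimQ mu))).toLinearMap =
      intertwiners (rep b γ) (tensor (conjRep A) (rep b mu)) :=
    Submodule.ext fun _ => Submodule.mem_comap.trans
      (conjSwap_mem_intertwiners_iff isSmooth_rep isSmooth_rep)
  rw [mult, mult, ← hcomap]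
  exact (finrank_eq_of_conjLinearEquiv (conjSwap.ofSubmodule' _)).symm

end Multiplicities

section RotatedTransforms

variable {d : ℕ} {b : Bases d} {m n : Type} [Fintype m] [DecidableEq m] [Fintype n] [DecidableEq n]

theorem exists_star_mul_self_eq (p q : ℕ) : ∃ a : ℂ, star a * a = (p : ℂ) / q := by
  refine ⟨(√(p / q : ℝ) : ℝ), ?_⟩
  rw [Complex.star_def, Complex.conj_ofReal, ← Complex.ofReal_mul,
    Real.mul_self_sqrt (by positivity)]
  push_cast
  rfl

theorem IsOrthoBasis.smul_of_trace {R : MatRep d m} (hR : IsSmooth R) {γ : Staircase d} {c : ℕ}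
    {K : Fin c → Matrix m (Fin (dimQ γ)) ℂ} {a t : ℂ}
    (card : c = Module.finrank ℂ (intertwiners (rep b γ) R))
    (mem : ∀ k, K k ∈ intertwiners (rep b γ) R)
    (htrace : ∀ k l, ((K k)ᴴ * K l).trace = if k = l then t else 0)
    (ha : star a * a * t = dimQ γ) : IsOrthoBasis b R γ fun k => a • K k := by
  refine ⟨card, fun k => Submodule.smul_mem _ _ (mem k), fun k l => ?_⟩
  rw [Matrix.conjTranspose_smul, Matrix.smul_mul, Matrix.mul_smul, smul_smul,
    eq_trace_div_smul_one (conjTranspose_mul_mem_intertwiners hR (mem k) (mem l)), htrace,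
    smul_smul, ← mul_div_assoc]
  split_ifs
  · rw [ha, div_self dimQ_ne_zero, one_smul]
  · rw [mul_zero, zero_div, zero_smul]

theorem exists_CGTransform_embed_cast_eq {R : MatRep d m} {S : MatRep d n}
    (h : IsSmooth (tensor R S)) {γ : Staircase d} {c : ℕ} (hc : mult b R S γ = c)
    {K : Fin c → Matrix (m × n) (Fin (dimQ γ)) ℂ} (hK : IsOrthoBasis b (tensor R S) γ K) :
    ∃ T : CGTransform b R S, ∀ ψ : Fin c → ℂ,
      T.embed γ (fun k => ψ (Fin.cast hc k)) = ∑ k, ψ k • K k := by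
  subst hc
  exact exists_CGTransform_embed_eq h hK

namespace CGTransform

theorem trace_family {R : MatRep d m} {S : MatRep d n} (T : CGTransform b R S) (γ : Staircase d)
    (k l : Fin (mult b R S γ)) :
    ((T.family γ k)ᴴ * T.family γ l).trace = if k = l then (dimQ γ : ℂ) else 0 := by
  rw [T.family_ortho]
  split_ifs
  · rw [Matrix.trace_one, Fintype.card_fin]
  · exact Matrix.trace_zero _ _

theorem exists_embed_eq_rotate {S : MatRep d n} (hS : IsSmooth S) (hc : HasScalarCenter S)
    {lam : Staircase d} (T : CGTransform b (conjRep (rep b lam)) S) (γ : Staircase d) :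
    ∃ (T₂ : CGTransform b S (conjRep (rep b γ))) (a : ℂ), star a * a = dimQ lam / dimQ γ ∧
      ∀ ψ, T₂.embed lam (fun k => ψ (Fin.cast (mult_rotate b S lam γ) k)) =
        a • rotate (T.embed γ ψ) := by
  obtain ⟨a, ha⟩ := exists_star_mul_self_eq (dimQ lam) (dimQ γ)
  have hsmooth : IsSmooth (tensor S (conjRep (rep b γ))) := hS.tensor isSmooth_rep.conjRep
  have hK : IsOrthoBasis b (tensor S (conjRep (rep b γ))) lam
      fun k => a • rotate (T.family γ k) := by
    refine .smul_of_trace hsmooth (mult_rotate b S lam γ).symm (fun k => ?_) (fun k l => ?_)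
      (by rw [ha, div_mul_cancel₀ _ dimQ_ne_zero])
    · exact (rotate_mem_intertwiners_iff isSmooth_rep isSmooth_rep).2
        (T.family_mem (isSmooth_rep.conjRep.tensor hS) (hasScalarCenter_rep.conjRep.tensor hc) γ k)
    · rw [trace_rotate, T.trace_family]
  obtain ⟨T₂, hT₂⟩ := exists_CGTransform_embed_cast_eq hsmooth (mult_rotate b S lam γ) hK
  refine ⟨T₂, a, ha, fun ψ => ?_⟩
  simp only [hT₂, T.embed_eq_sum, map_sum, map_smul, Finset.smul_sum, smul_comm a]

theorem exists_embed_eq_conjSwap {A : MatRep d m} (hA : IsSmooth A) (hc : HasScalarCenter A)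
    {mu : Staircase d} (T : CGTransform b (conjRep A) (rep b mu)) (γ : Staircase d) :
    ∃ (T₃ : CGTransform b A (rep b γ)) (a : ℂ), star a * a = dimQ mu / dimQ γ ∧
      ∀ ψ : _ → ℂ, T₃.embed mu (fun k => star (ψ (Fin.cast (mult_conjSwap b A mu γ) k))) =
        a • conjSwap (T.embed γ ψ) := by
  obtain ⟨a, ha⟩ := exists_star_mul_self_eq (dimQ mu) (dimQ γ)
  have hsmooth : IsSmooth (tensor A (rep b γ)) := hA.tensor isSmooth_rep
  have hK : IsOrthoBasis b (tensor A (rep b γ)) mu fun k => a • conjSwap (T.family γ k) := by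
    refine .smul_of_trace hsmooth (mult_conjSwap b A mu γ).symm (fun k => ?_) (fun k l => ?_)
      (by rw [ha, div_mul_cancel₀ _ dimQ_ne_zero])
    · exact (conjSwap_mem_intertwiners_iff isSmooth_rep isSmooth_rep).2
        (T.family_mem (hA.conjRep.tensor isSmooth_rep) (hc.conjRep.tensor hasScalarCenter_rep) γ k)
    · rw [trace_conjSwap, T.trace_family, apply_ite star, star_natCast, star_zero]
  obtain ⟨T₃, hT₃⟩ := exists_CGTransform_embed_cast_eq hsmooth (mult_conjSwap b A mu γ) hK
  refine ⟨T₃, a, ha, fun ψ => (hT₃ fun k => star (ψ k)).trans ?_⟩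
  simp only [T.embed_eq_sum, map_sum, map_smulₛₗ, Finset.smul_sum, smul_comm a, starRingEnd_apply]

end CGTransform

end RotatedTransforms

/-! ### The three descriptions of the extremal channels -/

section Formulas

variable {d : ℕ} {b : Bases d} {lam mu γ : Staircase d}
  (T : CGTransform b (conjRep (rep b lam)) (rep b mu))
  (hγ : γ ∈ labels b (conjRep (rep b lam)) (rep b mu))
  (ψ : Fin (mult b (conjRep (rep b lam)) (rep b mu) γ) → ℂ)
  (A : Matrix (Fin (dimQ lam)) (Fin (dimQ lam)) ℂ)

theorem extremalMap_apply : extremalMap T γ hγ ψ A =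
    ((dimQ lam : ℂ) / dimQ γ) • ofChoi (T.embed γ ψ * (T.embed γ ψ)ᴴ) A := by
  rw [extremalMap, T.mat_mul_block_mul, ← ofChoiEquiv_apply, map_smul, ofChoiEquiv_apply,
    LinearMap.smul_apply]

theorem extremalMap_eq_traceFst : extremalMap T γ hγ ψ A =
    ((dimQ lam : ℂ) / dimQ γ) • traceFst (T.embed γ ψ * (T.embed γ ψ)ᴴ *
      (Aᵀ ⊗ₖ (1 : Matrix (Fin (dimQ mu)) (Fin (dimQ mu)) ℂ))) := by
  rw [extremalMap_apply, ofChoi_eq_traceFst]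

theorem extremalMap_eq_traceSnd {E : Matrix (Fin (dimQ mu) × Fin (dimQ γ)) (Fin (dimQ lam)) ℂ}
    {a : ℂ} (ha : star a * a = dimQ lam / dimQ γ) (hE : E = a • rotate (T.embed γ ψ)) :
    extremalMap T γ hγ ψ A = traceSnd (E * A * Eᴴ) := by
  rw [extremalMap_apply, ofChoi_eq_traceSnd_rotate, hE, ← ha]
  ext
  simp [traceSnd, Finset.mul_sum, mul_assoc]

theorem extremalMap_eq_compress {F : Matrix (Fin (dimQ lam) × Fin (dimQ γ)) (Fin (dimQ mu)) ℂ}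
    {a : ℂ} (ha : star a * a = dimQ mu / dimQ γ) (hF : F = a • conjSwap (T.embed γ ψ)) :
    extremalMap T γ hγ ψ A = ((dimQ lam : ℂ) / dimQ mu) •
      (Fᴴ * (A ⊗ₖ (1 : Matrix (Fin (dimQ γ)) (Fin (dimQ γ)) ℂ)) * F) := by
  have hscalar : (dimQ lam : ℂ) / dimQ γ = dimQ lam / dimQ mu * (star a * a) := by
    rw [ha, div_mul_div_cancel₀ dimQ_ne_zero]
  rw [extremalMap_apply, ofChoi_eq_conjSwap_compress, hscalar, hF,
    Matrix.conjTranspose_smul, Matrix.smul_mul, Matrix.smul_mul, Matrix.mul_smul, smul_smul,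
    smul_smul, mul_assoc]

end Formulas

end EquivChannel

end

open EquivChannel in
theorem mainTheorem4 (d : ℕ) (b : Bases d) (lam mu : Staircase d) :
    Nonempty (CGTransform b (conjRep (rep b lam)) (rep b mu)) ∧
    ∀ T : CGTransform b (conjRep (rep b lam)) (rep b mu),
      Set.extremePoints ℝ (equivariantChannels (rep b lam) (rep b mu)) =
        {Φ | ∃ (γ : Staircase d) (hγ : γ ∈ labels b (conjRep (rep b lam)) (rep b mu))
          (ψ : Fin (mult b (conjRep (rep b lam)) (rep b mu) γ) → ℂ),
          ∑ k, ‖ψ k‖ ^ 2 = 1 ∧ Φ = extremalMap T γ hγ ψ} ∧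
      ∀ (γ : Staircase d) (hγ : γ ∈ labels b (conjRep (rep b lam)) (rep b mu)),
        ∃ (h₂ : mult b (rep b mu) (conjRep (rep b γ)) lam =
              mult b (conjRep (rep b lam)) (rep b mu) γ)
          (h₃ : mult b (rep b lam) (rep b γ) mu =
              mult b (conjRep (rep b lam)) (rep b mu) γ)
          (T₂ : CGTransform b (rep b mu) (conjRep (rep b γ)))
          (T₃ : CGTransform b (rep b lam) (rep b γ)),
          ∀ ψ : Fin (mult b (conjRep (rep b lam)) (rep b mu) γ) → ℂ, ∑ k, ‖ψ k‖ ^ 2 = 1 →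
          ∀ A : Matrix (Fin (dimQ lam)) (Fin (dimQ lam)) ℂ,
            extremalMap T γ hγ ψ A =
              ((dimQ lam : ℂ) / (dimQ γ : ℂ)) •
                traceFst (T.embed γ ψ * (T.embed γ ψ)ᴴ *
                  (Aᵀ ⊗ₖ (1 : Matrix (Fin (dimQ mu)) (Fin (dimQ mu)) ℂ))) ∧
            extremalMap T γ hγ ψ A =
              traceSnd (T₂.embed lam (fun k => ψ (Fin.cast h₂ k)) * A *
                (T₂.embed lam (fun k => ψ (Fin.cast h₂ k)))ᴴ) ∧
            extremalMap T γ hγ ψ A =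
              ((dimQ lam : ℂ) / (dimQ mu : ℂ)) •
                ((T₃.embed mu (fun k => star (ψ (Fin.cast h₃ k))))ᴴ *
                  (A ⊗ₖ (1 : Matrix (Fin (dimQ γ)) (Fin (dimQ γ)) ℂ)) *
                  T₃.embed mu (fun k => star (ψ (Fin.cast h₃ k)))) := by
  refine ⟨exists_CGTransform b isSmooth_conjRep_tensor, fun T =>
    ⟨extremePoints_equivariantChannels T, fun γ hγ => ?_⟩⟩
  obtain ⟨T₂, a, ha, hT₂⟩ := T.exists_embed_eq_rotate isSmooth_rep hasScalarCenter_rep γ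
  obtain ⟨T₃, c, hc, hT₃⟩ := T.exists_embed_eq_conjSwap isSmooth_rep hasScalarCenter_rep γ
  exact ⟨mult_rotate b (rep b mu) lam γ, mult_conjSwap b (rep b lam) mu γ, T₂, T₃, fun ψ _ A =>
    ⟨extremalMap_eq_traceFst T hγ ψ A, extremalMap_eq_traceSnd T hγ ψ A ha (hT₂ ψ),
      extremalMap_eq_compress T hγ ψ A hc (hT₃ ψ)⟩⟩
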